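/- Let $Q=[0,1)^d$, let $Q_0$ be an open set with Lipschitz boundary and $\overline{Q}_0\subset(0,1)^d$, and put $Q_1=Q\setminus\overline{Q}_0$; assume that $\bigcup_{n\in\mathbb Z^d}(Q_1+n)$ is connected. Let $A_0,A_1$ be real symmetric $d\times d$ matrix functions on $Q$ with entries in $L^\infty(Q)$ such that, for some $\nu>0$, $A_0\ge\nu I$ a.e. on $Q$, $A_1\ge\nu I$ a.e. on $Q_1$, and $A_1=0$ a.e. on $Q_0$. For $\varkappa\in\mathbb R^d$ let $H^1_\varkappa(Q)$ be the space of (restrictions to $Q$ of) functions $u\in H^1_{\rm loc}(\mathbb R^d)$ with $u(y+n)=e^{{\rm i}\varkappa\cdot n}u(y)$ for all $n\in\mathbb Z^d$, with the norm of $H^1(Q)$, and let $H^1_0(Q_0)$ be the closure of $C_c^\infty(Q_0)$ in it. Let $d(\varkappa)={\rm dist}(\varkappa,2\pi\mathbb Z^d)$, so that $d(\varkappa)=|\varkappa|$ for $\varkappa\in[-\pi,\pi]^d$. For every $\varkappa\in\mathbb R^d\setminus 2\pi\mathbb Z^d$ and $F\in L^2(Q)$: (a) for every $\varepsilon>0$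 there is a unique $w_{\varepsilon,\varkappa}\in H^1_\varkappa(Q)$ with $-\nabla\cdot(\varepsilon^{-2}A_1+A_0)\nabla w_{\varepsilon,\varkappa}+w_{\varepsilon,\varkappa}=F$, in the weak sense with test functions in $H^1_\varkappa(Q)$; (b) there is a unique sequence $w^{(0)}_\varkappa,w^{(1)}_\varkappa,\dots$ in $H^1_\varkappa(Q)$ (the outer expansion) such that $w^{(0)}_\varkappa\in H^1_0(Q_0)$ solves the Dirichlet problem $$\int_{Q_0}\bigl(A_0\nabla w^{(0)}_\varkappa\cdot\overline{\nabla\varphi}+w^{(0)}_\varkappa\overline{\varphi}\bigr)=\int_{Q_0}F\overline{\varphi}\qquad\forall\varphi\in H^1_0(Q_0),$$ and, weakly with test functions in $H^1_\varkappa(Q)$, $-\nabla\cdot A_1\nabla w^{(1)}_\varkappa=F+\nabla\cdot A_0\nabla w^{(0)}_\varkappa-w^{(0)}_\varkappa$ and $-\nabla\cdot A_1\nabla w^{(n+1)}_\varkappa=\nabla\cdot A_0\nabla w^{(n)}_\varkappa-w^{(n)}_\varkappa$ for all $n\ge1$. Put $U^{(N)}_{\varepsilon,\varkappa}=\sum_{n=0}^N\varepsilon^{2n}w^{(n)}_\varkappa$.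 Then for every integer $N\ge1$ there is a constant $C_N>0$, independent of $\varkappa$, $\varepsilon$ and $F$, such that for all $\varkappa\in\mathbb R^d\setminus2\pi\mathbb Z^d$, $\varepsilon>0$ and $F\in L^2(Q)$ $$\bigl\|w_{\varepsilon,\varkappa}-U^{(N)}_{\varepsilon,\varkappa}\bigr\|_{H^1(Q)}\le C_N\Bigl(\frac{\varepsilon}{d(\varkappa)}\Bigr)^{2N}\|F\|_{L^2(Q)}.$$ In particular, there is a constant $C>0$, independent of $\varkappa$, $\varepsilon$ and $F$, such that $$\bigl\|w_{\varepsilon,\varkappa}-w^{(0)}_\varkappa\bigr\|_{H^1(Q)}\le C\Bigl(\frac{\varepsilon}{d(\varkappa)}\Bigr)^{2}\|F\|_{L^2(Q)}.$$ -/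

import Mathlib

open MeasureTheory Set
open scoped ContDiff

noncomputable section

namespace DoublePorosity

/-- The space `ℝ^d` with its Euclidean norm. -/
abbrev Space (d : ℕ) : Type := EuclideanSpace ℝ (Fin d)

/-- The space `ℂ^d`, in which gradients of complex-valued functions take their values. -/
abbrev CVec (d : ℕ) : Type := EuclideanSpace ℂ (Fin d)

/-- The periodicity cell `Q = [0,1)^d`. -/
def cell (d : ℕ) : Set (Space d) := {y | ∀ i, y i ∈ Ico (0 : ℝ) 1}

/-- The open cube `(0,1)^d`. -/
def openCell (d : ℕ) : Set (Space d) := {y | ∀ i, y i ∈ Ioo (0 : ℝ) 1}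

/-- Lebesgue measure on `Q`. -/
abbrev cellMeasure (d : ℕ) : Measure (Space d) := volume.restrict (cell d)

/-- The point of `ℤ^d ⊆ ℝ^d` with the given integer coordinates. -/
def latticePoint {d : ℕ} (n : Fin d → ℤ) : Space d := WithLp.toLp 2 fun i => (n i : ℝ)

/-- The dual lattice `2πℤ^d`. -/
def dualLattice (d : ℕ) : Set (Space d) :=
  {x | ∃ m : Fin d → ℤ, ∀ i, x i = 2 * Real.pi * (m i : ℝ)}

/-- The union `⋃_{n ∈ ℤ^d} (S + n)` of the integer translates of `S`. -/
def periodicUnion {d : ℕ} (S : Set (Space d)) : Set (Space d) :=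
  ⋃ n : Fin d → ℤ, (fun y => y + latticePoint n) '' S

/-- Lipschitz boundary: near each boundary point, `Ω` is the set lying below the graph of a
Lipschitz function, in the direction of some unit vector `e`. -/
def HasLipschitzBoundary {d : ℕ} (Ω : Set (Space d)) : Prop :=
  ∀ x ∈ frontier Ω, ∃ (e : Space d) (K : NNReal) (γ : Space d → ℝ) (r : ℝ),
    ‖e‖ = 1 ∧ LipschitzWith K γ ∧ 0 < r ∧
      ∀ y ∈ Metric.ball x r, (y ∈ Ω ↔ inner ℝ y e < γ (y - (inner ℝ y e : ℝ) • e))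

/-- `g` is the weak gradient of `u` on the whole of `ℝ^d`. -/
def HasWeakGradient {d : ℕ} (u : Space d → ℂ) (g : Space d → CVec d) : Prop :=
  LocallyIntegrable u volume ∧ LocallyIntegrable g volume ∧
    ∀ φ : Space d → ℂ, ContDiff ℝ ∞ φ → HasCompactSupport φ → ∀ i : Fin d,
      ∫ y, u y * fderiv ℝ φ y (EuclideanSpace.single i 1) = -∫ y, g y i * φ y

/-- `κ`-quasi-periodicity: `u(y + n) = exp(i κ·n) u(y)`, that is, `exp(-i κ·y) u(y)` is
`ℤ^d`-periodic. -/
def IsQuasiPeriodic {d : ℕ} (κ : Space d) (u : Space d → ℂ) : Prop :=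
  ∀ (n : Fin d → ℤ) (y : Space d),
    u (y + latticePoint n) = Complex.exp (Complex.I * ((∑ i, κ i * (n i : ℝ) : ℝ) : ℂ)) * u y

theorem HasWeakGradient.zero {d : ℕ} :
    HasWeakGradient (0 : Space d → ℂ) (0 : Space d → CVec d) := by
  refine ⟨locallyIntegrable_zero, locallyIntegrable_zero, ?_⟩
  intro φ _ _ i
  simp

theorem integrable_mul_fderiv {d : ℕ} {u : Space d → ℂ} (hu : LocallyIntegrable u volume)
    {φ : Space d → ℂ} (hφ : ContDiff ℝ ∞ φ) (hc : HasCompactSupport φ) (v : Space d) :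
    Integrable (fun y => u y * fderiv ℝ φ y v) volume := by
  have h1 : Continuous fun y => fderiv ℝ φ y v :=
    (hφ.continuous_fderiv (by simp)).clm_apply continuous_const
  have h2 : HasCompactSupport fun y => fderiv ℝ φ y v := hc.fderiv_apply ℝ v
  simpa [mul_comm] using hu.integrable_smul_left_of_hasCompactSupport h1 h2

theorem integrable_coord_mul {d : ℕ} {g : Space d → CVec d} (hg : LocallyIntegrable g volume)
    {φ : Space d → ℂ} (hφ : ContDiff ℝ ∞ φ) (hc : HasCompactSupport φ) (i : Fin d) :
    Integrable (fun y => g y i * φ y) volume := by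
  have h := hg.integrable_smul_left_of_hasCompactSupport hφ.continuous hc
  have h2 := (EuclideanSpace.proj (𝕜 := ℂ) i).integrable_comp h
  simpa [mul_comm] using h2

theorem HasWeakGradient.add {d : ℕ} {u v : Space d → ℂ} {g h : Space d → CVec d}
    (hu : HasWeakGradient u g) (hv : HasWeakGradient v h) :
    HasWeakGradient (u + v) (g + h) := by
  refine ⟨hu.1.add hv.1, hu.2.1.add hv.2.1, ?_⟩
  intro φ hφ hc i
  have e1 := integral_add (integrable_mul_fderiv hu.1 hφ hc (EuclideanSpace.single i 1))
    (integrable_mul_fderiv hv.1 hφ hc (EuclideanSpace.single i 1))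
  have e2 := integral_add (integrable_coord_mul hu.2.1 hφ hc i)
    (integrable_coord_mul hv.2.1 hφ hc i)
  simp only [Pi.add_apply, PiLp.add_apply, add_mul]
  rw [e1, e2, hu.2.2 φ hφ hc i, hv.2.2 φ hφ hc i, neg_add]

theorem HasWeakGradient.smul {d : ℕ} {u : Space d → ℂ} {g : Space d → CVec d} (c : ℂ)
    (hu : HasWeakGradient u g) : HasWeakGradient (c • u) (c • g) := by
  refine ⟨hu.1.smul c, hu.2.1.smul c, ?_⟩
  intro φ hφ hc i
  simp only [Pi.smul_apply, PiLp.smul_apply, smul_eq_mul, mul_assoc, integral_const_mul]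
  rw [hu.2.2 φ hφ hc i, mul_neg]

theorem IsQuasiPeriodic.add {d : ℕ} {κ : Space d} {u v : Space d → ℂ}
    (hu : IsQuasiPeriodic κ u) (hv : IsQuasiPeriodic κ v) : IsQuasiPeriodic κ (u + v) := by
  intro n y
  simp only [Pi.add_apply, hu n y, hv n y, mul_add]

theorem IsQuasiPeriodic.smul {d : ℕ} {κ : Space d} {u : Space d → ℂ} (c : ℂ)
    (hu : IsQuasiPeriodic κ u) : IsQuasiPeriodic κ (c • u) := by
  intro n y
  simp only [Pi.smul_apply, hu n y, smul_eq_mul]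
  ring

/-- The space `L²(Q)` of complex-valued functions. -/
abbrev L2 (d : ℕ) : Type := Lp ℂ 2 (cellMeasure d)

/-- The Hilbert space `L²(Q) × L²(Q)^d`, normed by `(‖u‖² + ‖g‖²)^{1/2}`. -/
abbrev L2Pair (d : ℕ) : Type := WithLp 2 (L2 d × Lp (CVec d) 2 (cellMeasure d))

/-- The space `H¹_κ(Q)`: the pairs `(u, ∇u)`, restricted to `Q`, where `u` runs through the
`κ`-quasi-periodic functions on `ℝ^d` that have a weak gradient and are square integrable
over `Q` together with it (by quasi-periodicity, these are the `κ`-quasi-periodic functions in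
`H¹_loc(ℝ^d)`). The norm inherited from `L2Pair` is the usual norm of `H¹(Q)`. -/
def H1 {d : ℕ} (κ : Space d) : Submodule ℂ (L2Pair d) where
  carrier := {p | ∃ (u : Space d → ℂ) (g : Space d → CVec d),
    IsQuasiPeriodic κ u ∧ HasWeakGradient u g ∧
      p.fst =ᵐ[cellMeasure d] u ∧ p.snd =ᵐ[cellMeasure d] g}
  zero_mem' := by
    refine ⟨0, 0, fun n y => by simp, HasWeakGradient.zero, ?_, ?_⟩
    · exact Lp.coeFn_zero _ _ _
    · exact Lp.coeFn_zero _ _ _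
  add_mem' := by
    rintro p q ⟨u, g, h1, h2, h3, h4⟩ ⟨v, h, k1, k2, k3, k4⟩
    refine ⟨u + v, g + h, h1.add k1, h2.add k2, ?_, ?_⟩
    · exact (Lp.coeFn_add _ _).trans (h3.add k3)
    · exact (Lp.coeFn_add _ _).trans (h4.add k4)
  smul_mem' := by
    rintro c p ⟨u, g, h1, h2, h3, h4⟩
    refine ⟨c • u, c • g, h1.smul c, h2.smul c, ?_, ?_⟩
    · exact (Lp.coeFn_smul _ _).trans (h3.const_smul c)
    · exact (Lp.coeFn_smul _ _).trans (h4.const_smul c)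

/-- The function underlying an element of `H¹_κ(Q)`, as an element of `L²(Q)`. -/
def fn {d : ℕ} {κ : Space d} (u : H1 κ) : L2 d := (u : L2Pair d).fst

/-- The gradient of an element of `H¹_κ(Q)`. -/
def grad {d : ℕ} {κ : Space d} (u : H1 κ) : Lp (CVec d) 2 (cellMeasure d) :=
  (u : L2Pair d).snd

/-- The space `H¹_0(Ω)`, for an open set `Ω` with closure in `(0,1)^d`, as a subset of
`H¹_κ(Q)`: the closure in the `H¹` norm of the smooth functions with compact support in `Ω`. -/
def H10 {d : ℕ} (κ : Space d) (Ω : Set (Space d)) : Set (H1 κ) :=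
  closure {u : H1 κ | ∃ φ : Space d → ℂ, ContDiff ℝ ∞ φ ∧ HasCompactSupport φ ∧
    tsupport φ ⊆ Ω ∧ fn u =ᵐ[cellMeasure d] φ}

/-- The sesquilinear form `∫_Q A ∇u · conj(∇v)`. -/
def form {d : ℕ} {κ : Space d} (A : Space d → Matrix (Fin d) (Fin d) ℝ) (u v : H1 κ) : ℂ :=
  ∫ y in cell d, ∑ i, ∑ j, ((A y i j : ℝ) : ℂ) * grad u y j * (starRingEnd ℂ) (grad v y i)

/-- The pairing `∫_Q f conj(v)`. -/
def pairing {d : ℕ} (f v : L2 d) : ℂ := ∫ y in cell d, f y * (starRingEnd ℂ) (v y)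

/-- The standing assumptions on the coefficients and on the geometry. The matrices matter only
through their values on `Q` (from which they are extended periodically). The soft component is
`Q₀`, the stiff component is `Q₁ = Q \ closure Q₀`. -/
structure Admissible {d : ℕ} (ν : ℝ) (A₀ A₁ : Space d → Matrix (Fin d) (Fin d) ℝ)
    (Q₀ : Set (Space d)) : Prop where
  nu_pos : 0 < ν
  memLp_A₀ : ∀ i j, MemLp (fun y => A₀ y i j) ⊤ (cellMeasure d)
  memLp_A₁ : ∀ i j, MemLp (fun y => A₁ y i j) ⊤ (cellMeasure d)
  symm_A₀ : ∀ᵐ y ∂(cellMeasure d), (A₀ y).IsSymm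
  symm_A₁ : ∀ᵐ y ∂(cellMeasure d), (A₁ y).IsSymm
  isOpen_soft : IsOpen Q₀
  closure_soft : closure Q₀ ⊆ openCell d
  lipschitz_soft : HasLipschitzBoundary Q₀
  connected_stiff : IsConnected (periodicUnion (cell d \ closure Q₀))
  elliptic_A₀ : ∀ᵐ y ∂(cellMeasure d), ∀ ξ : Fin d → ℝ,
    ν * (ξ ⬝ᵥ ξ) ≤ ξ ⬝ᵥ (A₀ y).mulVec ξ
  elliptic_A₁ : ∀ᵐ y ∂(cellMeasure d), y ∉ closure Q₀ → ∀ ξ : Fin d → ℝ,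
    ν * (ξ ⬝ᵥ ξ) ≤ ξ ⬝ᵥ (A₁ y).mulVec ξ
  soft_A₁ : ∀ᵐ y ∂(cellMeasure d), y ∈ Q₀ → A₁ y = 0

/-- `w ∈ H¹_κ(Q)` is the weak solution of `-∇·(ε⁻² A₁ + A₀)∇w + w = F`. -/
def IsSolution {d : ℕ} {κ : Space d} (A₀ A₁ : Space d → Matrix (Fin d) (Fin d) ℝ) (ε : ℝ)
    (F : L2 d) (w : H1 κ) : Prop :=
  ∀ φ : H1 κ, form (fun y => (ε ^ 2)⁻¹ • A₁ y + A₀ y) w φ + pairing (fn w) (fn φ) = pairing F (fn φ)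

/-- The sequence `w⁽⁰⁾, w⁽¹⁾, …` of coefficients of the outer expansion `∑ ε²ⁿ w⁽ⁿ⁾`. -/
structure IsOuterExpansion {d : ℕ} {κ : Space d} (A₀ A₁ : Space d → Matrix (Fin d) (Fin d) ℝ)
    (Q₀ : Set (Space d)) (F : L2 d) (w : ℕ → H1 κ) : Prop where
  /-- the leading term lies in `H¹_0(Q₀)`; -/
  leading_mem : w 0 ∈ H10 κ Q₀
  /-- it is the Dirichlet solution of `-∇·A₀∇w⁽⁰⁾ + w⁽⁰⁾ = F` in the soft inclusion; -/
  leading_eq : ∀ φ ∈ H10 κ Q₀, form A₀ (w 0) φ + pairing (fn (w 0)) (fn φ) = pairing F (fn φ)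
  /-- `-∇·A₁∇w⁽¹⁾ = F + ∇·A₀∇w⁽⁰⁾ - w⁽⁰⁾`; -/
  first_eq : ∀ φ : H1 κ,
    form A₁ (w 1) φ = pairing F (fn φ) - form A₀ (w 0) φ - pairing (fn (w 0)) (fn φ)
  /-- `-∇·A₁∇w⁽ⁿ⁺¹⁾ = ∇·A₀∇w⁽ⁿ⁾ - w⁽ⁿ⁾` for `n ≥ 1`. -/
  succ_eq : ∀ n : ℕ, 1 ≤ n → ∀ φ : H1 κ,
    form A₁ (w (n + 1)) φ = -form A₀ (w n) φ - pairing (fn (w n)) (fn φ)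

/-- The truncated outer expansion `U⁽ᴺ⁾ = ∑_{n ≤ N} ε²ⁿ w⁽ⁿ⁾`. -/
def truncation {d : ℕ} {κ : Space d} (ε : ℝ) (w : ℕ → H1 κ) (N : ℕ) : H1 κ :=
  ∑ n ∈ Finset.range (N + 1), ((ε ^ (2 * n) : ℝ) : ℂ) • w n

end DoublePorosity

end

/-! By Riesz representation the problem reads (ε⁻²B₁ + B₀)w = f in H¹_κ(Q), with B₁ coming from A₁
and B₀ from A₀ together with the mass term. B₀ is bounded and coercive with constants free of κ,
while B₁ is nonnegative and annihilates V = H¹₀(Q₀). All dependence on κ sits in one inequality,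
`exists_gap`: d(κ)²‖u − P_V u‖² ≤ C‖∇u‖² with the gradient taken on the stiff part Q₁ only. Thus B₁
is coercive modulo V with a constant of order d(κ)².

Given the gap, the rest is Hilbert space algebra (`IsPenaltyPair`). The equation B₁w⁽ⁿ⁺¹⁾ = −B₀w⁽ⁿ⁾
is solvable only if B₀w⁽ⁿ⁾ ⟂ V, and this condition fixes the V-component of w⁽ⁿ⁾ that the previous
equation leaves free. The same orthogonality gives c‖w⁽ⁿ⁾‖ ≤ M‖w⁽ⁿ⁾ − P_V w⁽ⁿ⁾‖, so with the gap
‖w⁽ⁿ⁾‖ is at most a constant times d(κ)⁻²‖B₁w⁽ⁿ⁾‖ (`norm_step_le`). Each term therefore costs one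
factor d(κ)⁻². Inserting the truncation into the equation telescopes to the residual ε²ᴺB₀w⁽ᴺ⁾
(`apply_truncation`), and the coercivity of ε⁻²B₁ + B₀, uniform in ε, turns the residual into the
error bound.

The gap has two ingredients. The first is a Poincaré inequality on Q₁ (`poincareOn_stiff_cell`): the
connected periodic stiff component joins x to x + n, and u(x + n) − u(x) = (exp(iκ·n) − 1)u(x), so
|exp(iκ·n) − 1|²∫|u|² over Q₁ is controlled by the stiff energy. Taking n along the coordinate axes
recovers d(κ)² (`infDist_sq_le_sum`). The second is an extension (`exists_soft_correction`):
reflecting u across the Lipschitz boundary into Q₀ changes it by an element of V and leaves an H¹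
norm controlled by u on Q₁.

Both ingredients are proved for smooth quasi-periodic functions, which are dense
(`exists_smooth_near`). The reflected functions are merely Lipschitz; `mem_H10sub_of_lipschitz`
places the correction in V by a weak-limit argument. -/

open scoped ENNReal

/-! ### Integer translates of the cell and integrals of periodic functions. -/

namespace DoublePorosity

variable {d : ℕ}

/-- The integer part of a point of `ℝ^d`. -/
noncomputable def intPart (y : Space d) : Fin d → ℤ := fun i => ⌊y i⌋

@[simp] theorem latticePoint_apply (n : Fin d → ℤ) (i : Fin d) :
    latticePoint n i = (n i : ℝ) := rfl

@[simp] theorem latticePoint_zero : latticePoint (0 : Fin d → ℤ) = 0 := by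
  ext i; simp

theorem latticePoint_add (m n : Fin d → ℤ) :
    latticePoint (m + n) = latticePoint m + latticePoint n := by
  ext i; simp

theorem latticePoint_neg (n : Fin d → ℤ) : latticePoint (-n) = -latticePoint n := by
  ext i; simp

theorem measurable_intPart : Measurable (intPart : Space d → Fin d → ℤ) := by
  refine measurable_pi_lambda _ fun i => ?_
  exact Int.measurable_floor.comp (by fun_prop)

theorem mem_cell_iff {y : Space d} : y ∈ cell d ↔ intPart y = 0 := by
  simp only [cell, mem_ofPred_eq, mem_Ico, funext_iff, intPart, Pi.zero_apply, Int.floor_eq_zero_iff]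

theorem intPart_add (y : Space d) (n : Fin d → ℤ) :
    intPart (y + latticePoint n) = intPart y + n := by
  ext i; simp [intPart]

theorem sub_mem_cell_iff {y : Space d} {n : Fin d → ℤ} :
    y - latticePoint n ∈ cell d ↔ intPart y = n := by
  rw [mem_cell_iff, sub_eq_add_neg, ← latticePoint_neg, intPart_add, ← sub_eq_add_neg, sub_eq_zero]

theorem sub_intPart_mem_cell (y : Space d) : y - latticePoint (intPart y) ∈ cell d :=
  sub_mem_cell_iff.2 rfl

theorem measurableSet_cell : MeasurableSet (cell d) := by
  have : cell d = intPart ⁻¹' {0} := by ext y; simp [mem_cell_iff]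
  rw [this]; exact measurable_intPart (measurableSet_singleton _)

theorem openCell_subset_cell : openCell d ⊆ cell d := fun _ hy i => Ioo_subset_Ico_self (hy i)

theorem isOpen_openCell : IsOpen (openCell d) := by
  simp only [openCell, ofPred_forall]
  exact isOpen_iInter_of_finite fun i => isOpen_Ioo.preimage (by fun_prop)

theorem norm_le_of_coord_abs_le {y : Space d} {r : ℝ} (hr : 0 ≤ r) (h : ∀ i, |y i| ≤ r) :
    ‖y‖ ≤ Real.sqrt d * r := by
  rw [EuclideanSpace.norm_eq]
  refine Real.sqrt_le_iff.2 ⟨by positivity, ?_⟩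
  calc ∑ i, ‖y i‖ ^ 2 ≤ ∑ _i : Fin d, r ^ 2 :=
        Finset.sum_le_sum fun i _ => by
          rw [Real.norm_eq_abs]; exact pow_le_pow_left₀ (abs_nonneg _) (h i) 2
    _ = (Real.sqrt d * r) ^ 2 := by
        rw [mul_pow, Real.sq_sqrt (Nat.cast_nonneg d)]; simp

theorem isBounded_cell : Bornology.IsBounded (cell d) := by
  refine (Metric.isBounded_closedBall (x := (0 : Space d)) (r := Real.sqrt d * 1)).subset ?_
  intro y hy
  rw [mem_closedBall_zero_iff]
  exact norm_le_of_coord_abs_le zero_le_one fun i => by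
    rw [abs_of_nonneg (hy i).1]; exact (hy i).2.le

theorem volume_cell_lt_top : volume (cell d) < ⊤ := isBounded_cell.measure_lt_top

instance : IsFiniteMeasure (cellMeasure d) := ⟨by simpa using volume_cell_lt_top⟩

/-- The lattice points whose cells meet a bounded set. -/
theorem finite_lattice_meet {A : Set (Space d)} (hA : Bornology.IsBounded A) :
    {n : Fin d → ℤ | ∃ y ∈ cell d, y + latticePoint n ∈ A}.Finite := by
  obtain ⟨R, hR⟩ := hA.subset_closedBall (0 : Space d)
  refine (Set.finite_Icc (fun _ : Fin d => -⌈R + 1⌉) (fun _ => ⌈R + 1⌉)).subset ?_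
  rintro n ⟨y, hy, hn⟩
  have h1 := hR hn
  rw [mem_closedBall_zero_iff] at h1
  have h2 : ∀ i, |y i + n i| ≤ R := fun i => by
    have := (EuclideanSpace.norm_eq (y + latticePoint n)).symm
    have h3 := PiLp.norm_apply_le (y + latticePoint n) i
    simp only [PiLp.add_apply, latticePoint_apply, Real.norm_eq_abs] at h3
    exact h3.trans h1
  rw [mem_Icc, Pi.le_def, Pi.le_def]
  refine ⟨fun i => ?_, fun i => ?_⟩
  · have h4 := abs_le.1 (h2 i)
    have h5 := (hy i).2
    have h6 : (-(⌈R + 1⌉ : ℤ) : ℝ) ≤ n i := by linarith [Int.le_ceil (R + 1)]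
    exact_mod_cast h6
  · have h4 := abs_le.1 (h2 i)
    have h5 := (hy i).1
    have h6 : (n i : ℝ) ≤ ⌈R + 1⌉ := by linarith [Int.le_ceil (R + 1)]
    exact_mod_cast h6

theorem iUnion_preimage_cell :
    (⋃ n : Fin d → ℤ, (fun y : Space d => y - latticePoint n) ⁻¹' cell d) = univ := by
  ext y; simp only [mem_iUnion, mem_preimage, mem_univ, iff_true]
  exact ⟨_, sub_intPart_mem_cell y⟩

theorem measurableSet_preimage_cell (n : Fin d → ℤ) :
    MeasurableSet ((fun y : Space d => y - latticePoint n) ⁻¹' cell d) :=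
  measurableSet_cell.preimage (by fun_prop)

theorem pairwise_disjoint_preimage_cell :
    Pairwise (Function.onFun Disjoint
      fun n : Fin d → ℤ => (fun y : Space d => y - latticePoint n) ⁻¹' cell d) := by
  intro m n hmn
  refine Set.disjoint_left.2 fun y hm hn => hmn ?_
  rw [mem_preimage, sub_mem_cell_iff] at hm hn
  exact hm.symm.trans hn

theorem setLIntegral_preimage_cell (n : Fin d → ℤ) (f : Space d → ℝ≥0∞) :
    ∫⁻ y in (fun y : Space d => y - latticePoint n) ⁻¹' cell d, f y =
      ∫⁻ y in cell d, f (y + latticePoint n) := by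
  have h := (measurePreserving_sub_right (volume : Measure (Space d)) (latticePoint n))
  have h2 := h.setLIntegral_comp_preimage_emb (MeasurableEquiv.subRight
    (latticePoint n)).measurableEmbedding (fun y => f (y + latticePoint n)) (cell d)
  simpa using h2

theorem setIntegral_preimage_cell {E : Type*} [NormedAddCommGroup E] [NormedSpace ℝ E]
    (n : Fin d → ℤ) (f : Space d → E) :
    ∫ y in (fun y : Space d => y - latticePoint n) ⁻¹' cell d, f y =
      ∫ y in cell d, f (y + latticePoint n) := by
  have h := (measurePreserving_sub_right (volume : Measure (Space d)) (latticePoint n))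
  have h2 := h.setIntegral_preimage_emb (MeasurableEquiv.subRight
    (latticePoint n)).measurableEmbedding (fun y => f (y + latticePoint n)) (cell d)
  simpa using h2

theorem hasSum_integral_cell {E : Type*} [NormedAddCommGroup E] [NormedSpace ℝ E]
    {f : Space d → E} (hf : Integrable f) :
    HasSum (fun n : Fin d → ℤ => ∫ y in cell d, f (y + latticePoint n)) (∫ y, f y) := by
  have h := hasSum_integral_iUnion (μ := volume) (f := f) measurableSet_preimage_cell
    pairwise_disjoint_preimage_cell hf.integrableOn
  rw [iUnion_preimage_cell, setIntegral_univ] at h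
  simpa only [setIntegral_preimage_cell] using h

/-- A function on `ℝ^d` invariant under integer translations. -/
def IsPeriodic {β : Type*} (F : Space d → β) : Prop :=
  ∀ (n : Fin d → ℤ) (y : Space d), F (y + latticePoint n) = F y

/-- The integral of a periodic function over a bounded set is controlled by that over the cell. -/
theorem exists_setLIntegral_le_cell {A : Set (Space d)} (hA : Bornology.IsBounded A) :
    ∃ N : ℕ, ∀ F : Space d → ℝ≥0∞, IsPeriodic F →
      ∫⁻ y in A, F y ≤ N * ∫⁻ y in cell d, F y := by
  classical
  set S := (finite_lattice_meet hA).toFinset with hS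
  refine ⟨S.card, fun F hF => ?_⟩
  have hsub : A ⊆ ⋃ n ∈ S, (fun y : Space d => y - latticePoint n) ⁻¹' cell d := by
    intro y hy
    simp only [mem_iUnion]
    refine ⟨intPart y, ?_, sub_intPart_mem_cell y⟩
    rw [hS, Set.Finite.mem_toFinset]
    exact ⟨_, sub_intPart_mem_cell y, by simpa using hy⟩
  calc ∫⁻ y in A, F y
      ≤ ∫⁻ y in ⋃ n ∈ S, (fun y : Space d => y - latticePoint n) ⁻¹' cell d, F y :=
        lintegral_mono_set hsub
    _ ≤ ∑ n ∈ S, ∫⁻ y in (fun y : Space d => y - latticePoint n) ⁻¹' cell d, F y := by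
        rw [lintegral_biUnion_finset _ (fun n _ => measurableSet_preimage_cell n)]
        exact fun m _ n _ h => pairwise_disjoint_preimage_cell h
    _ = S.card * ∫⁻ y in cell d, F y := by
        simp_rw [setLIntegral_preimage_cell, hF _ _]
        simp

/-- Countably many translates of the cell cover the space, and a countable union of null sets is
null. -/
theorem ae_of_ae_cell {p : Space d → Prop} (hp : ∀ᵐ y ∂cellMeasure d, p y)
    (hper : ∀ (n : Fin d → ℤ) (y : Space d), p y → p (y + latticePoint n)) : ∀ᵐ y, p y := by
  have h1 : ∀ n : Fin d → ℤ, ∀ᵐ y : Space d, y - latticePoint n ∈ cell d → p y := by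
    intro n
    have h2 := (ae_restrict_iff' measurableSet_cell).1 hp
    have h3 := (measurePreserving_sub_right (volume : Measure (Space d))
      (latticePoint n)).quasiMeasurePreserving.ae h2
    filter_upwards [h3] with y hy hc
    simpa using hper n _ (hy hc)
  filter_upwards [ae_all_iff.2 h1] with y hy
  exact hy _ (sub_intPart_mem_cell y)

end DoublePorosity

/-! ### Quasi-periodic extension and completeness of H¹_κ(Q). -/

namespace DoublePorosity

variable {d : ℕ}

/-- The quasi-periodicity factor `exp(i κ·n)`. -/
noncomputable def phase (κ : Space d) (n : Fin d → ℤ) : ℂ :=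
  Complex.exp (Complex.I * ((∑ i, κ i * (n i : ℝ) : ℝ) : ℂ))

@[simp] theorem norm_phase (κ : Space d) (n : Fin d → ℤ) : ‖phase κ n‖ = 1 := by
  rw [phase, mul_comm, Complex.norm_exp_ofReal_mul_I]

@[simp] theorem phase_zero (κ : Space d) : phase κ 0 = 1 := by simp [phase]

theorem phase_add (κ : Space d) (m n : Fin d → ℤ) :
    phase κ (m + n) = phase κ m * phase κ n := by
  rw [phase, phase, phase, ← Complex.exp_add]
  congr 1
  simp only [Pi.add_apply, Int.cast_add, mul_add, Finset.sum_add_distrib, Complex.ofReal_add]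

/-- The quasi-periodic extension of the restriction of a function to the cell. -/
noncomputable def qpExt {E : Type*} [SMul ℂ E] (κ : Space d) (f : Space d → E) (y : Space d) : E :=
  phase κ (intPart y) • f (y - latticePoint (intPart y))

section Ext
variable {E : Type*} [NormedAddCommGroup E]

theorem locallyIntegrable_of_periodic_norm {f : Space d → E} (hm : AEStronglyMeasurable f)
    (hp : IsPeriodic fun y => ‖f y‖) (hi : IntegrableOn f (cell d)) : LocallyIntegrable f := by
  rw [locallyIntegrable_iff]
  intro K hK
  refine ⟨hm.restrict, ?_⟩
  obtain ⟨N, hN⟩ := exists_setLIntegral_le_cell hK.isBounded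
  refine (hN (fun y => ‖f y‖ₑ) fun n y => ?_).trans_lt ?_
  · have := hp n y
    simp only [enorm_eq_nnnorm, ENNReal.coe_inj]
    exact NNReal.eq this
  · exact ENNReal.mul_lt_top (ENNReal.natCast_lt_top N) hi.2

variable [NormedSpace ℂ E]

theorem qpExt_of_mem {κ : Space d} {f : Space d → E} {y : Space d} (hy : y ∈ cell d) :
    qpExt κ f y = f y := by
  rw [qpExt, mem_cell_iff.1 hy]; simp

theorem qpExt_add (κ : Space d) (f : Space d → E) (n : Fin d → ℤ) (y : Space d) :
    qpExt κ f (y + latticePoint n) = phase κ n • qpExt κ f y := by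
  rw [qpExt, qpExt, intPart_add, phase_add, smul_smul, mul_comm, latticePoint_add]
  congr 2; abel

theorem isQuasiPeriodic_qpExt (κ : Space d) (f : Space d → ℂ) : IsQuasiPeriodic κ (qpExt κ f) :=
  fun n y => qpExt_add κ f n y

theorem stronglyMeasurable_qpExt {f : Space d → E} (hf : StronglyMeasurable f) (κ : Space d) :
    StronglyMeasurable (qpExt κ f) := by
  refine StronglyMeasurable.smul ?_ (hf.comp_measurable ?_)
  · exact (measurable_of_countable (phase κ)).stronglyMeasurable.comp_measurable measurable_intPart
  · exact measurable_id.sub ((measurable_of_countable latticePoint).comp measurable_intPart)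

theorem locallyIntegrable_qpExt {f : Space d → E} (hf : StronglyMeasurable f)
    (hi : IntegrableOn f (cell d)) (κ : Space d) : LocallyIntegrable (qpExt κ f) := by
  refine locallyIntegrable_of_periodic_norm (stronglyMeasurable_qpExt hf κ).aestronglyMeasurable
    (fun n y => ?_) ?_
  · simp only [qpExt_add, norm_smul, norm_phase, one_mul]
  · exact hi.congr_fun (fun y hy => (qpExt_of_mem hy).symm) measurableSet_cell
end Ext

/-- The fundamental lemma of the calculus of variations, applied with real test functions. It yields
the uniqueness of weak gradients. -/
theorem HasWeakGradient.ae_eq_zero {u : Space d → ℂ} {g : Space d → CVec d}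
    (h : HasWeakGradient u g) (hu : u =ᵐ[volume] 0) : g =ᵐ[volume] 0 := by
  refine ae_eq_zero_of_integral_contDiff_smul_eq_zero h.2.1 fun φ hφ hc => ?_
  have hφ' : ContDiff ℝ ∞ fun y => (φ y : ℂ) := Complex.ofRealCLM.contDiff.comp hφ
  have hc' : HasCompactSupport fun y => (φ y : ℂ) := hc.comp_left (g := fun x : ℝ => (x : ℂ)) (by simp)
  have hint : Integrable (fun y => φ y • g y) :=
    h.2.1.integrable_smul_left_of_hasCompactSupport hφ.continuous hc
  ext i
  have h1 := h.2.2 _ hφ' hc' i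
  have h2 : ∫ y, u y * fderiv ℝ (fun y => (φ y : ℂ)) y (EuclideanSpace.single i 1) = 0 := by
    rw [integral_eq_zero_of_ae]
    filter_upwards [hu] with y hy; simp [hy]
  rw [h2, eq_comm, neg_eq_zero] at h1
  have h3 := (EuclideanSpace.proj (𝕜 := ℂ) i).integral_comp_comm hint
  change ∫ y, (φ y • g y) i = _ at h3
  change (∫ y, φ y • g y) i = 0
  rw [← h1]; refine h3.symm.trans ?_
  refine integral_congr_ae (.of_forall fun y => ?_)
  simp [mul_comm]

theorem HasWeakGradient.ae_unique {u : Space d → ℂ} {g g' : Space d → CVec d}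
    (h : HasWeakGradient u g) (h' : HasWeakGradient u g') : g =ᵐ[volume] g' := by
  have h1 := (h.add (h'.smul (-1))).ae_eq_zero (.of_forall fun y => by simp)
  filter_upwards [h1] with y hy
  simpa [← sub_eq_add_neg, sub_eq_zero] using hy

theorem locallyIntegrable_comp_add {E : Type*} [NormedAddCommGroup E] {f : Space d → E}
    (hf : LocallyIntegrable f) (a : Space d) : LocallyIntegrable fun y => f (y + a) := by
  have h := locallyIntegrable_map_homeomorph (Homeomorph.addRight a) (f := f)
    (μ := (volume : Measure (Space d)))
  rw [show Measure.map (Homeomorph.addRight a) (volume : Measure (Space d)) = volume from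
    (measurePreserving_add_right volume a).map_eq] at h
  exact h.1 hf

theorem HasWeakGradient.translate {u : Space d → ℂ} {g : Space d → CVec d}
    (h : HasWeakGradient u g) (a : Space d) :
    HasWeakGradient (fun y => u (y + a)) (fun y => g (y + a)) := by
  refine ⟨locallyIntegrable_comp_add h.1 a, locallyIntegrable_comp_add h.2.1 a, ?_⟩
  intro φ hφ hc i
  have h1 := h.2.2 (fun y => φ (y - a)) (hφ.comp (contDiff_id.sub contDiff_const))
    (hc.comp_homeomorph (Homeomorph.subRight a)) i
  rw [← integral_add_right_eq_self _ a, ← integral_add_right_eq_self (fun y => g y i * _) a] at h1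
  simpa [fderiv_comp_sub] using h1

/-- The definition of `H1` asks only `u` to be quasi-periodic. The gradient inherits the property
because the translated and the multiplied gradients both belong to the same function. -/
theorem HasWeakGradient.ae_quasiPeriodic {κ : Space d} {u : Space d → ℂ} {g : Space d → CVec d}
    (h : HasWeakGradient u g) (hu : IsQuasiPeriodic κ u) (n : Fin d → ℤ) :
    ∀ᵐ y, g (y + latticePoint n) = phase κ n • g y := by
  have h1 := h.translate (latticePoint n)
  have h2 := h.smul (phase κ n)
  have : (fun y => u (y + latticePoint n)) = phase κ n • u := funext fun y => hu n y
  rw [this] at h1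
  exact h1.ae_unique h2

/-- The weak gradient relation between quasi-periodic functions, expressed on the cell. -/
def CellWeakGradient (κ : Space d) (f : Space d → ℂ) (g : Space d → CVec d) : Prop :=
  ∀ φ : Space d → ℂ, ContDiff ℝ ∞ φ → HasCompactSupport φ → ∀ i : Fin d,
    ∑' n : Fin d → ℤ, phase κ n * ∫ y in cell d, f y *
        fderiv ℝ φ (y + latticePoint n) (EuclideanSpace.single i 1) =
      -∑' n : Fin d → ℤ, phase κ n * ∫ y in cell d, g y i * φ (y + latticePoint n)

/-- Cutting the integral over ℝ^d into translated cells pulls the phases out of `f`, so only the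
values of `f` on the cell remain. -/
theorem tsum_phase_integral {κ : Space d} {f ψ : Space d → ℂ}
    (hf : ∀ n : Fin d → ℤ, ∀ᵐ y, f (y + latticePoint n) = phase κ n * f y)
    (hi : Integrable fun y => f y * ψ y) :
    ∑' n : Fin d → ℤ, phase κ n * ∫ y in cell d, f y * ψ (y + latticePoint n) =
      ∫ y, f y * ψ y := by
  rw [← (hasSum_integral_cell hi).tsum_eq]
  refine tsum_congr fun n => ?_
  rw [← integral_const_mul]
  refine integral_congr_ae (ae_restrict_of_ae ?_)
  filter_upwards [hf n] with y hy
  rw [hy, mul_assoc]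

theorem HasWeakGradient.cellWeakGradient {κ : Space d} {u : Space d → ℂ} {g : Space d → CVec d}
    (h : HasWeakGradient u g) (hu : IsQuasiPeriodic κ u) : CellWeakGradient κ u g := by
  intro φ hφ hc i
  rw [tsum_phase_integral (ψ := fun y => fderiv ℝ φ y (EuclideanSpace.single i 1))
      (fun n => .of_forall (hu n)) (integrable_mul_fderiv h.1 hφ hc _),
    tsum_phase_integral (f := fun y => g y i) _ (integrable_coord_mul h.2.1 hφ hc i),
    h.2.2 φ hφ hc i]
  intro n
  filter_upwards [h.ae_quasiPeriodic hu n] with y hy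
  simp [hy]

theorem CellWeakGradient.hasWeakGradient_qpExt {κ : Space d} {f : Space d → ℂ}
    {g : Space d → CVec d} (h : CellWeakGradient κ f g) (hf : StronglyMeasurable f)
    (hg : StronglyMeasurable g) (hfi : IntegrableOn f (cell d)) (hgi : IntegrableOn g (cell d)) :
    HasWeakGradient (qpExt κ f) (qpExt κ g) := by
  have h1 := locallyIntegrable_qpExt hf hfi κ
  have h2 := locallyIntegrable_qpExt hg hgi κ
  refine ⟨h1, h2, fun φ hφ hc i => ?_⟩
  have h3 := h φ hφ hc i
  rw [← tsum_phase_integral (ψ := fun y => fderiv ℝ φ y (EuclideanSpace.single i 1))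
      (fun n => .of_forall (qpExt_add κ f n)) (integrable_mul_fderiv h1 hφ hc _),
    ← tsum_phase_integral (κ := κ) (f := fun y => qpExt κ g y i) _
      (integrable_coord_mul h2 hφ hc i)]
  · convert h3 using 4 with n n
    · exact setIntegral_congr_fun measurableSet_cell fun y hy => by simp only [qpExt_of_mem hy]
    · congr 1
      exact setIntegral_congr_fun measurableSet_cell fun y hy => by simp only [qpExt_of_mem hy]
  · intro n
    exact .of_forall fun y => by simp [qpExt_add]

theorem CellWeakGradient.congr {κ : Space d} {f f' : Space d → ℂ} {g g' : Space d → CVec d}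
    (h : CellWeakGradient κ f g) (hf : f =ᵐ[cellMeasure d] f') (hg : g =ᵐ[cellMeasure d] g') :
    CellWeakGradient κ f' g' := by
  intro φ hφ hc i
  convert h φ hφ hc i using 4 with n n
  · exact integral_congr_ae (by filter_upwards [hf] with y hy; rw [hy])
  · congr 1
    exact integral_congr_ae (by filter_upwards [hg] with y hy; rw [hy])

theorem MemLp.integrableOn_cell {E : Type*} [NormedAddCommGroup E] {f : Space d → E}
    (hf : MemLp f 2 (cellMeasure d)) : IntegrableOn f (cell d) :=
  hf.integrable (by norm_num)

/-- This trades the existential over global representatives for a family of linear equations in the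
pair itself, from which closedness can be read off. The representatives are recovered by `qpExt`. -/
theorem mem_H1_iff {κ : Space d} {p : L2Pair d} :
    p ∈ H1 κ ↔ CellWeakGradient κ p.fst p.snd := by
  constructor
  · rintro ⟨u, g, h1, h2, h3, h4⟩
    exact (h2.cellWeakGradient h1).congr h3.symm h4.symm
  · intro h
    refine ⟨qpExt κ p.fst, qpExt κ p.snd, isQuasiPeriodic_qpExt _ _,
      h.hasWeakGradient_qpExt (Lp.stronglyMeasurable _) (Lp.stronglyMeasurable _)
      (MemLp.integrableOn_cell (Lp.memLp _)) (MemLp.integrableOn_cell (Lp.memLp _)), ?_, ?_⟩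
    · filter_upwards [ae_restrict_mem measurableSet_cell] with y hy using (qpExt_of_mem hy).symm
    · filter_upwards [ae_restrict_mem measurableSet_cell] with y hy using (qpExt_of_mem hy).symm

theorem exists_finset_lattice {φ : Space d → ℂ} (hc : HasCompactSupport φ) :
    ∃ S : Finset (Fin d → ℤ), ∀ n ∉ S, ∀ y ∈ cell d, φ (y + latticePoint n) = 0 ∧
      fderiv ℝ φ (y + latticePoint n) = 0 := by
  have hfin := finite_lattice_meet (IsCompact.isBounded hc)
  refine ⟨hfin.toFinset, fun n hn y hy => ?_⟩
  have h1 : y + latticePoint n ∉ tsupport φ := fun h =>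
    hn (hfin.mem_toFinset.2 ⟨y, hy, h⟩)
  exact ⟨image_eq_zero_of_notMem_tsupport h1, image_eq_zero_of_notMem_tsupport
    fun h => h1 (tsupport_fderiv_subset ℝ h)⟩

/-- Integration against a bounded continuous function, as a functional on `L²(Q)`. -/
theorem continuous_integral_mul {ψ : Space d → ℂ} (hψ : Continuous ψ) {C : ℝ}
    (hC : ∀ y, ‖ψ y‖ ≤ C) : Continuous fun f : L2 d => ∫ y in cell d, f y * ψ y := by
  have hm : MemLp (fun y => (starRingEnd ℂ) (ψ y)) 2 (cellMeasure d) :=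
    MemLp.of_bound (Complex.continuous_conj.comp hψ).aestronglyMeasurable C
      (.of_forall fun y => by simpa using hC y)
  have h : (fun f : L2 d => ∫ y in cell d, f y * ψ y) = fun f => inner ℂ (hm.toLp _) f := by
    ext f
    rw [L2.inner_def]
    refine integral_congr_ae ?_
    filter_upwards [hm.coeFn_toLp] with y hy
    simp [hy, RCLike.inner_apply]
  rw [h]
  fun_prop

theorem continuous_integral_coord_mul {ψ : Space d → ℂ} (hψ : Continuous ψ) {C : ℝ}
    (hC : ∀ y, ‖ψ y‖ ≤ C) (i : Fin d) :
    Continuous fun f : Lp (CVec d) 2 (cellMeasure d) => ∫ y in cell d, f y i * ψ y := by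
  have h1 := (continuous_integral_mul hψ hC).comp
    ((EuclideanSpace.proj (𝕜 := ℂ) i).compLpL 2 (cellMeasure d)).continuous
  refine h1.congr fun f => integral_congr_ae ?_
  filter_upwards [(EuclideanSpace.proj (𝕜 := ℂ) i).coeFn_compLpL f] with y hy
  rw [hy]; rfl

/-- Each test function imposes an equality of two functionals. Compact support leaves finitely many
lattice terms in each series, so both functionals are continuous. -/
theorem isClosed_H1 (κ : Space d) : IsClosed (H1 κ : Set (L2Pair d)) := by
  have h : (H1 κ : Set (L2Pair d)) = {p | CellWeakGradient κ p.fst p.snd} :=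
    Set.ext fun p => mem_H1_iff
  rw [h]
  simp only [CellWeakGradient, Set.ofPred_forall]
  refine isClosed_iInter fun φ => isClosed_iInter fun hφ => isClosed_iInter fun hc =>
    isClosed_iInter fun i => ?_
  obtain ⟨S, hS⟩ := exists_finset_lattice hc
  have hdφ : Continuous fun y => fderiv ℝ φ y (EuclideanSpace.single i 1) :=
    (hφ.continuous_fderiv (by simp)).clm_apply continuous_const
  have hdc : HasCompactSupport fun y => fderiv ℝ φ y (EuclideanSpace.single i 1) :=
    hc.fderiv_apply ℝ _
  obtain ⟨C, hC⟩ := hc.exists_bound_of_continuous hφ.continuous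
  obtain ⟨C', hC'⟩ := hdc.exists_bound_of_continuous hdφ
  have e1 : ∀ p : L2Pair d, ∑' n : Fin d → ℤ, phase κ n * ∫ y in cell d, p.fst y *
        fderiv ℝ φ (y + latticePoint n) (EuclideanSpace.single i 1) =
      ∑ n ∈ S, phase κ n * ∫ y in cell d, p.fst y *
        fderiv ℝ φ (y + latticePoint n) (EuclideanSpace.single i 1) := by
    intro p
    refine tsum_eq_sum fun n hn => ?_
    rw [setIntegral_eq_zero_of_forall_eq_zero, mul_zero]
    intro y hy; simp [(hS n hn y hy).2]
  have e2 : ∀ p : L2Pair d, ∑' n : Fin d → ℤ, phase κ n * ∫ y in cell d, p.snd y i *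
        φ (y + latticePoint n) =
      ∑ n ∈ S, phase κ n * ∫ y in cell d, p.snd y i * φ (y + latticePoint n) := by
    intro p
    refine tsum_eq_sum fun n hn => ?_
    rw [setIntegral_eq_zero_of_forall_eq_zero, mul_zero]
    intro y hy; simp [(hS n hn y hy).1]
  simp only [e1, e2]
  refine isClosed_eq ?_ ?_
  · refine continuous_finsetSum _ fun n _ => continuous_const.mul ?_
    exact (continuous_integral_mul (hdφ.comp (continuous_add_const _)) fun y => hC' _).comp
      (WithLp.continuous_fst ..)
  · refine (continuous_finsetSum _ fun n _ => continuous_const.mul ?_).neg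
    exact (continuous_integral_coord_mul (hφ.continuous.comp (continuous_add_const _))
      (fun y => hC _) i).comp (WithLp.continuous_snd ..)

instance (κ : Space d) : CompleteSpace (H1 κ) := (isClosed_H1 κ).completeSpace_coe

/-- A function vanishing on the cell vanishes on ℝ^d by quasi-periodicity, and then so does its weak
gradient. This lets `H10` be described through `fn` alone, and it supplies the injective operator
for the weak-limit argument. -/
theorem fn_injective {κ : Space d} : Function.Injective (fn : H1 κ → L2 d) := by
  suffices h : ∀ p : H1 κ, fn p = 0 → p = 0 by
    intro p q hpq
    have : fn (p - q) = fn p - fn q := rfl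
    exact sub_eq_zero.1 (h _ (by rw [this, hpq, sub_self]))
  intro p hp
  obtain ⟨u, g, h1, h2, h3, h4⟩ := p.2
  have hu : u =ᵐ[volume] 0 := by
    refine ae_of_ae_cell (p := fun y => u y = 0) ?_ fun n y hy => by rw [h1 n y, hy, mul_zero]
    have h5 : (fn p : Space d → ℂ) =ᵐ[cellMeasure d] 0 := by rw [hp]; exact Lp.coeFn_zero _ _ _
    filter_upwards [h3, h5] with y hy hy'
    rw [← hy]; exact hy'
  have hg := h2.ae_eq_zero hu
  have h6 : grad p = 0 := by
    refine Lp.ext ?_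
    filter_upwards [h4, ae_restrict_of_ae hg, Lp.coeFn_zero (CVec d) 2 (cellMeasure d)]
      with y hy hy' hy''
    rw [hy'', grad, hy, hy']
  exact Subtype.ext ((WithLp.ext_iff ..).2 (Prod.ext hp h6))

end DoublePorosity

/-! ### Lipschitz functions as elements of H¹_κ(Q), and H¹₀ as a closed subspace. -/

namespace DoublePorosity

variable {d : ℕ}

/-- The classical gradient, as a vector of partial derivatives. -/
noncomputable def gradVec (u : Space d → ℂ) (y : Space d) : CVec d :=
  WithLp.toLp 2 fun i => fderiv ℝ u y (EuclideanSpace.single i 1)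

@[simp] theorem gradVec_apply (u : Space d → ℂ) (y : Space d) (i : Fin d) :
    gradVec u y i = fderiv ℝ u y (EuclideanSpace.single i 1) := rfl

theorem norm_gradVec_le (u : Space d → ℂ) (y : Space d) :
    ‖gradVec u y‖ ≤ Real.sqrt d * ‖fderiv ℝ u y‖ := by
  rw [EuclideanSpace.norm_eq]
  refine Real.sqrt_le_iff.2 ⟨by positivity, ?_⟩
  calc ∑ i, ‖gradVec u y i‖ ^ 2 ≤ ∑ _i : Fin d, ‖fderiv ℝ u y‖ ^ 2 :=
        Finset.sum_le_sum fun i _ => by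
          refine pow_le_pow_left₀ (norm_nonneg _) ?_ 2
          simpa using (fderiv ℝ u y).le_opNorm (EuclideanSpace.single i 1)
    _ = (Real.sqrt d * ‖fderiv ℝ u y‖) ^ 2 := by
        rw [mul_pow, Real.sq_sqrt (Nat.cast_nonneg d)]; simp

theorem fderiv_apply_eq_sum (u : Space d → ℂ) (y v : Space d) :
    fderiv ℝ u y v = ∑ i, (v i : ℂ) * gradVec u y i := by
  have h : v = ∑ i, v i • EuclideanSpace.single i (1 : ℝ) := by
    ext j; simp [Pi.single_apply]
  conv_lhs => rw [h]
  rw [map_sum]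
  simp

theorem norm_fderiv_le_gradVec (u : Space d → ℂ) (y : Space d) :
    ‖fderiv ℝ u y‖ ≤ ‖gradVec u y‖ := by
  refine ContinuousLinearMap.opNorm_le_bound _ (norm_nonneg _) fun v => ?_
  rw [fderiv_apply_eq_sum]
  have h := norm_inner_le_norm (𝕜 := ℂ) (WithLp.toLp 2 fun i => (v i : ℂ) : CVec d) (gradVec u y)
  have h2 : ‖(WithLp.toLp 2 fun i => (v i : ℂ) : CVec d)‖ = ‖v‖ := by
    rw [EuclideanSpace.norm_eq, EuclideanSpace.norm_eq]; simp
  rw [h2, mul_comm] at h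
  have h3 : ∑ i, (v i : ℂ) * gradVec u y i =
      inner ℂ (WithLp.toLp 2 fun i => (v i : ℂ) : CVec d) (gradVec u y) := by
    rw [PiLp.inner_apply]
    exact Finset.sum_congr rfl fun i _ => by simp [mul_comm]
  rw [h3]; exact h

theorem measurable_gradVec (u : Space d → ℂ) : Measurable (gradVec u) := by
  refine (PiLp.continuous_toLp 2 _).measurable.comp (measurable_pi_lambda _ fun i => ?_)
  exact measurable_fderiv_apply_const ℝ u _

theorem continuous_gradVec {u : Space d → ℂ} (hu : ContDiff ℝ 1 u) : Continuous (gradVec u) := by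
  refine (PiLp.continuous_toLp 2 _).comp (continuous_pi fun i => ?_)
  exact (hu.continuous_fderiv (by simp)).clm_apply continuous_const

theorem exists_H1 {κ : Space d} {f : Space d → ℂ} {g : Space d → CVec d}
    (h : CellWeakGradient κ f g) (hf : MemLp f 2 (cellMeasure d)) (hg : MemLp g 2 (cellMeasure d)) :
    ∃ p : H1 κ, fn p =ᵐ[cellMeasure d] f ∧ grad p =ᵐ[cellMeasure d] g :=
  ⟨⟨WithLp.toLp 2 (hf.toLp f, hg.toLp g), mem_H1_iff.2
    (h.congr hf.coeFn_toLp.symm hg.coeFn_toLp.symm)⟩, hf.coeFn_toLp, hg.coeFn_toLp⟩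

theorem hasWeakGradient_of_contDiff {u : Space d → ℂ} (hu : ContDiff ℝ 1 u) :
    HasWeakGradient u (gradVec u) := by
  refine ⟨hu.continuous.locallyIntegrable, (continuous_gradVec hu).locallyIntegrable, ?_⟩
  intro φ hφ hc i
  refine integral_mul_fderiv_eq_neg_fderiv_mul_of_integrable ?_ ?_ ?_ ?_ ?_
  · exact integrable_coord_mul (continuous_gradVec hu).locallyIntegrable hφ hc i
  · exact integrable_mul_fderiv hu.continuous.locallyIntegrable hφ hc _
  · exact (hu.continuous.mul hφ.continuous).integrable_of_hasCompactSupport hc.mul_left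
  · exact fun x _ => hu.differentiable (by simp) x
  · exact fun x _ => hφ.differentiable (by simp) x

section Lipschitz

/-- By Rademacher the line derivatives of Lipschitz functions agree almost everywhere with the
Fréchet derivatives, so integration by parts for the former carries over. -/
theorem integral_fderiv_mul_real {a c : Space d → ℝ} {K L : NNReal} (ha : LipschitzWith K a)
    (hc : LipschitzWith L c) (hcc : HasCompactSupport c) (v : Space d) :
    ∫ y, fderiv ℝ a y v * c y = -∫ y, a y * fderiv ℝ c y v := by
  have h := ha.integral_lineDeriv_mul_eq (μ := volume) hc hcc v
  have e1 : ∫ y, fderiv ℝ a y v * c y = ∫ y, lineDeriv ℝ a y v * c y := by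
    refine integral_congr_ae ?_
    filter_upwards [ha.ae_differentiableAt] with y hy
    rw [hy.lineDeriv_eq_fderiv]
  rw [e1, h, ← integral_neg]
  refine integral_congr_ae ?_
  filter_upwards [hc.ae_differentiableAt] with y hy
  rw [hy.lineDeriv_eq_fderiv, map_neg]; ring

theorem integrable_fderiv_mul_real {a c : Space d → ℝ} {K : NNReal} (ha : LipschitzWith K a)
    (hc : Continuous c) (hcc : HasCompactSupport c) (v : Space d) :
    Integrable fun y => fderiv ℝ a y v * c y := by
  refine (hc.integrable_of_hasCompactSupport hcc).bdd_mul (c := K * ‖v‖)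
    (measurable_fderiv_apply_const ℝ a v).aestronglyMeasurable (.of_forall fun y => ?_)
  exact ((fderiv ℝ a y).le_opNorm v).trans
    (mul_le_mul_of_nonneg_right (norm_fderiv_le_of_lipschitz ℝ ha) (norm_nonneg _))

theorem integrable_mul_fderiv_real {a c : Space d → ℝ} (ha : Continuous a)
    (hc : ContDiff ℝ 1 c) (hcc : HasCompactSupport c) (v : Space d) :
    Integrable fun y => a y * fderiv ℝ c y v :=
  (ha.mul ((hc.continuous_fderiv (by simp)).clm_apply
    continuous_const)).integrable_of_hasCompactSupport (hcc.fderiv_apply ℝ v).mul_left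

theorem integral_fderiv_mul {u φ : Space d → ℂ} {K : NNReal} (hu : LipschitzWith K u)
    (hφ : ContDiff ℝ 1 φ) (hc : HasCompactSupport φ) (v : Space d) :
    ∫ y, fderiv ℝ u y v * φ y = -∫ y, u y * fderiv ℝ φ y v := by
  obtain ⟨L, hL⟩ := hφ.lipschitzWith_of_hasCompactSupport hc (by simp)
  have hre : LipschitzWith 1 Complex.re := LipschitzWith.of_dist_le_mul fun x y => by
    simpa [Real.dist_eq, Complex.dist_eq] using Complex.abs_re_le_norm (x - y)
  have him : LipschitzWith 1 Complex.im := LipschitzWith.of_dist_le_mul fun x y => by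
    simpa [Real.dist_eq, Complex.dist_eq] using Complex.abs_im_le_norm (x - y)
  have fre : ∀ {w : Space d → ℂ} {y}, DifferentiableAt ℝ w y →
      fderiv ℝ (fun y => (w y).re) y v = (fderiv ℝ w y v).re := fun {w y} hw => by
    have := (Complex.reCLM.hasFDerivAt.comp y hw.hasFDerivAt).fderiv
    exact congrArg (fun l : Space d →L[ℝ] ℝ => l v) this
  have fim : ∀ {w : Space d → ℂ} {y}, DifferentiableAt ℝ w y →
      fderiv ℝ (fun y => (w y).im) y v = (fderiv ℝ w y v).im := fun {w y} hw => by
    have := (Complex.imCLM.hasFDerivAt.comp y hw.hasFDerivAt).fderiv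
    exact congrArg (fun l : Space d →L[ℝ] ℝ => l v) this
  have ure := hre.comp hu
  have uim := him.comp hu
  have φre := hre.comp hL
  have φim := him.comp hL
  have cre : HasCompactSupport (Complex.re ∘ φ) := hc.comp_left rfl
  have cim : HasCompactSupport (Complex.im ∘ φ) := hc.comp_left rfl
  have dre : ContDiff ℝ 1 (Complex.re ∘ φ) := Complex.reCLM.contDiff.comp hφ
  have dim : ContDiff ℝ 1 (Complex.im ∘ φ) := Complex.imCLM.contDiff.comp hφ
  have I1 := integrable_fderiv_mul_real ure φre.continuous cre v
  have I2 := integrable_fderiv_mul_real uim φim.continuous cim v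
  have I3 := integrable_fderiv_mul_real ure φim.continuous cim v
  have I4 := integrable_fderiv_mul_real uim φre.continuous cre v
  have J1 := integrable_mul_fderiv_real ure.continuous dre cre v
  have J2 := integrable_mul_fderiv_real uim.continuous dim cim v
  have J3 := integrable_mul_fderiv_real ure.continuous dim cim v
  have J4 := integrable_mul_fderiv_real uim.continuous dre cre v
  have E1 := integral_fderiv_mul_real ure φre cre v
  have E2 := integral_fderiv_mul_real uim φim cim v
  have E3 := integral_fderiv_mul_real ure φim cim v
  have E4 := integral_fderiv_mul_real uim φre cre v
  -- The real formula is applied to the four products of real and imaginary parts, and these are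
  -- then reassembled.
  have L1 : ∫ y, fderiv ℝ u y v * φ y =
      ((∫ y, fderiv ℝ (Complex.re ∘ u) y v * (Complex.re ∘ φ) y) -
        ∫ y, fderiv ℝ (Complex.im ∘ u) y v * (Complex.im ∘ φ) y : ℝ) +
      ((∫ y, fderiv ℝ (Complex.re ∘ u) y v * (Complex.im ∘ φ) y) +
        ∫ y, fderiv ℝ (Complex.im ∘ u) y v * (Complex.re ∘ φ) y : ℝ) * Complex.I := by
    rw [← integral_sub I1 I2, ← integral_add I3 I4, ← integral_complex_ofReal,
      ← integral_complex_ofReal, ← integral_mul_const, ← integral_add (I1.sub I2).ofReal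
        ((I3.add I4).ofReal.mul_const _)]
    refine integral_congr_ae ?_
    filter_upwards [hu.ae_differentiableAt] with y hy
    have r1 : fderiv ℝ (Complex.re ∘ u) y v = (fderiv ℝ u y v).re := fre hy
    have r2 : fderiv ℝ (Complex.im ∘ u) y v = (fderiv ℝ u y v).im := fim hy
    rw [r1, r2]
    apply Complex.ext <;> simp
  have L2 : ∫ y, u y * fderiv ℝ φ y v =
      ((∫ y, (Complex.re ∘ u) y * fderiv ℝ (Complex.re ∘ φ) y v) -
        ∫ y, (Complex.im ∘ u) y * fderiv ℝ (Complex.im ∘ φ) y v : ℝ) +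
      ((∫ y, (Complex.re ∘ u) y * fderiv ℝ (Complex.im ∘ φ) y v) +
        ∫ y, (Complex.im ∘ u) y * fderiv ℝ (Complex.re ∘ φ) y v : ℝ) * Complex.I := by
    rw [← integral_sub J1 J2, ← integral_add J3 J4, ← integral_complex_ofReal,
      ← integral_complex_ofReal, ← integral_mul_const, ← integral_add (J1.sub J2).ofReal
        ((J3.add J4).ofReal.mul_const _)]
    refine integral_congr_ae (.of_forall fun y => ?_)
    have hy := hφ.differentiable (by simp) y
    have r1 : fderiv ℝ (Complex.re ∘ φ) y v = (fderiv ℝ φ y v).re := fre hy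
    have r2 : fderiv ℝ (Complex.im ∘ φ) y v = (fderiv ℝ φ y v).im := fim hy
    simp only [r1, r2]
    apply Complex.ext <;> simp
  rw [L1, L2, E1, E2, E3, E4]
  push_cast; ring

theorem memLp_gradVec_of_lipschitz {u : Space d → ℂ} {K : NNReal} (hu : LipschitzWith K u) :
    MemLp (gradVec u) 2 (cellMeasure d) :=
  MemLp.of_bound (measurable_gradVec u).aestronglyMeasurable (Real.sqrt d * K)
    (.of_forall fun y => (norm_gradVec_le u y).trans
      (mul_le_mul_of_nonneg_left (norm_fderiv_le_of_lipschitz ℝ hu) (by positivity)))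

theorem setIntegral_cell_eq {f : Space d → ℂ} (hf : ∀ y ∉ cell d, f y = 0) :
    ∫ y in cell d, f y = ∫ y, f y := setIntegral_eq_integral_of_forall_compl_eq_zero hf

/-- With the support inside the open cell, every cell integral is an integral over ℝ^d, and the
identity holds for each lattice term separately. The phases play no role, so every κ is allowed. -/
theorem cellWeakGradient_of_lipschitz (κ : Space d) {u : Space d → ℂ} {K : NNReal}
    (hu : LipschitzWith K u) (hs : tsupport u ⊆ openCell d) :
    CellWeakGradient κ u (gradVec u) := by
  intro φ hφ hc i
  rw [← tsum_neg]
  refine tsum_congr fun n => ?_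
  rw [← mul_neg]
  congr 1
  have h1 : ∀ y ∉ cell d, u y = 0 := fun y hy => image_eq_zero_of_notMem_tsupport
    fun h => hy (openCell_subset_cell (hs h))
  have h2 : ∀ y ∉ cell d, fderiv ℝ u y = 0 := fun y hy => image_eq_zero_of_notMem_tsupport
    fun h => hy (openCell_subset_cell (hs (tsupport_fderiv_subset ℝ h)))
  rw [setIntegral_cell_eq fun y hy => by rw [h1 y hy, zero_mul],
    setIntegral_cell_eq fun y hy => by simp [h2 y hy]]
  have h3 := integral_fderiv_mul hu (φ := fun y => φ (y + latticePoint n))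
    ((hφ.comp (contDiff_id.add contDiff_const)).of_le (by simp))
    (hc.comp_homeomorph (Homeomorph.addRight (latticePoint n))) (EuclideanSpace.single i 1)
  simp only [fderiv_comp_add_right] at h3
  simp only [gradVec_apply, h3, neg_neg]

end Lipschitz

theorem hasCompactSupport_of_tsupport_subset {u : Space d → ℂ} (hs : tsupport u ⊆ openCell d) :
    HasCompactSupport u :=
  Metric.isCompact_of_isClosed_isBounded (isClosed_tsupport u)
    (isBounded_cell.subset (hs.trans openCell_subset_cell))

theorem exists_H1_of_lipschitz (κ : Space d) {u : Space d → ℂ} {K : NNReal}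
    (hu : LipschitzWith K u) (hs : tsupport u ⊆ openCell d) :
    ∃ p : H1 κ, fn p =ᵐ[cellMeasure d] u ∧ grad p =ᵐ[cellMeasure d] gradVec u := by
  refine exists_H1 (cellWeakGradient_of_lipschitz κ hu hs) ?_ (memLp_gradVec_of_lipschitz hu)
  obtain ⟨C, hC⟩ := (hasCompactSupport_of_tsupport_subset hs).exists_bound_of_continuous
    hu.continuous
  exact MemLp.of_bound hu.continuous.aestronglyMeasurable C (.of_forall hC)

/-- The function underlying an element of `H¹_κ(Q)`, as a continuous linear map. -/
noncomputable def fnL (κ : Space d) : H1 κ →L[ℂ] L2 d :=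
  (WithLp.fstL 2 ℂ (L2 d) (Lp (CVec d) 2 (cellMeasure d))).comp (H1 κ).subtypeL

@[simp] theorem fnL_apply {κ : Space d} (u : H1 κ) : fnL κ u = fn u := rfl

/-- The gradient of an element of `H¹_κ(Q)`, as a continuous linear map. -/
noncomputable def gradL (κ : Space d) : H1 κ →L[ℂ] Lp (CVec d) 2 (cellMeasure d) :=
  (WithLp.sndL 2 ℂ (L2 d) (Lp (CVec d) 2 (cellMeasure d))).comp (H1 κ).subtypeL

theorem norm_sq_H1 {κ : Space d} (u : H1 κ) : ‖u‖ ^ 2 = ‖fn u‖ ^ 2 + ‖grad u‖ ^ 2 :=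
  WithLp.prod_norm_sq_eq_of_L2 (u : L2Pair d)

theorem norm_fn_le {κ : Space d} (u : H1 κ) : ‖fn u‖ ≤ ‖u‖ := by
  have := norm_sq_H1 u
  exact le_of_sq_le_sq (by nlinarith [sq_nonneg ‖grad u‖]) (norm_nonneg _)

theorem norm_grad_le {κ : Space d} (u : H1 κ) : ‖grad u‖ ≤ ‖u‖ := by
  have := norm_sq_H1 u
  exact le_of_sq_le_sq (by nlinarith [sq_nonneg ‖fn u‖]) (norm_nonneg _)

theorem norm_le_add {κ : Space d} (u : H1 κ) : ‖u‖ ≤ ‖fn u‖ + ‖grad u‖ := by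
  have := norm_sq_H1 u
  exact le_of_sq_le_sq (by nlinarith [norm_nonneg (fn u), norm_nonneg (grad u)]) (by positivity)

/-- The functions in `H¹_κ(Q)` given on `Q` by smooth functions with compact support in `Ω`. -/
noncomputable def smoothCompact (κ : Space d) (Ω : Set (Space d)) : Submodule ℂ (H1 κ) where
  carrier := {u | ∃ φ : Space d → ℂ, ContDiff ℝ ∞ φ ∧ HasCompactSupport φ ∧
    tsupport φ ⊆ Ω ∧ fn u =ᵐ[cellMeasure d] φ}
  zero_mem' := ⟨0, contDiff_const, HasCompactSupport.zero, by simp [tsupport],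
    Lp.coeFn_zero _ _ _⟩
  add_mem' := by
    rintro u v ⟨φ, h1, h2, h3, h4⟩ ⟨ψ, k1, k2, k3, k4⟩
    refine ⟨φ + ψ, h1.add k1, h2.add k2, ?_, (Lp.coeFn_add _ _).trans (h4.add k4)⟩
    exact (tsupport_add φ ψ).trans (union_subset h3 k3)
  smul_mem' := by
    rintro c u ⟨φ, h1, h2, h3, h4⟩
    refine ⟨c • φ, contDiff_const.smul h1, h2.smul_left (f := fun _ => c), ?_,
      (Lp.coeFn_smul _ _).trans (h4.const_smul c)⟩
    exact (tsupport_smul_subset_right (fun _ => c) φ).trans h3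

/-- The space `H¹_0(Ω)` as a closed subspace. -/
noncomputable def H10sub (κ : Space d) (Ω : Set (Space d)) : Submodule ℂ (H1 κ) :=
  (smoothCompact κ Ω).topologicalClosure

theorem isClosed_H10sub (κ : Space d) (Ω : Set (Space d)) :
    IsClosed (H10sub κ Ω : Set (H1 κ)) := Submodule.isClosed_topologicalClosure _

/-- The classical gradient defines an element of `H1 κ` with the same underlying function, and
`fn_injective` identifies the two. -/
theorem grad_ae_eq_of_smoothCompact {κ : Space d} {u : H1 κ} {φ : Space d → ℂ}
    (hφ : ContDiff ℝ 1 φ) (hs : tsupport φ ⊆ openCell d)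
    (hu : fn u =ᵐ[cellMeasure d] φ) : grad u =ᵐ[cellMeasure d] gradVec φ := by
  obtain ⟨L, hL⟩ := hφ.lipschitzWith_of_hasCompactSupport
    (hasCompactSupport_of_tsupport_subset hs) (by simp)
  obtain ⟨p, hp, hp'⟩ := exists_H1_of_lipschitz κ hL hs
  have : u = p := fn_injective (Lp.ext (hu.trans hp.symm))
  rw [this]; exact hp'

end DoublePorosity

/-! ### Weak limits, mollification, and Lipschitz functions in H¹₀. -/

namespace DoublePorosity

variable {d : ℕ}

/-- A bounded sequence of a closed subspace, whose images under an injective operator converge to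
the image of `x`, has `x` as its weak limit; hence `x` lies in the subspace. -/
theorem mem_of_bounded_of_tendsto {H W : Type*} [NormedAddCommGroup H] [InnerProductSpace ℂ H]
    [CompleteSpace H] [NormedAddCommGroup W] [InnerProductSpace ℂ W] [CompleteSpace W]
    {S : Submodule ℂ H} (hS : IsClosed (S : Set H)) (T : H →L[ℂ] W) (hT : Function.Injective T)
    {s : ℕ → H} {x : H} {C : ℝ} (hs : ∀ k, s k ∈ S) (hC : ∀ k, ‖s k‖ ≤ C)
    (hlim : Filter.Tendsto (fun k => T (s k)) Filter.atTop (nhds (T x))) : x ∈ S := by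
  have : CompleteSpace S := hS.completeSpace_coe
  rw [← Submodule.orthogonal_orthogonal S, Submodule.mem_orthogonal]
  intro z hz
  -- Injectivity of `T` is density of the range of its adjoint, so pairing with `z` is nearly a
  -- pairing that factors through `T`.
  have hdense : (ContinuousLinearMap.adjoint T).range.topologicalClosure = ⊤ := by
    rw [Submodule.topologicalClosure_eq_top_iff, ContinuousLinearMap.orthogonal_range,
      ContinuousLinearMap.adjoint_adjoint]
    exact LinearMap.ker_eq_bot.2 hT
  have hC0 : 0 ≤ C := (norm_nonneg _).trans (hC 0)
  have key : ∀ ε > 0, ‖inner ℂ z x‖ ≤ ε * (‖x‖ + C) := by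
    intro ε hε
    have hz' : z ∈ closure ((ContinuousLinearMap.adjoint T).range : Set H) := by
      rw [← Submodule.topologicalClosure_coe, hdense]; trivial
    obtain ⟨_, ⟨y, rfl⟩, hy⟩ := Metric.mem_closure_iff.1 hz' ε hε
    have hlim' : Filter.Tendsto (fun k => ε * (‖x‖ + C) + ‖y‖ * ‖T x - T (s k)‖) Filter.atTop
        (nhds (ε * (‖x‖ + C) + ‖y‖ * 0)) := by
      refine tendsto_const_nhds.add (tendsto_const_nhds.mul ?_)
      simpa using (tendsto_const_nhds.sub hlim).norm (a := T x - T x)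
    rw [mul_zero, add_zero] at hlim'
    refine ge_of_tendsto hlim' (.of_forall fun k => ?_)
    -- Since `z ⟂ s k`, subtracting `s k` is free. The first term is small by density and
    -- boundedness, the second by convergence of the images.
    have e1 : inner ℂ z x = inner ℂ (z - ContinuousLinearMap.adjoint T y) (x - s k) +
        inner ℂ y (T x - T (s k)) := by
      rw [← map_sub, ← ContinuousLinearMap.adjoint_inner_left, ← inner_add_left, sub_add_cancel,
        inner_sub_right, Submodule.inner_left_of_mem_orthogonal (hs k) hz, sub_zero]
    rw [e1]
    refine (norm_add_le _ _).trans (add_le_add ?_ (norm_inner_le_norm _ _))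
    refine (norm_inner_le_norm _ _).trans ?_
    rw [dist_eq_norm] at hy
    exact mul_le_mul hy.le ((norm_sub_le _ _).trans (by gcongr; exact hC k)) (norm_nonneg _) hε.le
  have h0 : ‖inner ℂ z x‖ ≤ 0 := by
    refine le_of_forall_pos_le_add fun ε hε => ?_
    have h1 : 0 < ‖x‖ + C + 1 := by positivity
    have h2 := key (ε / (‖x‖ + C + 1)) (by positivity)
    rw [zero_add]
    refine h2.trans ?_
    rw [div_mul_eq_mul_div, div_le_iff₀ h1]
    nlinarith
  exact norm_le_zero_iff.1 h0

section Mollify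

variable {E : Type*} [NormedAddCommGroup E] [NormedSpace ℝ E]

/-- Convolution with a smooth bump function of integral one. -/
noncomputable def mollify (ρ : ContDiffBump (0 : Space d)) (f : Space d → E) : Space d → E :=
  convolution (ρ.normed volume) f (ContinuousLinearMap.lsmul ℝ ℝ) volume

theorem mollify_apply (ρ : ContDiffBump (0 : Space d)) (f : Space d → E) (x : Space d) :
    mollify ρ f x = ∫ t, ρ.normed volume t • f (x - t) := rfl

theorem integrable_mollify (ρ : ContDiffBump (0 : Space d)) {f : Space d → E}
    (hf : LocallyIntegrable f) (x : Space d) :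
    Integrable fun t => ρ.normed volume t • f (x - t) :=
  ρ.hasCompactSupport_normed.convolutionExists_left (ContinuousLinearMap.lsmul ℝ ℝ)
    ρ.continuous_normed hf x

theorem contDiff_mollify [CompleteSpace E] (ρ : ContDiffBump (0 : Space d)) {f : Space d → E}
    (hf : LocallyIntegrable f) : ContDiff ℝ ∞ (mollify ρ f) :=
  ρ.hasCompactSupport_normed.contDiff_convolution_left _ ρ.contDiff_normed hf

theorem lipschitzWith_mollify (ρ : ContDiffBump (0 : Space d)) {f : Space d → E} {K : NNReal}
    (hf : LipschitzWith K f) : LipschitzWith K (mollify ρ f) := by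
  refine LipschitzWith.of_dist_le_mul fun x y => ?_
  have hl := hf.continuous.locallyIntegrable (μ := (volume : Measure (Space d)))
  rw [dist_eq_norm, mollify_apply, mollify_apply,
    ← integral_sub (integrable_mollify ρ hl x) (integrable_mollify ρ hl y)]
  have h1 : ∀ t, ‖ρ.normed volume t • f (x - t) - ρ.normed volume t • f (y - t)‖ ≤
      ρ.normed volume t * (K * dist x y) := by
    intro t
    rw [← smul_sub, norm_smul, Real.norm_of_nonneg (ρ.nonneg_normed t), ← dist_eq_norm]
    refine mul_le_mul_of_nonneg_left ?_ (ρ.nonneg_normed t)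
    simpa using hf.dist_le_mul (x - t) (y - t)
  refine (norm_integral_le_of_norm_le (ρ.integrable_normed.mul_const _) (.of_forall h1)).trans ?_
  rw [integral_mul_const, ρ.integral_normed, one_mul]

theorem norm_mollify_sub_le [CompleteSpace E] (ρ : ContDiffBump (0 : Space d)) {f : Space d → E}
    {K : NNReal} (hf : LipschitzWith K f) (x : Space d) :
    ‖mollify ρ f x - f x‖ ≤ K * ρ.rOut := by
  rw [← dist_eq_norm]
  refine ρ.dist_normed_convolution_le hf.continuous.aestronglyMeasurable fun y hy => ?_
  exact (hf.dist_le_mul y x).trans (mul_le_mul_of_nonneg_left (Metric.mem_ball.1 hy).le K.2)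

theorem exists_of_mollify_ne_zero {ρ : ContDiffBump (0 : Space d)} {f : Space d → E} {x : Space d}
    (h : mollify ρ f x ≠ 0) : ∃ y, dist x y < ρ.rOut ∧ f y ≠ 0 := by
  by_contra! hc
  refine h ?_
  rw [mollify_apply, integral_eq_zero_of_ae (.of_forall fun t => ?_)]
  by_cases ht : t ∈ Metric.ball (0 : Space d) ρ.rOut
  · have := hc (x - t) (by simpa [dist_eq_norm] using ht)
    simp [this]
  · rw [← ρ.support_normed_eq (μ := volume), Function.notMem_support] at ht
    simp [ht]

end Mollify

/-- Soft thresholding on the real line. -/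
noncomputable def softReal (δ x : ℝ) : ℝ := max (x - δ) 0 - max (-x - δ) 0

/-- Soft thresholding of the real and imaginary parts. -/
noncomputable def soft (δ : ℝ) (z : ℂ) : ℂ := softReal δ z.re + softReal δ z.im * Complex.I

theorem abs_softReal_sub_self_le {δ : ℝ} (hδ : 0 ≤ δ) (x : ℝ) : |softReal δ x - x| ≤ δ := by
  unfold softReal
  rw [abs_le]
  rcases max_cases (x - δ) 0 with h | h <;> rcases max_cases (-x - δ) 0 with h' | h' <;>
    constructor <;> linarith

theorem abs_softReal_sub_le (δ x y : ℝ) : |softReal δ x - softReal δ y| ≤ 2 * |x - y| := by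
  have h1 := abs_max_sub_max_le_abs (x - δ) (y - δ) 0
  have h2 := abs_max_sub_max_le_abs (-x - δ) (-y - δ) 0
  have h3 : |x - δ - (y - δ)| = |x - y| := by ring_nf
  have h4 : |-x - δ - (-y - δ)| = |x - y| := by rw [abs_sub_comm x y]; ring_nf
  unfold softReal
  calc _ = |(max (x - δ) 0 - max (y - δ) 0) - (max (-x - δ) 0 - max (-y - δ) 0)| := by ring_nf
    _ ≤ _ := abs_sub _ _
    _ ≤ _ := by linarith

theorem softReal_eq_zero {δ x : ℝ} (h : |x| ≤ δ) : softReal δ x = 0 := by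
  rw [abs_le] at h
  rw [softReal, max_eq_right (by linarith), max_eq_right (by linarith), sub_zero]

theorem norm_soft_sub_self_le {δ : ℝ} (hδ : 0 ≤ δ) (z : ℂ) : ‖soft δ z - z‖ ≤ 2 * δ := by
  refine (Complex.norm_le_abs_re_add_abs_im _).trans ?_
  have h1 := abs_softReal_sub_self_le hδ z.re
  have h2 := abs_softReal_sub_self_le hδ z.im
  simp only [soft, Complex.sub_re, Complex.add_re, Complex.ofReal_re, Complex.mul_re,
    Complex.I_re, Complex.ofReal_im, Complex.I_im, Complex.sub_im, Complex.add_im, Complex.mul_im]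
  ring_nf at h1 h2 ⊢
  linarith

theorem lipschitzWith_soft (δ : ℝ) : LipschitzWith 4 (soft δ) := by
  refine LipschitzWith.of_dist_le_mul fun z w => ?_
  rw [dist_eq_norm, dist_eq_norm]
  refine (Complex.norm_le_abs_re_add_abs_im _).trans ?_
  have h1 := abs_softReal_sub_le δ z.re w.re
  have h2 := abs_softReal_sub_le δ z.im w.im
  have h3 := Complex.abs_re_le_norm (z - w)
  have h4 := Complex.abs_im_le_norm (z - w)
  simp only [Complex.sub_re, Complex.sub_im] at h3 h4
  simp only [soft, Complex.sub_re, Complex.add_re, Complex.ofReal_re, Complex.mul_re,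
    Complex.I_re, Complex.ofReal_im, Complex.I_im, Complex.sub_im, Complex.add_im, Complex.mul_im,
    NNReal.coe_ofNat]
  ring_nf at h1 h2 ⊢
  linarith

theorem lt_norm_of_soft_ne_zero {δ : ℝ} {z : ℂ} (h : soft δ z ≠ 0) : δ < ‖z‖ := by
  by_contra! hc
  exact h (by simp [soft, softReal_eq_zero ((Complex.abs_re_le_norm z).trans hc),
    softReal_eq_zero ((Complex.abs_im_le_norm z).trans hc)])

/-- A Lipschitz function vanishing off an open set is a uniform limit of smooth, uniformly Lipschitz
functions with support in the set. -/
theorem exists_smooth_approx {Ω : Set (Space d)} {u : Space d → ℂ} {K : NNReal}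
    (hu : LipschitzWith K u) (hv : ∀ y ∉ Ω, u y = 0) {δ : ℝ} (hδ : 0 < δ) :
    ∃ φ : Space d → ℂ, ContDiff ℝ ∞ φ ∧ tsupport φ ⊆ Ω ∧ LipschitzWith (4 * K) φ ∧
      ∀ y, ‖φ y - u y‖ ≤ 4 * δ := by
  have hK : (0 : ℝ) < 4 * K + 1 := by positivity
  -- Thresholding kills `u` where |u| ≤ δ. With K·r ≤ δ/2, mollifying at radius `r` reaches only
  -- points where |u| ≥ δ/2, a closed set inside `Ω`; the factor 4K also covers the Lipschitz
  -- constant of the thresholded function in the error bound.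
  set r : ℝ := δ / (4 * K + 1) / 2 with hr
  have hr0 : 0 < r := by positivity
  have hKr : (4 * K + 1) * r = δ / 2 := by rw [hr]; field_simp
  let ρ : ContDiffBump (0 : Space d) := ⟨r / 2, r, by positivity, by linarith⟩
  have hw : LipschitzWith (4 * K) fun y => soft δ (u y) := (lipschitzWith_soft δ).comp hu
  refine ⟨mollify ρ fun y => soft δ (u y), contDiff_mollify ρ hw.continuous.locallyIntegrable, ?_,
    lipschitzWith_mollify ρ hw, fun y => ?_⟩
  · have hcl : IsClosed {y | δ / 2 ≤ ‖u y‖} := isClosed_le continuous_const hu.continuous.norm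
    have hsub : {y | δ / 2 ≤ ‖u y‖} ⊆ Ω := fun y hy => by
      by_contra hc
      have : δ / 2 ≤ ‖u y‖ := hy
      rw [hv y hc, norm_zero] at this
      linarith
    refine (closure_minimal (fun x hx => ?_) hcl).trans hsub
    obtain ⟨y, hy, hy'⟩ := exists_of_mollify_ne_zero hx
    have h1 := lt_norm_of_soft_ne_zero hy'
    have h2 := hu.dist_le_mul y x
    rw [dist_comm y x, dist_eq_norm] at h2
    have h3 : dist x y < r := hy
    have h4 : (K : ℝ) * dist x y ≤ K * r := mul_le_mul_of_nonneg_left h3.le K.2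
    have h5 := norm_le_norm_add_norm_sub' (u y) (u x)
    have h6 : (0 : ℝ) ≤ K * r := by positivity
    change δ / 2 ≤ ‖u x‖
    nlinarith
  · have h1 := norm_mollify_sub_le ρ hw y
    have h2 := norm_soft_sub_self_le hδ.le (u y)
    have h3 := norm_sub_le_norm_sub_add_norm_sub (mollify ρ (fun y => soft δ (u y)) y)
      (soft δ (u y)) (u y)
    have h4 : ((4 * K : NNReal) : ℝ) * ρ.rOut = 4 * K * r := by push_cast; rfl
    rw [h4] at h1
    nlinarith

theorem norm_Lp_le_of_bound {E : Type*} [NormedAddCommGroup E] {f : Lp E 2 (cellMeasure d)} {C : ℝ}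
    (hC : 0 ≤ C) (h : ∀ᵐ y ∂cellMeasure d, ‖f y‖ ≤ C) :
    ‖f‖ ≤ Real.sqrt (volume.real (cell d)) * C := by
  have := Lp.norm_le_of_ae_bound hC h
  rw [Real.sqrt_eq_rpow]
  simp only [ENNReal.toReal_ofNat, measureUnivNNReal, Measure.restrict_apply_univ, ← one_div]
    at this ⊢
  exact this

/-- The smooth approximants converge uniformly and share a Lipschitz bound, hence are bounded in H¹
and converge in L². Convergence of the gradients is not needed, because a closed subspace is weakly
closed. No regularity of the boundary of `Ω` enters. -/
theorem mem_H10sub_of_lipschitz {κ : Space d} {Ω : Set (Space d)} (hcl : closure Ω ⊆ openCell d)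
    {u : Space d → ℂ} {K : NNReal} (hu : LipschitzWith K u) (hv : ∀ y ∉ Ω, u y = 0)
    {p : H1 κ} (hp : fn p =ᵐ[cellMeasure d] u) : p ∈ H10sub κ Ω := by
  have hs : tsupport u ⊆ openCell d := by
    refine (closure_mono fun y hy => ?_).trans hcl
    by_contra hc
    exact hy (hv y hc)
  choose! φ h1 h2 h3 h4 using fun (k : ℕ) =>
    exists_smooth_approx hu hv (δ := 1 / ((k : ℝ) + 1)) (by positivity)
  have hΩ : Ω ⊆ openCell d := subset_closure.trans hcl
  choose q hq hq' using fun k => exists_H1_of_lipschitz κ (h3 k) ((h2 k).trans hΩ)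
  obtain ⟨B, hB⟩ := (hasCompactSupport_of_tsupport_subset hs).exists_bound_of_continuous
    hu.continuous
  have hB0 : 0 ≤ B := (norm_nonneg _).trans (hB 0)
  have hdiff : ∀ k, ‖fn (q k) - fn p‖ ≤
      Real.sqrt (volume.real (cell d)) * (4 * (1 / ((k : ℝ) + 1))) := fun k => by
    refine norm_Lp_le_of_bound (by positivity) ?_
    filter_upwards [Lp.coeFn_sub (fn (q k)) (fn p), hq k, hp] with y e1 e2 e3
    rw [e1, Pi.sub_apply, e2, e3]
    exact h4 k y
  refine mem_of_bounded_of_tendsto (isClosed_H10sub κ Ω) (fnL κ) fn_injective (s := q)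
    (C := Real.sqrt (volume.real (cell d)) * (B + 4) +
      Real.sqrt (volume.real (cell d)) * (Real.sqrt d * (4 * K))) (fun k => ?_) (fun k => ?_) ?_
  · exact Submodule.le_topologicalClosure _
      ⟨φ k, h1 k, hasCompactSupport_of_tsupport_subset ((h2 k).trans hΩ), h2 k, hq k⟩
  · refine (norm_le_add _).trans (add_le_add ?_ ?_)
    · refine norm_Lp_le_of_bound (by positivity) ?_
      filter_upwards [hq k] with y e1
      rw [e1]
      have e2 := h4 k y
      have e3 := norm_le_norm_add_norm_sub' (φ k y) (u y)
      have e4 : 1 / ((k : ℝ) + 1) ≤ 1 := by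
        rw [div_le_one (by positivity)]; linarith [Nat.cast_nonneg (α := ℝ) k]
      linarith [hB y]
    · refine norm_Lp_le_of_bound (by positivity) ?_
      filter_upwards [hq' k] with y e1
      rw [e1]
      refine (norm_gradVec_le _ _).trans (mul_le_mul_of_nonneg_left ?_ (Real.sqrt_nonneg _))
      simpa using norm_fderiv_le_of_lipschitz ℝ (h3 k) (x₀ := y)
  · rw [tendsto_iff_norm_sub_tendsto_zero]
    refine squeeze_zero (fun _ => norm_nonneg _) hdiff ?_
    have := (tendsto_one_div_add_atTop_nhds_zero_nat (𝕜 := ℝ)).const_mul 4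
    simpa using this.const_mul (Real.sqrt (volume.real (cell d)))

end DoublePorosity

/-! ### Density of smooth quasi-periodic functions. -/

namespace DoublePorosity

variable {d : ℕ}

theorem sq_lintegral_mul_le {α : Type*} [MeasurableSpace α] (μ : Measure α) {f g : α → ℝ≥0∞}
    (hf : AEMeasurable f μ) (hg : AEMeasurable g μ) :
    (∫⁻ a, f a * g a ∂μ) ^ 2 ≤ (∫⁻ a, f a ^ 2 ∂μ) * ∫⁻ a, g a ^ 2 ∂μ := by
  have h := ENNReal.lintegral_mul_le_Lp_mul_Lq μ Real.HolderConjugate.two_two hf hg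
  have h2 := pow_le_pow_left₀ zero_le h 2
  simp only [Pi.mul_apply, ENNReal.rpow_ofNat] at h2
  refine h2.trans (le_of_eq ?_)
  have h3 : ∀ x : ℝ≥0∞, (x ^ ((1 : ℝ) / 2)) ^ 2 = x := fun x => by
    rw [← ENNReal.rpow_natCast, ← ENNReal.rpow_mul]; norm_num
  rw [mul_pow, h3, h3]

theorem sq_lintegral_weight_mul_le {α : Type*} [MeasurableSpace α] (μ : Measure α)
    {w g : α → ℝ≥0∞} (hw : AEMeasurable w μ) (hg : AEMeasurable g μ) :
    (∫⁻ a, w a * g a ∂μ) ^ 2 ≤ (∫⁻ a, w a ∂μ) * ∫⁻ a, w a * g a ^ 2 ∂μ := by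
  have h := sq_lintegral_mul_le μ (hw.pow_const (1 / 2 : ℝ)) ((hw.pow_const (1 / 2 : ℝ)).mul hg)
  have h3 : ∀ x : ℝ≥0∞, (x ^ ((1 : ℝ) / 2)) ^ 2 = x := fun x => by
    rw [← ENNReal.rpow_natCast, ← ENNReal.rpow_mul]; norm_num
  simp only [Pi.mul_apply, mul_pow, h3, ← mul_assoc] at h
  simpa only [← sq, h3] using h

theorem enorm_sq_Lp {α E : Type*} [MeasurableSpace α] {μ : Measure α} [NormedAddCommGroup E]
    (f : Lp E 2 μ) : ‖f‖ₑ ^ 2 = ∫⁻ y, ‖f y‖ₑ ^ 2 ∂μ := by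
  rw [Lp.enorm_def, eLpNorm_eq_lintegral_rpow_enorm_toReal (by simp) (by simp),
    ← ENNReal.rpow_natCast, ← ENNReal.rpow_mul]
  simp

section Translation

variable {E : Type*} [NormedAddCommGroup E]

/-- This is the continuity of translations in L²(ℝ^d), unpacked at the origin. -/
theorem exists_translation_small {F : Space d → E} (hF : MemLp F 2 volume)
    {ε : ℝ≥0∞} (hε : 0 < ε) : ∃ r > 0, ∀ t : Space d, ‖t‖ < r →
      ∫⁻ x, ‖F (x - t) - F x‖ₑ ^ 2 ≤ ε := by
  let G := hF.toLp F
  have hmp : ∀ t : Space d, MeasurePreserving (fun x : Space d => x - t) volume volume :=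
    fun t => measurePreserving_sub_right volume t
  let g : Space d → C(Space d, Space d) := fun t => ⟨fun x => x - t, by fun_prop⟩
  have hg : Continuous g := by
    refine ContinuousMap.continuous_of_continuous_uncurry _ ?_
    change Continuous fun p : Space d × Space d => p.2 - p.1
    fun_prop
  have hcont : Continuous fun t => Lp.compMeasurePreserving (g t) (hmp t) G :=
    Continuous.compMeasurePreservingLp continuous_const hg hmp (by simp)
  have h0 : Lp.compMeasurePreserving (g 0) (hmp 0) G = G := by
    refine Lp.ext ?_
    filter_upwards [Lp.coeFn_compMeasurePreserving G (hmp 0)] with x hx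
    refine hx.trans ?_
    simp
  have h1 : Filter.Tendsto (fun t => ‖Lp.compMeasurePreserving (g t) (hmp t) G - G‖ₑ ^ 2)
      (nhds 0) (nhds 0) := by
    have h2 : Continuous fun t => ‖Lp.compMeasurePreserving (g t) (hmp t) G - G‖ₑ ^ 2 :=
      (ENNReal.continuous_pow 2).comp (hcont.sub continuous_const).enorm
    simpa [h0] using h2.tendsto 0
  obtain ⟨r, hr, hr'⟩ := Metric.eventually_nhds_iff.1 (h1.eventually (gt_mem_nhds hε))
  refine ⟨r, hr, fun t ht => ?_⟩
  have h2 := (hr' (y := t) (by simpa using ht)).le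
  rw [enorm_sq_Lp] at h2
  refine le_trans (le_of_eq (lintegral_congr_ae ?_)) h2
  filter_upwards [Lp.coeFn_compMeasurePreserving G (hmp t), hF.coeFn_toLp,
    (hmp t).quasiMeasurePreserving.ae hF.coeFn_toLp,
    Lp.coeFn_sub (Lp.compMeasurePreserving (g t) (hmp t) G) G] with x e1 e2 e3 e4
  have e5 : (Lp.compMeasurePreserving (g t) (hmp t) G) x = F (x - t) := e1.trans e3
  rw [e4, Pi.sub_apply, e2, e5]

end Translation

section

variable {E : Type*} [NormedAddCommGroup E] [NormedSpace ℝ E]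

theorem mollify_congr_of_ball {ρ : ContDiffBump (0 : Space d)} {f g : Space d → E} {x : Space d}
    (h : ∀ y, dist x y < ρ.rOut → f y = g y) : mollify ρ f x = mollify ρ g x := by
  rw [mollify_apply, mollify_apply]
  refine integral_congr_ae (.of_forall fun t => ?_)
  by_cases ht : t ∈ Metric.ball (0 : Space d) ρ.rOut
  · have := h (x - t) (by simpa [dist_eq_norm] using ht)
    simp [this]
  · rw [← ρ.support_normed_eq (μ := volume), Function.notMem_support] at ht
    simp [ht]

variable [CompleteSpace E]

/-- The mollifier is a probability weight, so Cauchy–Schwarz bounds the squared average of F(x − t)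
− F(x) by the average of the squares. Tonelli then reduces the claim to single translations. -/
theorem lintegral_mollify_sub_le {F : Space d → E} (hm : StronglyMeasurable F)
    (hl : LocallyIntegrable F) {ρ : ContDiffBump (0 : Space d)} {ε : ℝ≥0∞}
    (h : ∀ t : Space d, ‖t‖ < ρ.rOut → ∫⁻ x, ‖F (x - t) - F x‖ₑ ^ 2 ≤ ε) :
    ∫⁻ x, ‖mollify ρ F x - F x‖ₑ ^ 2 ≤ ε := by
  let w : Space d → ℝ≥0∞ := fun t => ENNReal.ofReal (ρ.normed volume t)
  have hw : Measurable w := ENNReal.measurable_ofReal.comp ρ.continuous_normed.measurable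
  have hw1 : ∫⁻ t, w t = 1 := by
    rw [← ofReal_integral_eq_lintegral_ofReal ρ.integrable_normed
      (.of_forall ρ.nonneg_normed), ρ.integral_normed, ENNReal.ofReal_one]
  have hD : StronglyMeasurable fun p : Space d × Space d => F (p.1 - p.2) - F p.1 :=
    (hm.comp_measurable (measurable_fst.sub measurable_snd)).sub (hm.comp_measurable measurable_fst)
  have key : ∀ x, ‖mollify ρ F x - F x‖ₑ ^ 2 ≤ ∫⁻ t, w t * ‖F (x - t) - F x‖ₑ ^ 2 := by
    intro x
    have e1 : mollify ρ F x - F x = ∫ t, ρ.normed volume t • (F (x - t) - F x) := by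
      simp_rw [smul_sub]
      rw [integral_sub (integrable_mollify ρ hl x) (ρ.integrable_normed.smul_const _),
        integral_smul_const, ρ.integral_normed, one_smul, mollify_apply]
    have e2 : ‖mollify ρ F x - F x‖ₑ ≤ ∫⁻ t, w t * ‖F (x - t) - F x‖ₑ := by
      rw [e1]
      refine (enorm_integral_le_lintegral_enorm _).trans (le_of_eq (lintegral_congr fun t => ?_))
      rw [enorm_smul, Real.enorm_of_nonneg (ρ.nonneg_normed t)]
    refine (pow_le_pow_left₀ zero_le e2 2).trans ?_
    refine (sq_lintegral_weight_mul_le _ hw.aemeasurable ?_).trans (by rw [hw1, one_mul])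
    exact (hD.comp_measurable measurable_prodMk_left).enorm.aemeasurable
  refine (lintegral_mono key).trans ?_
  rw [lintegral_lintegral_swap]
  · calc ∫⁻ t, ∫⁻ x, w t * ‖F (x - t) - F x‖ₑ ^ 2 ≤ ∫⁻ t, w t * ε := by
          refine lintegral_mono fun t => ?_
          dsimp only
          have hDt : Measurable fun x => ‖F (x - t) - F x‖ₑ ^ 2 :=
            (hD.comp_measurable (measurable_prodMk_right (y := t))).enorm.pow_const 2
          rw [lintegral_const_mul _ hDt]
          by_cases ht : ‖t‖ < ρ.rOut
          · gcongr; exact h t ht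
          · have : t ∉ Function.support (ρ.normed volume) := by
              rw [ρ.support_normed_eq]; simpa using ht
            rw [Function.notMem_support] at this
            simp [w, this]
      _ = ε := by rw [lintegral_mul_const _ hw, hw1, one_mul]
  · exact ((hw.comp measurable_snd).mul (hD.enorm.pow_const 2)).aemeasurable

/-- Mollification of a function with periodic norm converges in `L²` of the cell. -/
theorem exists_mollify_cell_small {f : Space d → E} (hm : StronglyMeasurable f)
    (hp : IsPeriodic fun y => ‖f y‖)
    (hf : ∫⁻ y in cell d, ‖f y‖ₑ ^ 2 < ⊤) {ε : ℝ≥0∞} (hε : 0 < ε) :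
    ∃ r > 0, ∀ ρ : ContDiffBump (0 : Space d), ρ.rOut < r →
      ∫⁻ x in cell d, ‖mollify ρ f x - f x‖ₑ ^ 2 ≤ ε := by
  -- A function of periodic norm need not lie in L²(ℝ^d), so it is cut off to a unit neighbourhood
  -- of the cell. Mollifiers of radius below 1 do not see the cut from inside the cell.
  set B := Metric.thickening 1 (cell d) with hB
  have hBm : MeasurableSet B := Metric.isOpen_thickening.measurableSet
  have hcB : cell d ⊆ B := Metric.self_subset_thickening one_pos _
  have hper : IsPeriodic fun y => ‖f y‖ₑ ^ 2 := fun n y => by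
    have := hp n y
    dsimp only at this ⊢
    rw [← ofReal_norm, this, ofReal_norm]
  obtain ⟨N, hN⟩ := exists_setLIntegral_le_cell (A := B) isBounded_cell.thickening
  have hF : MemLp (B.indicator f) 2 volume := by
    refine ⟨(hm.indicator hBm).aestronglyMeasurable, ?_⟩
    rw [eLpNorm_indicator_eq_eLpNorm_restrict hBm,
      eLpNorm_lt_top_iff_lintegral_rpow_enorm_lt_top (by simp) (by simp)]
    simp only [ENNReal.toReal_ofNat, ENNReal.rpow_ofNat]
    exact (hN _ hper).trans_lt (ENNReal.mul_lt_top (ENNReal.natCast_lt_top N) hf)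
  obtain ⟨r, hr, hr'⟩ := exists_translation_small hF hε
  refine ⟨min r 1, lt_min hr one_pos, fun ρ hρ => ?_⟩
  have h1 := lintegral_mollify_sub_le (hm.indicator hBm) (hF.locallyIntegrable (by norm_num))
    (ρ := ρ) fun t ht => hr' t (ht.trans (hρ.trans_le (min_le_left _ _)))
  refine le_trans ?_ ((setLIntegral_le_lintegral (cell d) _).trans h1)
  refine le_of_eq (setLIntegral_congr_fun measurableSet_cell fun x hx => ?_)
  rw [indicator_of_mem (hcB hx), mollify_congr_of_ball (f := f) (g := B.indicator f) fun y hy => ?_]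
  refine (indicator_of_mem ?_ f).symm
  rw [hB, Metric.mem_thickening_iff]
  exact ⟨x, hx, by rw [dist_comm]; exact hy.trans (hρ.trans_le (min_le_right _ _))⟩

end

theorem IsQuasiPeriodic.mollify {κ : Space d} {u : Space d → ℂ} (hu : IsQuasiPeriodic κ u)
    (ρ : ContDiffBump (0 : Space d)) : IsQuasiPeriodic κ (mollify ρ u) := by
  intro n y
  rw [mollify_apply, mollify_apply, ← integral_const_mul]
  refine integral_congr_ae (.of_forall fun t => ?_)
  simp only [add_sub_right_comm, hu n (y - t), Complex.real_smul]
  ring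

/-- The derivative falls on the kernel, and the weak gradient identity is then tested with the
reflected kernel y ↦ ρ(x − y). -/
theorem HasWeakGradient.gradVec_mollify {u : Space d → ℂ} {g : Space d → CVec d}
    (h : HasWeakGradient u g) (ρ : ContDiffBump (0 : Space d)) (x : Space d) :
    gradVec (DoublePorosity.mollify ρ u) x = DoublePorosity.mollify ρ g x := by
  ext i
  set e : Space d := EuclideanSpace.single i 1
  have hρ : ContDiff ℝ ∞ (ρ.normed volume) := ρ.contDiff_normed
  have hρ1 : ContDiff ℝ 1 (ρ.normed volume) := hρ.of_le (by simp)
  have hρc := ρ.hasCompactSupport_normed (μ := volume)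
  set L := (ContinuousLinearMap.lsmul ℝ ℝ : ℝ →L[ℝ] ℂ →L[ℝ] ℂ)
  have e1 : fderiv ℝ (DoublePorosity.mollify ρ u) x e =
      ∫ t, u t * ((fderiv ℝ (ρ.normed volume) (x - t) e : ℝ) : ℂ) := by
    have h1 : DoublePorosity.mollify ρ u = convolution u (ρ.normed volume) L.flip volume :=
      (convolution_flip L).symm
    rw [h1, (hρc.hasFDerivAt_convolution_right L.flip h.1 hρ1 x).fderiv,
      convolution_precompR_apply L.flip h.1 (hρc.fderiv ℝ) (hρ1.continuous_fderiv (by simp))]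
    refine integral_congr_ae (.of_forall fun t => ?_)
    simp [L, mul_comm]
  let φ : Space d → ℂ := fun y => ((ρ.normed volume (x - y) : ℝ) : ℂ)
  have hφ : ContDiff ℝ ∞ φ :=
    Complex.ofRealCLM.contDiff.comp (hρ.comp (contDiff_const.sub contDiff_id))
  have hφc : HasCompactSupport φ :=
    (hρc.comp_homeomorph (Homeomorph.subLeft x)).comp_left (g := fun r : ℝ => (r : ℂ)) (by simp)
  have hd : ∀ y, fderiv ℝ φ y e = -((fderiv ℝ (ρ.normed volume) (x - y) e : ℝ) : ℂ) := by
    intro y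
    have h2 : HasFDerivAt (fun y => ρ.normed volume (x - y))
        (-(fderiv ℝ (ρ.normed volume) (x - y))) y := by
      have h3 := (hρ1.differentiable (by simp) (x - y)).hasFDerivAt.comp y
        ((hasFDerivAt_const x y).sub (hasFDerivAt_id y))
      simpa [Function.comp_def] using! h3
    have h4 := (Complex.ofRealCLM.hasFDerivAt.comp y h2).fderiv
    have h5 : fderiv ℝ φ y = _ := h4
    rw [h5]; simp
  have h6 := h.2.2 φ hφ hφc i
  simp only [e, hd, mul_neg, integral_neg, neg_inj] at h6
  rw [gradVec_apply, e1, h6]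
  have h7 := (EuclideanSpace.proj (𝕜 := ℂ) i).integral_comp_comm (integrable_mollify ρ h.2.1 x)
  change _ = (∫ t, ρ.normed volume t • g (x - t)) i
  refine Eq.trans ?_ h7
  rw [← integral_sub_left_eq_self _ volume x]
  refine integral_congr_ae (.of_forall fun t => ?_)
  simp [φ, mul_comm]

/-- The norms of `u` and of its derivative are periodic, so the compact closure of the cell gives
their maxima. -/
theorem contDiff_gradVec_bounded {κ : Space d} {u : Space d → ℂ} (hu : ContDiff ℝ 1 u)
    (hq : IsQuasiPeriodic κ u) : ∃ C : NNReal, ∀ y, ‖u y‖ ≤ C ∧ ‖fderiv ℝ u y‖ ≤ C := by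
  obtain ⟨C, hC⟩ := (isBounded_cell (d := d)).isCompact_closure.exists_bound_of_continuousOn
    (f := fun y => (u y, fderiv ℝ u y))
    (hu.continuous.prodMk (hu.continuous_fderiv (by simp))).continuousOn
  have h1 : ∀ y ∈ cell d, ‖u y‖ ≤ C ∧ ‖fderiv ℝ u y‖ ≤ C := fun y hy => by
    have := hC y (subset_closure hy)
    rwa [Prod.norm_mk, max_le_iff] at this
  refine ⟨C.toNNReal, fun y => ?_⟩
  have h2 := h1 _ (sub_intPart_mem_cell y)
  have h3 : ∀ z, u (z + latticePoint (intPart y)) = phase κ (intPart y) * u z := fun z => hq _ z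
  have h4 : ‖u y‖ = ‖u (y - latticePoint (intPart y))‖ := by
    conv_lhs => rw [← sub_add_cancel y (latticePoint (intPart y)), h3]
    simp
  have h5 : ‖fderiv ℝ u y‖ = ‖fderiv ℝ u (y - latticePoint (intPart y))‖ := by
    conv_lhs => rw [← sub_add_cancel y (latticePoint (intPart y)), ← fderiv_comp_add_right]
    simp_rw [h3]
    rw [fderiv_const_mul (hu.differentiable (by simp) _), norm_smul, norm_phase, one_mul]
  rw [h4, h5]
  exact ⟨h2.1.trans (Real.le_coe_toNNReal C), h2.2.trans (Real.le_coe_toNNReal C)⟩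

theorem exists_H1_of_contDiff {κ : Space d} {u : Space d → ℂ} (hu : ContDiff ℝ 1 u)
    (hq : IsQuasiPeriodic κ u) :
    ∃ p : H1 κ, fn p =ᵐ[cellMeasure d] u ∧ grad p =ᵐ[cellMeasure d] gradVec u := by
  obtain ⟨C, hC⟩ := contDiff_gradVec_bounded hu hq
  refine exists_H1 ((hasWeakGradient_of_contDiff hu).cellWeakGradient hq) ?_ ?_
  · exact MemLp.of_bound hu.continuous.aestronglyMeasurable C (.of_forall fun y => (hC y).1)
  · exact MemLp.of_bound (continuous_gradVec hu).aestronglyMeasurable (Real.sqrt d * C)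
      (.of_forall fun y => (norm_gradVec_le u y).trans
        (mul_le_mul_of_nonneg_left (hC y).2 (by positivity)))

theorem lintegral_qpExt_lt_top {E : Type*} [NormedAddCommGroup E] [NormedSpace ℂ E] (κ : Space d)
    (f : Lp E 2 (cellMeasure d)) : ∫⁻ y in cell d, ‖qpExt κ f y‖ₑ ^ 2 < ⊤ := by
  have h : ∫⁻ y in cell d, ‖qpExt κ f y‖ₑ ^ 2 = ∫⁻ y in cell d, ‖f y‖ₑ ^ 2 :=
    setLIntegral_congr_fun measurableSet_cell fun y hy => by rw [qpExt_of_mem hy]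
  rw [h, ← enorm_sq_Lp]
  exact ENNReal.pow_lt_top enorm_lt_top

theorem norm_Lp_sub_lt {E : Type*} [NormedAddCommGroup E] {f g : Lp E 2 (cellMeasure d)}
    {F G : Space d → E} (hF : f =ᵐ[cellMeasure d] F) (hG : g =ᵐ[cellMeasure d] G) {ε : ℝ}
    (hε : 0 < ε) (h : ∫⁻ y in cell d, ‖F y - G y‖ₑ ^ 2 ≤ ENNReal.ofReal (ε ^ 2)) :
    ‖f - g‖ ≤ ε := by
  have h1 : ‖f - g‖ₑ ^ 2 ≤ ENNReal.ofReal (ε ^ 2) := by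
    rw [enorm_sq_Lp]
    refine le_trans (le_of_eq (lintegral_congr_ae ?_)) h
    filter_upwards [Lp.coeFn_sub f g, hF, hG] with y e1 e2 e3
    rw [e1, Pi.sub_apply, e2, e3]
  rw [← ofReal_norm, ← ENNReal.ofReal_pow (norm_nonneg _),
    ENNReal.ofReal_le_ofReal_iff (by positivity)] at h1
  exact le_of_sq_le_sq h1 hε.le

/-- Smooth quasi-periodic functions are dense in `H¹_κ(Q)`. -/
theorem exists_smooth_near {κ : Space d} (p : H1 κ) {ε : ℝ} (hε : 0 < ε) :
    ∃ (u : Space d → ℂ) (q : H1 κ), IsQuasiPeriodic κ u ∧ ContDiff ℝ ∞ u ∧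
      fn q =ᵐ[cellMeasure d] u ∧ grad q =ᵐ[cellMeasure d] gradVec u ∧ ‖q - p‖ < ε := by
  set u := qpExt κ (fn p) with hu
  set g := qpExt κ (grad p) with hg
  have hup : (fn p : Space d → ℂ) =ᵐ[cellMeasure d] u := by
    filter_upwards [ae_restrict_mem measurableSet_cell] with y hy using (qpExt_of_mem hy).symm
  have hgp : (grad p : Space d → CVec d) =ᵐ[cellMeasure d] g := by
    filter_upwards [ae_restrict_mem measurableSet_cell] with y hy using (qpExt_of_mem hy).symm
  have hw : HasWeakGradient u g :=
    (mem_H1_iff.1 p.2).hasWeakGradient_qpExt (Lp.stronglyMeasurable _) (Lp.stronglyMeasurable _)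
      (MemLp.integrableOn_cell (Lp.memLp _)) (MemLp.integrableOn_cell (Lp.memLp _))
  have hq : IsQuasiPeriodic κ u := isQuasiPeriodic_qpExt κ _
  have hε3 : (0 : ℝ) < (ε / 3) := by positivity
  have hε' : 0 < ENNReal.ofReal ((ε / 3) ^ 2) := ENNReal.ofReal_pos.2 (by positivity)
  obtain ⟨r₁, hr₁, h₁⟩ := exists_mollify_cell_small (f := u)
    (stronglyMeasurable_qpExt (Lp.stronglyMeasurable _) κ)
    (fun n y => by simp only [hu, qpExt_add, norm_smul, norm_phase, one_mul])
    (lintegral_qpExt_lt_top κ _) hε'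
  obtain ⟨r₂, hr₂, h₂⟩ := exists_mollify_cell_small (f := g)
    (stronglyMeasurable_qpExt (Lp.stronglyMeasurable _) κ)
    (fun n y => by simp only [hg, qpExt_add, norm_smul, norm_phase, one_mul])
    (lintegral_qpExt_lt_top κ _) hε'
  have hr : 0 < min r₁ r₂ := lt_min hr₁ hr₂
  let ρ : ContDiffBump (0 : Space d) :=
    ⟨min r₁ r₂ / 4, min r₁ r₂ / 2, by positivity, by linarith⟩
  have hρ : ρ.rOut < min r₁ r₂ := by change min r₁ r₂ / 2 < _; linarith
  have hs : ContDiff ℝ ∞ (mollify ρ u) := contDiff_mollify ρ hw.1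
  obtain ⟨q, hq1, hq2⟩ := exists_H1_of_contDiff (hs.of_le (by simp)) (hq.mollify ρ)
  refine ⟨mollify ρ u, q, hq.mollify ρ, hs, hq1, hq2, ?_⟩
  have e1 : ‖fn q - fn p‖ ≤ ε / 3 :=
    norm_Lp_sub_lt hq1 hup hε3 (h₁ ρ (hρ.trans_le (min_le_left _ _)))
  have e2 : ‖grad q - grad p‖ ≤ ε / 3 := by
    refine norm_Lp_sub_lt hq2 hgp hε3 ?_
    simp_rw [hw.gradVec_mollify ρ]
    exact h₂ ρ (hρ.trans_le (min_le_right _ _))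
  have e3 : ‖q - p‖ ≤ ‖fn q - fn p‖ + ‖grad q - grad p‖ := norm_le_add (q - p)
  linarith

end DoublePorosity

/-! ### The periodic stiff component and boundary charts. -/

namespace DoublePorosity

variable {d : ℕ}

section Geometry

theorem mem_periodicUnion {S : Set (Space d)} (hS : S ⊆ cell d) {y : Space d} :
    y ∈ periodicUnion S ↔ y - latticePoint (intPart y) ∈ S := by
  simp only [periodicUnion, mem_iUnion, mem_image]
  constructor
  · rintro ⟨n, z, hz, rfl⟩
    rw [intPart_add, mem_cell_iff.1 (hS hz)]
    simpa using hz
  · intro h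
    exact ⟨_, _, h, sub_add_cancel _ _⟩

theorem add_mem_periodicUnion {S : Set (Space d)} (hS : S ⊆ cell d) {y : Space d}
    (n : Fin d → ℤ) : y + latticePoint n ∈ periodicUnion S ↔ y ∈ periodicUnion S := by
  rw [mem_periodicUnion hS, mem_periodicUnion hS, intPart_add, latticePoint_add]
  congr! 1; abel

/-- The connected stiff component of the periodic medium. -/
def stiff (Q₀ : Set (Space d)) : Set (Space d) := periodicUnion (cell d \ closure Q₀)

variable {Q₀ : Set (Space d)}

theorem mem_stiff {y : Space d} :
    y ∈ stiff Q₀ ↔ y - latticePoint (intPart y) ∉ closure Q₀ := by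
  rw [stiff, mem_periodicUnion sdiff_subset, mem_sdiff]
  exact and_iff_right (sub_intPart_mem_cell y)

theorem mem_stiff_of_mem_cell {y : Space d} (hy : y ∈ cell d) :
    y ∈ stiff Q₀ ↔ y ∉ closure Q₀ := by
  rw [mem_stiff, mem_cell_iff.1 hy]; simp

theorem add_mem_stiff {y : Space d} (n : Fin d → ℤ) :
    y + latticePoint n ∈ stiff Q₀ ↔ y ∈ stiff Q₀ := add_mem_periodicUnion sdiff_subset n

theorem isClosed_range_latticePoint : IsClosed (range (latticePoint (d := d))) := by
  have h : range (latticePoint (d := d)) = ⋂ i : Fin d, {y | y i ∈ range ((↑) : ℤ → ℝ)} := by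
    ext y
    simp only [mem_range, mem_iInter, mem_ofPred_eq]
    constructor
    · rintro ⟨n, rfl⟩ i; exact ⟨n i, rfl⟩
    · intro h
      choose n hn using h
      exact ⟨n, by ext i; exact hn i⟩
  rw [h]
  exact isClosed_iInter fun i =>
    Int.isClosedEmbedding_coe_real.isClosed_range.preimage (by fun_prop)

theorem isOpen_stiff (hcl : closure Q₀ ⊆ openCell d) : IsOpen (stiff Q₀) := by
  have hc : IsCompact (closure Q₀) := Metric.isCompact_of_isClosed_isBounded isClosed_closure
    (isBounded_cell.subset (hcl.trans openCell_subset_cell))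
  have h : (stiff Q₀)ᶜ = (fun p : Space d × Space d => p.1 + p.2) ''
      (closure Q₀ ×ˢ range latticePoint) := by
    ext y
    rw [mem_compl_iff, mem_stiff, not_not]
    constructor
    · intro hy
      exact ⟨(_, latticePoint (intPart y)), ⟨hy, mem_range_self _⟩, sub_add_cancel _ _⟩
    · rintro ⟨⟨z, _⟩, ⟨hz, n, rfl⟩, rfl⟩
      dsimp only at hz ⊢
      rw [intPart_add, mem_cell_iff.1 (openCell_subset_cell (hcl hz))]
      simpa using hz
  rw [← isClosed_compl_iff, h]
  have h2 := IsClosed.add_left_of_isCompact (isClosed_range_latticePoint (d := d)) hc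
  rwa [← Set.add_image_prod] at h2

theorem mem_stiff_of_mem_Icc (hcl : closure Q₀ ⊆ openCell d) {y : Space d}
    (hy : ∀ i, y i ∈ Icc (0 : ℝ) 1) (hy' : y ∉ closure Q₀) : y ∈ stiff Q₀ := by
  rw [mem_stiff]
  intro h
  have h0 : intPart y = 0 := by
    ext i
    have h1 := (hcl h i)
    simp only [PiLp.sub_apply, latticePoint_apply, mem_Ioo] at h1
    have h2 : (intPart y i : ℝ) < 1 := by linarith [(hy i).2]
    have h3 : (-1 : ℝ) < intPart y i := by linarith [(hy i).1]
    have h4 : intPart y i < 1 := by exact_mod_cast h2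
    have h5 : -1 < intPart y i := by exact_mod_cast h3
    rw [Pi.zero_apply]; omega
  rw [h0] at h
  simp only [latticePoint_zero, sub_zero] at h
  exact hy' h

/-- A boundary chart: near `x`, the set is `{h > 0}`, where the Lipschitz function `h` decreases at
unit rate in the direction `e`. -/
structure BoundaryChart (Q₀ : Set (Space d)) (x : Space d) where
  /-- the outward direction -/
  e : Space d
  /-- the height below the graph -/
  h : Space d → ℝ
  /-- a Lipschitz constant of the height -/
  L : NNReal
  /-- the radius -/
  r : ℝ
  norm_e : ‖e‖ = 1
  lip : LipschitzWith L h
  shift : ∀ (y : Space d) (t : ℝ), h (y + t • e) = h y - t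
  r_pos : 0 < r
  ball_subset : Metric.ball x r ⊆ openCell d
  mem_iff : ∀ y ∈ Metric.ball x r, y ∈ Q₀ ↔ 0 < h y

/-- The height is γ of the projection along `e`, minus the coordinate along `e`. Moving along `e`
does not change the projection, hence the unit rate of decrease. -/
theorem exists_boundaryChart (hcl : closure Q₀ ⊆ openCell d) (hl : HasLipschitzBoundary Q₀)
    {x : Space d} (hx : x ∈ frontier Q₀) : Nonempty (BoundaryChart Q₀ x) := by
  obtain ⟨e, K, γ, r, he, hγ, hr, hb⟩ := hl x hx
  obtain ⟨r', hr', hball⟩ := Metric.isOpen_iff.1 isOpen_openCell x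
    (hcl (frontier_subset_closure hx))
  have hin : ∀ y : Space d, |inner ℝ y e| ≤ ‖y‖ := fun y => by
    simpa [he] using abs_real_inner_le_norm y e
  have hee : inner ℝ e e = (1 : ℝ) := by rw [real_inner_self_eq_norm_sq, he]; norm_num
  have h1 : LipschitzWith 1 fun y : Space d => (inner ℝ y e : ℝ) :=
    LipschitzWith.of_dist_le_mul fun y z => by
      rw [Real.dist_eq, ← inner_sub_left, dist_eq_norm]; simpa using hin (y - z)
  have h2 : LipschitzWith (1 + 1) fun y : Space d => y - (inner ℝ y e : ℝ) • e := by
    refine LipschitzWith.id.sub (LipschitzWith.of_dist_le_mul fun y z => ?_)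
    rw [dist_eq_norm, ← sub_smul, norm_smul, he, mul_one, ← dist_eq_norm]
    exact h1.dist_le_mul y z
  refine ⟨⟨e, fun y => γ (y - (inner ℝ y e : ℝ) • e) - inner ℝ y e, _, min r r', he,
    (hγ.comp h2).sub h1, fun y t => ?_, lt_min hr hr',
    (Metric.ball_subset_ball (min_le_right _ _)).trans hball, fun y hy => ?_⟩⟩
  · rw [inner_add_left, real_inner_smul_left, hee, mul_one]
    have : y + t • e - (inner ℝ y e + t) • e = y - (inner ℝ y e : ℝ) • e := by
      rw [add_smul]; abel
    rw [this]; ring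
  · rw [hb y (Metric.ball_subset_ball (min_le_left _ _) hy), sub_pos]

namespace BoundaryChart

variable {x : Space d} (c : BoundaryChart Q₀ x)

theorem notMem_closure {y : Space d} (hy : y ∈ Metric.ball x c.r) (hh : c.h y < 0) :
    y ∉ closure Q₀ := by
  intro hc
  have ho : IsOpen (Metric.ball x c.r ∩ {z | c.h z < 0}) :=
    Metric.isOpen_ball.inter (isOpen_lt c.lip.continuous continuous_const)
  obtain ⟨z, ⟨hz, hz'⟩, hzQ⟩ := mem_closure_iff.1 hc _ ho ⟨hy, hh⟩
  have hz'' : c.h z < 0 := hz'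
  linarith [(c.mem_iff z hz).1 hzQ]

theorem mem_stiff {y : Space d} (hy : y ∈ Metric.ball x c.r) (hh : c.h y < 0) : y ∈ stiff Q₀ :=
  (mem_stiff_of_mem_cell (openCell_subset_cell (c.ball_subset hy))).2 (c.notMem_closure hy hh)

theorem h_nonpos {y : Space d} (hy : y ∈ Metric.ball x c.r) (hyQ : y ∉ Q₀) : c.h y ≤ 0 := by
  by_contra! h
  exact hyQ ((c.mem_iff y hy).2 h)

theorem h_eq_zero (ho : IsOpen Q₀) {y : Space d} (hy : y ∈ Metric.ball x c.r)
    (hyQ : y ∈ frontier Q₀) : c.h y = 0 := by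
  rw [ho.frontier_eq] at hyQ
  refine le_antisymm (c.h_nonpos hy hyQ.2) ?_
  by_contra! h
  exact c.notMem_closure hy h hyQ.1

end BoundaryChart

/-- Distinct multiples of `e` carry the zero set onto distinct, hence disjoint, level sets.
Infinitely many disjoint translates by a bounded set of vectors force measure zero. -/
theorem volume_levelSet_eq_zero {e : Space d} {h : Space d → ℝ} (hc : Continuous h)
    (hs : ∀ (y : Space d) (t : ℝ), h (y + t • e) = h y - t) : volume {y | h y = 0} = 0 := by
  refine Measure.addHaar_eq_zero_of_disjoint_translates volume
    (fun n : ℕ => ((n : ℝ) + 1)⁻¹ • e) ?_ ?_ (isClosed_eq hc continuous_const).measurableSet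
  · refine (Metric.isBounded_closedBall (x := (0 : Space d)) (r := ‖e‖)).subset ?_
    rintro _ ⟨n, rfl⟩
    rw [mem_closedBall_zero_iff, norm_smul, norm_inv, Real.norm_of_nonneg (by positivity)]
    refine mul_le_of_le_one_left (norm_nonneg _) (inv_le_one_of_one_le₀ ?_)
    linarith [Nat.cast_nonneg (α := ℝ) n]
  · intro m n hmn
    refine Set.disjoint_left.2 ?_
    rintro z hz hz'
    simp only [singleton_add, image_add_left, mem_preimage, mem_ofPred_eq] at hz hz'
    have key : ∀ k : ℕ, h (-(((k : ℝ) + 1)⁻¹ • e) + z) = h z + ((k : ℝ) + 1)⁻¹ := fun k => by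
      rw [add_comm, ← neg_smul, hs]; ring
    rw [key] at hz hz'
    have h1 : ((m : ℝ) + 1)⁻¹ = ((n : ℝ) + 1)⁻¹ := by linarith
    rw [inv_inj, add_left_inj, Nat.cast_inj] at h1
    exact hmn h1

theorem isCompact_frontier_soft (hcl : closure Q₀ ⊆ openCell d) : IsCompact (frontier Q₀) :=
  Metric.isCompact_of_isClosed_isBounded isClosed_frontier
    (isBounded_cell.subset (frontier_subset_closure.trans (hcl.trans openCell_subset_cell)))

theorem volume_frontier_eq_zero (ho : IsOpen Q₀) (hcl : closure Q₀ ⊆ openCell d)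
    (hl : HasLipschitzBoundary Q₀) : volume (frontier Q₀) = 0 := by
  refine (isCompact_frontier_soft hcl).measure_zero_of_nhdsWithin fun x hx => ?_
  obtain ⟨c⟩ := exists_boundaryChart hcl hl hx
  refine ⟨frontier Q₀ ∩ Metric.ball x c.r, ?_, ?_⟩
  · exact Filter.inter_mem self_mem_nhdsWithin
      (mem_nhdsWithin_of_mem_nhds (Metric.ball_mem_nhds x c.r_pos))
  · exact measure_mono_null (fun y hy => c.h_eq_zero ho hy.2 hy.1)
      (volume_levelSet_eq_zero c.lip.continuous c.shift)

end Geometry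

/-! ### The Poincaré inequality for quasi-periodic functions on the stiff component. -/

section Poincare

variable {Q₀ : Set (Space d)}

/-- The Dirichlet energy on the stiff part of the cell. -/
noncomputable def stiffEnergy (Q₀ : Set (Space d)) (u : Space d → ℂ) : ℝ≥0∞ :=
  ∫⁻ y in cell d \ closure Q₀, ‖fderiv ℝ u y‖ₑ ^ 2

theorem enorm_fderiv_periodic {κ : Space d} {u : Space d → ℂ} (hq : IsQuasiPeriodic κ u)
    (hu : ContDiff ℝ 1 u) : IsPeriodic fun y => ‖fderiv ℝ u y‖ₑ := by
  intro n y
  have h3 : ∀ z, u (z + latticePoint n) = phase κ n * u z := fun z => hq _ z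
  dsimp only
  rw [← fderiv_comp_add_right]
  simp_rw [h3]
  rw [fderiv_const_mul (hu.differentiable (by simp) _), enorm_smul]
  rw [← ofReal_norm, norm_phase, ENNReal.ofReal_one, one_mul]

/-- The indicator of the stiff component is periodic, so multiplying by it reduces to the bound for
a full cell. -/
theorem exists_lintegral_le_stiff (hcl : closure Q₀ ⊆ openCell d) {A : Set (Space d)}
    (hA : Bornology.IsBounded A) : ∃ N : ℕ, ∀ F : Space d → ℝ≥0∞, IsPeriodic F →
      ∫⁻ y in A ∩ stiff Q₀, F y ≤ N * ∫⁻ y in cell d \ closure Q₀, F y := by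
  obtain ⟨N, hN⟩ := exists_setLIntegral_le_cell hA
  have hm : MeasurableSet (stiff Q₀) := (isOpen_stiff hcl).measurableSet
  refine ⟨N, fun F hF => ?_⟩
  have h1 := hN ((stiff Q₀).indicator F) fun n y => by
    by_cases hy : y ∈ stiff Q₀
    · rw [indicator_of_mem hy, indicator_of_mem ((add_mem_stiff n).2 hy), hF n y]
    · rw [indicator_of_notMem hy, indicator_of_notMem fun h => hy ((add_mem_stiff n).1 h)]
  rw [setLIntegral_indicator hm, setLIntegral_indicator hm] at h1
  rw [inter_comm]
  refine h1.trans (le_of_eq ?_)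
  have h2 : stiff Q₀ ∩ cell d = cell d \ closure Q₀ := by
    ext y
    rw [mem_inter_iff, mem_sdiff, and_comm]
    exact and_congr_right fun hy => mem_stiff_of_mem_cell hy
  rw [h2]

theorem enorm_add_sq_le {E : Type*} [NormedAddCommGroup E] (a b : E) :
    ‖a + b‖ₑ ^ 2 ≤ 4 * (‖a‖ₑ ^ 2 + ‖b‖ₑ ^ 2) := by
  have h : ‖a + b‖ₑ ≤ 2 * max ‖a‖ₑ ‖b‖ₑ := by
    rw [two_mul]
    exact (enorm_add_le a b).trans (add_le_add (le_max_left _ _) (le_max_right _ _))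
  calc ‖a + b‖ₑ ^ 2 ≤ (2 * max ‖a‖ₑ ‖b‖ₑ) ^ 2 := pow_le_pow_left₀ zero_le h 2
    _ = 4 * (max ‖a‖ₑ ‖b‖ₑ) ^ 2 := by rw [mul_pow]; norm_num
    _ ≤ 4 * (‖a‖ₑ ^ 2 + ‖b‖ₑ ^ 2) := by
        gcongr
        rcases max_cases ‖a‖ₑ ‖b‖ₑ with h | h <;> rw [h.1]
        · exact le_self_add
        · exact le_add_self

theorem enorm_sub_sq_le_integral {u : Space d → ℂ} (hu : ContDiff ℝ 1 u) (y s : Space d) :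
    ‖u (y + s) - u y‖ₑ ^ 2 ≤ ∫⁻ t in Icc (0 : ℝ) 1, ‖s‖ₑ ^ 2 * ‖fderiv ℝ u (y + t • s)‖ₑ ^ 2 := by
  have hdc : Continuous fun t : ℝ => fderiv ℝ u (y + t • s) :=
    (hu.continuous_fderiv (by simp)).comp (by fun_prop)
  have h1 : ∫ t in (0 : ℝ)..1, fderiv ℝ u (y + t • s) s = u (y + s) - u y := by
    have h2 := intervalIntegral.integral_eq_sub_of_hasDerivAt (a := 0) (b := 1)
      (f := fun t : ℝ => u (y + t • s)) (f' := fun t => fderiv ℝ u (y + t • s) s)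
      (fun t _ => by
        have h3 : HasDerivAt (fun t : ℝ => y + t • s) s t := by
          simpa using ((hasDerivAt_id t).smul_const s).const_add y
        exact (hu.differentiable (by simp) _).hasFDerivAt.comp_hasDerivAt t h3)
      ((hdc.clm_apply continuous_const).intervalIntegrable _ _)
    simpa using h2
  rw [← h1, intervalIntegral.integral_of_le zero_le_one]
  have h4 : ‖∫ t in Ioc (0 : ℝ) 1, fderiv ℝ u (y + t • s) s‖ₑ ≤
      ∫⁻ t in Icc (0 : ℝ) 1, 1 * (‖s‖ₑ * ‖fderiv ℝ u (y + t • s)‖ₑ) := by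
    refine (enorm_integral_le_lintegral_enorm _).trans ?_
    refine (lintegral_mono_set Ioc_subset_Icc_self).trans (lintegral_mono fun t => ?_)
    rw [one_mul, mul_comm]
    exact ContinuousLinearMap.le_opENorm _ _
  refine (pow_le_pow_left₀ zero_le h4 2).trans ?_
  refine (sq_lintegral_mul_le _ aemeasurable_const
    (hdc.enorm.measurable.aemeasurable.const_mul _)).trans ?_
  simp [mul_pow]

/-- The increment is the integral of the derivative along the segment. After Tonelli and a shift of
variable, each slice lies in a bounded part of the stiff component, where the periodic energy is
counted a bounded number of times. The constant depends on neither κ nor `u`. -/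
theorem exists_translation_bound (hcl : closure Q₀ ⊆ openCell d) {A : Set (Space d)}
    (hA : MeasurableSet A) (hb : Bornology.IsBounded A) (s : Space d)
    (hs : ∀ y ∈ A, ∀ t ∈ Icc (0 : ℝ) 1, y + t • s ∈ stiff Q₀) :
    ∃ C : NNReal, ∀ (κ : Space d) (u : Space d → ℂ), IsQuasiPeriodic κ u → ContDiff ℝ 1 u →
      ∫⁻ y in A, ‖u (y + s) - u y‖ₑ ^ 2 ≤ C * stiffEnergy Q₀ u := by
  obtain ⟨R, hR⟩ := hb.subset_closedBall (0 : Space d)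
  set B : Set (Space d) := Metric.closedBall 0 (R + ‖s‖) with hB
  obtain ⟨N, hN⟩ := exists_lintegral_le_stiff (A := B) hcl Metric.isBounded_closedBall
  have hBm : MeasurableSet (B ∩ stiff Q₀) :=
    Metric.isClosed_closedBall.measurableSet.inter (isOpen_stiff hcl).measurableSet
  refine ⟨‖s‖₊ ^ 2 * N, fun κ u hq hu => ?_⟩
  have hdc : Continuous fun p : Space d × ℝ => fderiv ℝ u (p.1 + p.2 • s) :=
    (hu.continuous_fderiv (by simp)).comp (by fun_prop)
  calc ∫⁻ y in A, ‖u (y + s) - u y‖ₑ ^ 2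
      ≤ ∫⁻ y in A, ∫⁻ t in Icc (0 : ℝ) 1, ‖s‖ₑ ^ 2 * ‖fderiv ℝ u (y + t • s)‖ₑ ^ 2 :=
        lintegral_mono fun y => enorm_sub_sq_le_integral hu y s
    _ = ∫⁻ t in Icc (0 : ℝ) 1, ∫⁻ y in A, ‖s‖ₑ ^ 2 * ‖fderiv ℝ u (y + t • s)‖ₑ ^ 2 := by
        rw [lintegral_lintegral_swap]
        exact ((hdc.enorm.measurable.pow_const 2).const_mul _).aemeasurable
    _ ≤ ∫⁻ _t in Icc (0 : ℝ) 1, ‖s‖ₑ ^ 2 * (N * stiffEnergy Q₀ u) := by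
        refine setLIntegral_mono measurable_const fun t ht => ?_
        have hmt : Measurable fun y => ‖fderiv ℝ u (y + t • s)‖ₑ ^ 2 :=
          (hdc.comp (continuous_id.prodMk continuous_const)).enorm.measurable.pow_const 2
        rw [lintegral_const_mul _ hmt]
        refine mul_le_mul_right (le_trans ?_ (hN (fun y => ‖fderiv ℝ u y‖ₑ ^ 2) fun n y => by
          have := enorm_fderiv_periodic hq hu n y
          dsimp only at this ⊢
          rw [this])) _
        rw [← lintegral_indicator hA, ← lintegral_indicator hBm,
          ← lintegral_add_right_eq_self ((B ∩ stiff Q₀).indicator _) (t • s)]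
        refine lintegral_mono fun y => ?_
        by_cases hy : y ∈ A
        · have h1 : y + t • s ∈ B ∩ stiff Q₀ := by
            refine ⟨?_, hs y hy t ht⟩
            rw [hB, mem_closedBall_zero_iff]
            have h2 := mem_closedBall_zero_iff.1 (hR hy)
            refine (norm_add_le _ _).trans (add_le_add h2 ?_)
            rw [norm_smul, Real.norm_of_nonneg ht.1]
            exact mul_le_of_le_one_left (norm_nonneg _) ht.2
          rw [indicator_of_mem hy, indicator_of_mem h1]
        · rw [indicator_of_notMem hy]; exact zero_le
    _ = _ := by
        rw [setLIntegral_const]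
        simp [enorm_eq_nnnorm, mul_assoc]

/-- Two points at which all quasi-periodic functions nearly coincide on average, up to the stiff
energy. -/
def Linked (Q₀ : Set (Space d)) (x x' : Space d) : Prop :=
  ∃ ρ : ℝ, 0 < ρ ∧ ∃ C : NNReal, ∀ (κ : Space d) (u : Space d → ℂ), IsQuasiPeriodic κ u →
    ContDiff ℝ 1 u →
      ∫⁻ z in Metric.ball (0 : Space d) ρ, ‖u (x' + z) - u (x + z)‖ₑ ^ 2 ≤ C * stiffEnergy Q₀ u

theorem Linked.symm {x x' : Space d} (h : Linked Q₀ x x') : Linked Q₀ x' x := by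
  obtain ⟨ρ, hρ, C, hC⟩ := h
  refine ⟨ρ, hρ, C, fun κ u hq hu => ?_⟩
  simpa only [enorm_sub_rev] using hC κ u hq hu

theorem Linked.trans {x x' x'' : Space d} (h : Linked Q₀ x x') (h' : Linked Q₀ x' x'') :
    Linked Q₀ x x'' := by
  obtain ⟨ρ, hρ, C, hC⟩ := h
  obtain ⟨ρ', hρ', C', hC'⟩ := h'
  refine ⟨min ρ ρ', lt_min hρ hρ', 4 * (C' + C), fun κ u hq hu => ?_⟩
  have hm : ∀ a b : Space d, Measurable fun z => ‖u (a + z) - u (b + z)‖ₑ ^ 2 := fun a b =>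
    ((hu.continuous.comp (continuous_const.add continuous_id)).sub
      (hu.continuous.comp (continuous_const.add continuous_id))).enorm.measurable.pow_const 2
  calc ∫⁻ z in Metric.ball (0 : Space d) (min ρ ρ'), ‖u (x'' + z) - u (x + z)‖ₑ ^ 2
      ≤ ∫⁻ z in Metric.ball (0 : Space d) (min ρ ρ'), 4 * (‖u (x'' + z) - u (x' + z)‖ₑ ^ 2 +
          ‖u (x' + z) - u (x + z)‖ₑ ^ 2) := lintegral_mono fun z => by
        have := enorm_add_sq_le (u (x'' + z) - u (x' + z)) (u (x' + z) - u (x + z))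
        rwa [sub_add_sub_cancel] at this
    _ = 4 * ((∫⁻ z in Metric.ball (0 : Space d) (min ρ ρ'), ‖u (x'' + z) - u (x' + z)‖ₑ ^ 2) +
          ∫⁻ z in Metric.ball (0 : Space d) (min ρ ρ'), ‖u (x' + z) - u (x + z)‖ₑ ^ 2) := by
        rw [lintegral_const_mul _ (by exact (hm _ _).add (hm _ _)), lintegral_add_left (hm _ _)]
    _ ≤ 4 * (C' * stiffEnergy Q₀ u + C * stiffEnergy Q₀ u) := by
        gcongr
        · exact (lintegral_mono_set (Metric.ball_subset_ball (min_le_right _ _))).trans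
            (hC' κ u hq hu)
        · exact (lintegral_mono_set (Metric.ball_subset_ball (min_le_left _ _))).trans
            (hC κ u hq hu)
    _ = _ := by push_cast; ring

theorem setLIntegral_ball_translate (f : Space d → ℝ≥0∞) (x : Space d) (ρ : ℝ) :
    ∫⁻ z in Metric.ball (0 : Space d) ρ, f (x + z) = ∫⁻ y in Metric.ball x ρ, f y := by
  have h := (measurePreserving_add_left (volume : Measure (Space d)) x).setLIntegral_comp_preimage_emb
    (MeasurableEquiv.addLeft x).measurableEmbedding f (Metric.ball x ρ)
  rw [← h]
  congr 2
  ext z; simp [dist_eq_norm]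

theorem Linked.of_near (hcl : closure Q₀ ⊆ openCell d) {x : Space d} (hx : x ∈ stiff Q₀) :
    ∀ᶠ x' in nhds x, Linked Q₀ x x' := by
  obtain ⟨r, hr, hr'⟩ := Metric.isOpen_iff.1 (isOpen_stiff hcl) x hx
  filter_upwards [Metric.ball_mem_nhds x (half_pos hr)] with x' hx'
  obtain ⟨C, hC⟩ := exists_translation_bound hcl (A := Metric.ball x (r / 2))
    Metric.isOpen_ball.measurableSet Metric.isBounded_ball (x' - x) (fun y hy t ht => hr' (by
      rw [Metric.mem_ball, dist_eq_norm] at hx' hy ⊢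
      have h1 : y + t • (x' - x) - x = (y - x) + t • (x' - x) := by abel
      rw [h1]
      refine (norm_add_le _ _).trans_lt ?_
      have h2 : ‖t • (x' - x)‖ ≤ ‖x' - x‖ := by
        rw [norm_smul, Real.norm_of_nonneg ht.1]
        exact mul_le_of_le_one_left (norm_nonneg _) ht.2
      linarith))
  refine ⟨r / 2, half_pos hr, C, fun κ u hq hu => ?_⟩
  refine le_trans (le_of_eq ?_) (hC κ u hq hu)
  rw [← setLIntegral_ball_translate (fun y => ‖u (y + (x' - x)) - u y‖ₑ ^ 2)]
  refine lintegral_congr fun z => ?_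
  congr 4; abel

/-- Linking is symmetric, transitive, and holds between each stiff point and its neighbours. Its
classes are therefore relatively open, and a connected set has only one. -/
theorem linked_of_connected (hcl : closure Q₀ ⊆ openCell d) (hc : IsPreconnected (stiff Q₀))
    {x x' : Space d} (hx : x ∈ stiff Q₀) (hx' : x' ∈ stiff Q₀) : Linked Q₀ x x' :=
  hc.induction₂ (Linked Q₀) (fun _ hy => mem_nhdsWithin_of_mem_nhds (Linked.of_near hcl hy))
    (fun _ _ _ _ _ _ h h' => h.trans h') (fun _ _ _ _ h => h.symm) hx hx'

/-- The size of the jump of quasi-periodic functions in a lattice direction. -/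
noncomputable def phaseGap (κ : Space d) (n : Fin d → ℤ) : ℝ≥0∞ := ‖phase κ n - 1‖ₑ ^ 2

theorem phaseGap_le (κ : Space d) (n : Fin d → ℤ) : phaseGap κ n ≤ 4 := by
  have h : ‖phase κ n - 1‖ₑ ≤ 2 := by
    refine (enorm_sub_le ..).trans ?_
    rw [← ofReal_norm, ← ofReal_norm, norm_phase, norm_one, ENNReal.ofReal_one]
    norm_num
  exact (pow_le_pow_left₀ zero_le h 2).trans (by norm_num)

/-- The Poincaré inequality on a set, for quasi-periodic functions. -/
def PoincareOn (Q₀ : Set (Space d)) (n : Fin d → ℤ) (A : Set (Space d)) : Prop :=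
  ∃ C : NNReal, ∀ (κ : Space d) (u : Space d → ℂ), IsQuasiPeriodic κ u → ContDiff ℝ 1 u →
    phaseGap κ n * ∫⁻ y in A, ‖u y‖ₑ ^ 2 ≤ C * stiffEnergy Q₀ u

theorem PoincareOn.mono {n : Fin d → ℤ} {A B : Set (Space d)} (h : PoincareOn Q₀ n B)
    (hAB : A ⊆ B) : PoincareOn Q₀ n A := by
  obtain ⟨C, hC⟩ := h
  exact ⟨C, fun κ u hq hu => (mul_le_mul_right (lintegral_mono_set hAB) _).trans (hC κ u hq hu)⟩

theorem PoincareOn.union {n : Fin d → ℤ} {A B : Set (Space d)} (h : PoincareOn Q₀ n A)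
    (h' : PoincareOn Q₀ n B) : PoincareOn Q₀ n (A ∪ B) := by
  obtain ⟨C, hC⟩ := h
  obtain ⟨C', hC'⟩ := h'
  refine ⟨C + C', fun κ u hq hu => ?_⟩
  calc _ ≤ phaseGap κ n * ((∫⁻ y in A, ‖u y‖ₑ ^ 2) + ∫⁻ y in B, ‖u y‖ₑ ^ 2) :=
        mul_le_mul_right (lintegral_union_le _ _ _) _
    _ ≤ C * stiffEnergy Q₀ u + C' * stiffEnergy Q₀ u := by
        rw [mul_add]; exact add_le_add (hC κ u hq hu) (hC' κ u hq hu)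
    _ = _ := by push_cast; ring

/-- This is where quasi-periodicity replaces a zero-mean condition: linking x with x + n controls
the difference of `u` at the two places, which is (exp(iκ·n) − 1)u. -/
theorem poincareOn_interior (hcl : closure Q₀ ⊆ openCell d) (hc : IsPreconnected (stiff Q₀))
    (n : Fin d → ℤ) {x : Space d} (hx : x ∈ stiff Q₀) :
    ∃ ρ > 0, PoincareOn Q₀ n (Metric.ball x ρ) := by
  obtain ⟨ρ, hρ, C, hC⟩ := linked_of_connected hcl hc hx ((add_mem_stiff n).2 hx)
  refine ⟨ρ, hρ, C, fun κ u hq hu => ?_⟩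
  refine le_trans (le_of_eq ?_) (hC κ u hq hu)
  rw [← setLIntegral_ball_translate (fun y => ‖u y‖ₑ ^ 2), ← lintegral_const_mul]
  · refine lintegral_congr fun z => ?_
    have h1 : u (x + latticePoint n + z) = phase κ n * u (x + z) := by
      rw [add_right_comm]; exact hq n _
    rw [h1, phaseGap, ← mul_pow, ← enorm_mul, sub_mul, one_mul]
  · exact (hu.continuous.comp (continuous_const.add continuous_id)).enorm.measurable.pow_const 2

/-- Pushing the stiff points near `x` in the direction `c.e` moves them away from the soft set,
along segments that stay stiff, into a ball where the interior inequality is known. The increment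
costs only stiff energy, and its coefficient `phaseGap` is at most 4. -/
theorem poincareOn_boundary (hcl : closure Q₀ ⊆ openCell d) (hc : IsPreconnected (stiff Q₀))
    (ho : IsOpen Q₀) (n : Fin d → ℤ) {x : Space d} (hx : x ∈ frontier Q₀)
    (c : BoundaryChart Q₀ x) : ∃ ρ > 0, PoincareOn Q₀ n (Metric.ball x ρ ∩ stiff Q₀) := by
  have hr := c.r_pos
  set s : ℝ := c.r / 2 with hs
  have hs0 : 0 < s := by positivity
  have hnorm : ∀ t : ℝ, 0 ≤ t → ‖t • c.e‖ = t := fun t ht => by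
    rw [norm_smul, c.norm_e, mul_one, Real.norm_of_nonneg ht]
  have hx' : x + s • c.e ∈ stiff Q₀ := by
    refine c.mem_stiff ?_ ?_
    · rw [Metric.mem_ball, dist_eq_norm, add_sub_cancel_left, hnorm s hs0.le]; linarith
    · rw [c.shift, c.h_eq_zero ho (Metric.mem_ball_self hr) hx]; linarith
  obtain ⟨ρ', hρ', C', hC'⟩ := poincareOn_interior hcl hc n hx'
  set ρ := min ρ' s with hρ
  have hρ0 : 0 < ρ := lt_min hρ' hs0
  set A := Metric.ball x ρ ∩ stiff Q₀ with hA
  have hAm : MeasurableSet A :=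
    Metric.isOpen_ball.measurableSet.inter (isOpen_stiff hcl).measurableSet
  obtain ⟨C, hC⟩ := exists_translation_bound hcl hAm
    (Metric.isBounded_ball.subset inter_subset_left) (s • c.e) (fun y hy t ht => by
      -- The start of the segment is treated apart: the height there is only known to be
      -- nonpositive, whereas for t > 0 it is strictly negative.
      rcases ht.1.eq_or_lt with rfl | ht0
      · simpa using hy.2
      have hyb : dist y x < s := (Metric.mem_ball.1 hy.1).trans_le (min_le_right _ _)
      have hyr : y ∈ Metric.ball x c.r := by rw [Metric.mem_ball]; linarith
      have hyQ : y ∉ Q₀ := fun h => (mem_stiff_of_mem_cell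
        (openCell_subset_cell (c.ball_subset hyr))).1 hy.2 (subset_closure h)
      rw [smul_smul]
      have hts : 0 < t * s := by positivity
      refine c.mem_stiff ?_ ?_
      · rw [dist_eq_norm] at hyb
        rw [Metric.mem_ball, dist_eq_norm]
        have h1 : y + (t * s) • c.e - x = (y - x) + (t * s) • c.e := by abel
        rw [h1]
        refine (norm_add_le _ _).trans_lt ?_
        rw [hnorm _ hts.le]
        have h2 : t * s ≤ s := mul_le_of_le_one_left hs0.le ht.2
        linarith
      · rw [c.shift]
        linarith [c.h_nonpos hyr hyQ])
  refine ⟨ρ, hρ0, 4 * (4 * C + C'), fun κ u hq hu => ?_⟩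
  have hm1 : Measurable fun y => ‖u (y + s • c.e) - u y‖ₑ ^ 2 :=
    ((hu.continuous.comp (continuous_id.add continuous_const)).sub
      hu.continuous).enorm.measurable.pow_const 2
  have hm2 : Measurable fun y => ‖u (y + s • c.e)‖ₑ ^ 2 :=
    (hu.continuous.comp (continuous_id.add continuous_const)).enorm.measurable.pow_const 2
  have h1 : ∫⁻ y in A, ‖u y‖ₑ ^ 2 ≤ 4 * ((∫⁻ y in A, ‖u (y + s • c.e) - u y‖ₑ ^ 2) +
      ∫⁻ y in A, ‖u (y + s • c.e)‖ₑ ^ 2) := by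
    rw [← lintegral_add_left hm1, ← lintegral_const_mul _ (by exact hm1.add hm2)]
    refine lintegral_mono fun y => ?_
    have h2 := enorm_add_sq_le (u y - u (y + s • c.e)) (u (y + s • c.e))
    rwa [sub_add_cancel, enorm_sub_rev] at h2
  have h3 : ∫⁻ y in A, ‖u (y + s • c.e)‖ₑ ^ 2 ≤
      ∫⁻ y in Metric.ball (x + s • c.e) ρ', ‖u y‖ₑ ^ 2 := by
    rw [← lintegral_indicator hAm, ← lintegral_indicator Metric.isOpen_ball.measurableSet,
      ← lintegral_add_right_eq_self ((Metric.ball (x + s • c.e) ρ').indicator _) (s • c.e)]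
    refine lintegral_mono fun y => ?_
    by_cases hy : y ∈ A
    · rw [indicator_of_mem hy, indicator_of_mem]
      rw [Metric.mem_ball, dist_add_right]
      exact (Metric.mem_ball.1 hy.1).trans_le (min_le_left _ _)
    · rw [indicator_of_notMem hy]; exact zero_le
  calc phaseGap κ n * ∫⁻ y in A, ‖u y‖ₑ ^ 2
      ≤ phaseGap κ n * (4 * ((∫⁻ y in A, ‖u (y + s • c.e) - u y‖ₑ ^ 2) +
          ∫⁻ y in Metric.ball (x + s • c.e) ρ', ‖u y‖ₑ ^ 2)) := by
        gcongr; exact h1.trans (by gcongr)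
    _ = 4 * (phaseGap κ n * (∫⁻ y in A, ‖u (y + s • c.e) - u y‖ₑ ^ 2) +
          phaseGap κ n * ∫⁻ y in Metric.ball (x + s • c.e) ρ', ‖u y‖ₑ ^ 2) := by ring
    _ ≤ 4 * (4 * (C * stiffEnergy Q₀ u) + C' * stiffEnergy Q₀ u) := by
        refine mul_le_mul_right (add_le_add ?_ (hC' κ u hq hu)) _
        exact mul_le_mul' (phaseGap_le κ n) (hC κ u hq hu)
    _ = _ := by push_cast; ring

theorem poincareOn_stiff_cell (hcl : closure Q₀ ⊆ openCell d) (hc : IsPreconnected (stiff Q₀))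
    (ho : IsOpen Q₀) (hl : HasLipschitzBoundary Q₀) (n : Fin d → ℤ) :
    PoincareOn Q₀ n (cell d \ closure Q₀) := by
  -- Passing to the closed cube minus the open soft set gives a compact set. It acquires points of
  -- the upper faces, which are stiff, and of the boundary of `Q₀`, which the charts handle.
  set K : Set (Space d) := {y | ∀ i, y i ∈ Icc (0 : ℝ) 1} \ Q₀ with hK
  have hKc : IsCompact K := by
    refine Metric.isCompact_of_isClosed_isBounded ?_ ?_
    · refine IsClosed.sdiff ?_ ho
      simp only [ofPred_forall]
      exact isClosed_iInter fun i => isClosed_Icc.preimage (by fun_prop)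
    · refine (Metric.isBounded_closedBall (x := (0 : Space d)) (r := Real.sqrt d * 1)).subset ?_
      intro y hy
      rw [mem_closedBall_zero_iff]
      exact norm_le_of_coord_abs_le zero_le_one fun i => by
        rw [abs_of_nonneg (hy.1 i).1]; exact (hy.1 i).2
  have h : PoincareOn Q₀ n (K ∩ stiff Q₀) := by
    refine hKc.induction_on (p := fun S => PoincareOn Q₀ n (S ∩ stiff Q₀)) ?_ ?_ ?_ ?_
    · exact ⟨0, fun κ u _ _ => by simp⟩
    · exact fun S T hST hT => hT.mono (inter_subset_inter_left _ hST)
    · intro S T hS hT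
      rw [union_inter_distrib_right]; exact hS.union hT
    · intro x hx
      by_cases hxc : x ∈ closure Q₀
      · have hxf : x ∈ frontier Q₀ := by rw [ho.frontier_eq]; exact ⟨hxc, hx.2⟩
        obtain ⟨c⟩ := exists_boundaryChart hcl hl hxf
        obtain ⟨ρ, hρ, h⟩ := poincareOn_boundary hcl hc ho n hxf c
        exact ⟨_, mem_nhdsWithin_of_mem_nhds (Metric.ball_mem_nhds x hρ), h⟩
      · obtain ⟨ρ, hρ, h⟩ := poincareOn_interior hcl hc n (mem_stiff_of_mem_Icc hcl hx.1 hxc)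
        exact ⟨_, mem_nhdsWithin_of_mem_nhds (Metric.ball_mem_nhds x hρ),
          h.mono inter_subset_left⟩
  refine h.mono fun y hy => ⟨⟨fun i => Ico_subset_Icc_self (hy.1 i), fun h => hy.2
    (subset_closure h)⟩, (mem_stiff_of_mem_cell hy.1).2 hy.2⟩

end Poincare

end DoublePorosity

/-! ### Extension from the stiff component by reflection. -/

namespace DoublePorosity

variable {d : ℕ} {Q₀ : Set (Space d)}

/-- Preimages under an involution are images, and a K-Lipschitz image enlarges d-dimensional
Hausdorff measure by at most K^d. Lebesgue measure is a multiple of that measure, so no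
change-of-variables formula is required. -/
theorem exists_lintegral_comp_le {R : Space d → Space d} {K : NNReal} (hR : LipschitzWith K R)
    (hinv : Function.Involutive R) : ∃ C : NNReal, ∀ f : Space d → ℝ≥0∞, Measurable f →
      ∫⁻ y, f (R y) ≤ C * ∫⁻ y, f y := by
  refine ⟨K ^ (d : ℝ), fun f hf => ?_⟩
  have hRm : Measurable R := hR.continuous.measurable
  have hle : Measure.map R volume ≤ ((K ^ (d : ℝ) : NNReal) : ℝ≥0∞) • (volume : Measure (Space d)) := by
    refine Measure.le_iff.2 fun S hS => ?_
    rw [Measure.map_apply hRm hS, ← hinv.image_eq_preimage_symm]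
    rw [Measure.smul_apply, smul_eq_mul]
    have h1 := hR.hausdorffMeasure_image_le (d := (d : ℝ)) (Nat.cast_nonneg d) S
    rw [Measure.isAddLeftInvariant_eq_smul (volume : Measure (Space d))
      (Measure.hausdorffMeasure (d : ℝ))]
    simp only [Measure.smul_apply, ENNReal.smul_def, smul_eq_mul]
    rw [mul_left_comm]
    refine mul_le_mul_right (h1.trans (le_of_eq ?_)) _
    rw [ENNReal.coe_rpow_of_nonneg _ (Nat.cast_nonneg d)]
  calc ∫⁻ y, f (R y) = ∫⁻ y, f y ∂(Measure.map R volume) := (lintegral_map hf hRm).symm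
    _ ≤ ∫⁻ y, f y ∂(((K ^ (d : ℝ) : NNReal) : ℝ≥0∞) • (volume : Measure (Space d))) :=
        lintegral_mono' hle le_rfl
    _ = _ := by rw [lintegral_smul_measure, smul_eq_mul]

namespace BoundaryChart

variable {x : Space d} (c : BoundaryChart Q₀ x)

/-- The reflection in the boundary graph of a chart. -/
noncomputable def reflect (y : Space d) : Space d := y + (2 * c.h y) • c.e

theorem h_reflect (y : Space d) : c.h (c.reflect y) = -c.h y := by
  rw [reflect, c.shift]; ring

theorem involutive_reflect : Function.Involutive c.reflect := by
  intro y
  rw [reflect, h_reflect, reflect, add_assoc, ← add_smul]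
  simp

theorem lipschitzWith_reflect : LipschitzWith (1 + 2 * c.L) c.reflect := by
  refine LipschitzWith.id.add (LipschitzWith.of_dist_le_mul fun y z => ?_)
  rw [dist_eq_norm, ← sub_smul, norm_smul, c.norm_e, mul_one, ← mul_sub, norm_mul,
    ← dist_eq_norm]
  have := c.lip.dist_le_mul y z
  push_cast
  rw [Real.norm_of_nonneg zero_le_two]
  linarith

/-- A radius on which the reflection maps into the domain of the chart. -/
noncomputable def r' : ℝ := c.r / (1 + 2 * c.L)

theorem r'_pos : 0 < c.r' := div_pos c.r_pos (by positivity)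

theorem r'_le : c.r' ≤ c.r := div_le_self c.r_pos.le (by simp)

theorem reflect_mem_ball (ho : IsOpen Q₀) (hx : x ∈ frontier Q₀) {y : Space d}
    (hy : y ∈ Metric.ball x c.r') : c.reflect y ∈ Metric.ball x c.r := by
  have h0 : c.reflect x = x := by
    rw [reflect, c.h_eq_zero ho (Metric.mem_ball_self c.r_pos) hx]; simp
  have h1 := c.lipschitzWith_reflect.dist_le_mul y x
  rw [h0] at h1
  rw [Metric.mem_ball] at hy ⊢
  refine h1.trans_lt ?_
  push_cast
  rw [r', lt_div_iff₀ (by positivity)] at hy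
  linarith

theorem reflect_mem (ho : IsOpen Q₀) (hx : x ∈ frontier Q₀) {y : Space d}
    (hy : y ∈ Metric.ball x c.r') (hyQ : y ∈ Q₀) : c.reflect y ∈ cell d \ closure Q₀ := by
  have h1 := c.reflect_mem_ball ho hx hy
  refine ⟨openCell_subset_cell (c.ball_subset h1), c.notMem_closure h1 ?_⟩
  rw [h_reflect, neg_lt_zero]
  exact (c.mem_iff y (Metric.ball_subset_ball c.r'_le hy)).1 hyQ

end BoundaryChart

/-- The squared `H¹` density. -/
noncomputable def density (u : Space d → ℂ) (y : Space d) : ℝ≥0∞ :=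
  ‖u y‖ₑ ^ 2 + ‖fderiv ℝ u y‖ₑ ^ 2

theorem density_congr {u v : Space d → ℂ} {y : Space d} (h : u =ᶠ[nhds y] v) :
    density u y = density v y := by
  rw [density, density, h.fderiv_eq, h.eq_of_nhds]

theorem measurable_density {u : Space d → ℂ} (hu : Continuous u) : Measurable (density u) :=
  (hu.enorm.measurable.pow_const 2).add ((measurable_fderiv ℝ u).enorm.pow_const 2)

theorem density_smul_comp_le {φ : Space d → ℝ} {R : Space d → Space d} {u : Space d → ℂ}
    {M K : NNReal} {y : Space d} (hφ : DifferentiableAt ℝ φ y) (hR : DifferentiableAt ℝ R y)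
    (hu : DifferentiableAt ℝ u (R y)) (h1 : ‖φ y‖ ≤ M) (h2 : ‖fderiv ℝ φ y‖ ≤ M)
    (h3 : ‖fderiv ℝ R y‖ ≤ K) :
    density (fun y => φ y • u (R y)) y ≤ (5 * M ^ 2 + 4 * (M * K) ^ 2 : NNReal) * density u (R y) := by
  have e1 : ‖φ y‖ₑ ≤ M := by
    rw [enorm_eq_nnnorm]; exact_mod_cast h1
  have e2 : ‖fderiv ℝ φ y‖ₑ ≤ M := by
    rw [enorm_eq_nnnorm]; exact_mod_cast h2
  have e3 : ‖fderiv ℝ R y‖ₑ ≤ K := by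
    rw [enorm_eq_nnnorm]; exact_mod_cast h3
  have hd : fderiv ℝ (fun y => φ y • u (R y)) y =
      φ y • (fderiv ℝ u (R y)).comp (fderiv ℝ R y) + (fderiv ℝ φ y).smulRight (u (R y)) :=
    (hφ.hasFDerivAt.smul (hu.hasFDerivAt.comp y hR.hasFDerivAt)).fderiv
  have n1 : ‖φ y • (fderiv ℝ u (R y)).comp (fderiv ℝ R y)‖ₑ ≤ M * K * ‖fderiv ℝ u (R y)‖ₑ := by
    rw [enorm_smul]
    have h4 : ‖(fderiv ℝ u (R y)).comp (fderiv ℝ R y)‖ₑ ≤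
        ‖fderiv ℝ u (R y)‖ₑ * ‖fderiv ℝ R y‖ₑ := by
      have h5 := ContinuousLinearMap.opNorm_comp_le (fderiv ℝ u (R y)) (fderiv ℝ R y)
      rw [← ofReal_norm, ← ofReal_norm, ← ofReal_norm, ← ENNReal.ofReal_mul (norm_nonneg _)]
      exact ENNReal.ofReal_le_ofReal h5
    calc _ ≤ (M : ℝ≥0∞) * (‖fderiv ℝ u (R y)‖ₑ * K) :=
          mul_le_mul' e1 (h4.trans (mul_le_mul' le_rfl e3))
      _ = _ := by ring
  have n2 : ‖(fderiv ℝ φ y).smulRight (u (R y))‖ₑ ≤ M * ‖u (R y)‖ₑ := by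
    have : ‖(fderiv ℝ φ y).smulRight (u (R y))‖ₑ = ‖fderiv ℝ φ y‖ₑ * ‖u (R y)‖ₑ := by
      have h5 := ContinuousLinearMap.norm_smulRight_apply (fderiv ℝ φ y) (u (R y))
      rw [← ofReal_norm, h5, ENNReal.ofReal_mul (norm_nonneg _), ofReal_norm, ofReal_norm]
    rw [this]; exact mul_le_mul' e2 le_rfl
  rw [density, density, hd, enorm_smul, mul_pow]
  calc ‖φ y‖ₑ ^ 2 * ‖u (R y)‖ₑ ^ 2 +
        ‖φ y • (fderiv ℝ u (R y)).comp (fderiv ℝ R y) + (fderiv ℝ φ y).smulRight (u (R y))‖ₑ ^ 2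
      ≤ (M : ℝ≥0∞) ^ 2 * ‖u (R y)‖ₑ ^ 2 +
        4 * ((M * K * ‖fderiv ℝ u (R y)‖ₑ) ^ 2 + (M * ‖u (R y)‖ₑ) ^ 2) := by
        refine add_le_add (mul_le_mul' (pow_le_pow_left₀ zero_le e1 2) le_rfl) ?_
        refine (enorm_add_sq_le _ _).trans (mul_le_mul' le_rfl (add_le_add ?_ ?_))
        · exact pow_le_pow_left₀ zero_le n1 2
        · exact pow_le_pow_left₀ zero_le n2 2
    _ = 5 * (M : ℝ≥0∞) ^ 2 * ‖u (R y)‖ₑ ^ 2 + 4 * (M * K : ℝ≥0∞) ^ 2 * ‖fderiv ℝ u (R y)‖ₑ ^ 2 := by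
        ring
    _ ≤ (5 * M ^ 2 + 4 * (M * K) ^ 2 : NNReal) * ‖u (R y)‖ₑ ^ 2 +
        (5 * M ^ 2 + 4 * (M * K) ^ 2 : NNReal) * ‖fderiv ℝ u (R y)‖ₑ ^ 2 := by
        push_cast
        exact add_le_add (mul_le_mul' le_self_add le_rfl) (mul_le_mul' le_add_self le_rfl)
    _ = _ := by rw [mul_add]

theorem exists_reflect_bound (ho : IsOpen Q₀) {x : Space d} (hx : x ∈ frontier Q₀)
    (c : BoundaryChart Q₀ x) {φ : Space d → ℝ} (hφ : ContDiff ℝ 1 φ)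
    (hs : tsupport φ ⊆ Metric.ball x c.r') :
    ∃ C : NNReal, ∀ u : Space d → ℂ, ContDiff ℝ 1 u →
      ∫⁻ y in Q₀, density (fun y => φ y • u (c.reflect y)) y ≤
        C * ∫⁻ y in cell d \ closure Q₀, density u y := by
  have hcs : HasCompactSupport φ := Metric.isCompact_of_isClosed_isBounded (isClosed_tsupport φ)
    (Metric.isBounded_ball.subset hs)
  obtain ⟨M₁, hM₁⟩ := hcs.exists_bound_of_continuous hφ.continuous
  obtain ⟨M₂, hM₂⟩ := (hcs.fderiv ℝ).exists_bound_of_continuous (hφ.continuous_fderiv (by simp))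
  set M : NNReal := (max M₁ M₂).toNNReal
  have hM : max M₁ M₂ ≤ M := Real.le_coe_toNNReal _
  set K : NNReal := 1 + 2 * c.L
  obtain ⟨C, hC⟩ := exists_lintegral_comp_le c.lipschitzWith_reflect c.involutive_reflect
  have hm1 : MeasurableSet (cell d \ closure Q₀) := measurableSet_cell.diff isClosed_closure.measurableSet
  refine ⟨(5 * M ^ 2 + 4 * (M * K) ^ 2) * C, fun u hu => ?_⟩
  set F := (cell d \ closure Q₀).indicator (density u) with hF
  have hFm : Measurable F := (measurable_density hu.continuous).indicator hm1
  calc ∫⁻ y in Q₀, density (fun y => φ y • u (c.reflect y)) y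
      ≤ ∫⁻ y in Q₀, (5 * M ^ 2 + 4 * (M * K) ^ 2 : NNReal) * F (c.reflect y) := by
        refine lintegral_mono_ae ?_
        filter_upwards [ae_restrict_mem ho.measurableSet,
          -- The reflection is only Lipschitz, so the chain rule is used almost everywhere, by
          -- Rademacher.
          ae_restrict_of_ae c.lipschitzWith_reflect.ae_differentiableAt] with y hy hyd
        by_cases hys : y ∈ tsupport φ
        · rw [hF, indicator_of_mem (c.reflect_mem ho hx (hs hys) hy)]
          exact density_smul_comp_le (hφ.differentiable (by simp) y) hyd
            (hu.differentiable (by simp) _) (((hM₁ y).trans (le_max_left _ _)).trans hM)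
            (((hM₂ y).trans (le_max_right _ _)).trans hM)
            (norm_fderiv_le_of_lipschitz ℝ c.lipschitzWith_reflect)
        · have h0 : (fun y => φ y • u (c.reflect y)) =ᶠ[nhds y] fun _ => 0 := by
            filter_upwards [notMem_tsupport_iff_eventuallyEq.1 hys] with z hz
            simp [hz]
          rw [density_congr h0]
          simp [density, enorm_eq_nnnorm]
    _ ≤ ∫⁻ y, (5 * M ^ 2 + 4 * (M * K) ^ 2 : NNReal) * F (c.reflect y) :=
        setLIntegral_le_lintegral _ _
    _ = (5 * M ^ 2 + 4 * (M * K) ^ 2 : NNReal) * ∫⁻ y, F (c.reflect y) :=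
        lintegral_const_mul _ (hFm.comp c.lipschitzWith_reflect.continuous.measurable)
    _ ≤ (5 * M ^ 2 + 4 * (M * K) ^ 2 : NNReal) * (C * ∫⁻ y, F y) :=
        mul_le_mul' le_rfl (hC F hFm)
    _ = _ := by
        rw [hF, lintegral_indicator hm1]; push_cast; ring

/-- A segment leaving the open set crosses its frontier, where `u` vanishes. The value at the inner
endpoint is thus bounded by `K` times the length, and the Lipschitz constant is unchanged. -/
theorem lipschitzWith_indicator {u : Space d → ℂ} {K : NNReal} (hu : LipschitzWith K u)
    (ho : IsOpen Q₀) (h0 : ∀ y ∈ frontier Q₀, u y = 0) : LipschitzWith K (Q₀.indicator u) := by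
  have key : ∀ y ∈ Q₀, ∀ z ∉ Q₀, ‖u y‖ ≤ K * dist y z := by
    intro y hy z hz
    have hp : (segment ℝ y z ∩ frontier Q₀).Nonempty := by
      by_contra hne
      rw [Set.not_nonempty_iff_eq_empty] at hne
      have hzc : z ∉ closure Q₀ := fun h => by
        have : z ∈ segment ℝ y z ∩ frontier Q₀ :=
          ⟨right_mem_segment ℝ y z, by rw [ho.frontier_eq]; exact ⟨h, hz⟩⟩
        rw [hne] at this; exact this
      have hcov : segment ℝ y z ⊆ Q₀ ∪ (closure Q₀)ᶜ := by
        intro p hp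
        by_contra h
        rw [mem_union, not_or, mem_compl_iff, not_not] at h
        have : p ∈ segment ℝ y z ∩ frontier Q₀ := ⟨hp, by rw [ho.frontier_eq]; exact ⟨h.2, h.1⟩⟩
        rw [hne] at this; exact this
      obtain ⟨p, _, hp1, hp2⟩ := (convex_segment y z).isPreconnected Q₀ (closure Q₀)ᶜ ho
        isClosed_closure.isOpen_compl hcov ⟨y, left_mem_segment ℝ y z, hy⟩
        ⟨z, right_mem_segment ℝ y z, hzc⟩
      exact hp2 (subset_closure hp1)
    obtain ⟨p, hp, hpf⟩ := hp
    have h1 := dist_add_dist_of_mem_segment hp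
    have h2 := hu.dist_le_mul y p
    rw [h0 p hpf, dist_zero_right] at h2
    exact h2.trans (mul_le_mul_of_nonneg_left (by linarith [dist_nonneg (x := p) (y := z)]) K.2)
  refine LipschitzWith.of_dist_le_mul fun y z => ?_
  by_cases hy : y ∈ Q₀ <;> by_cases hz : z ∈ Q₀
  · rw [indicator_of_mem hy, indicator_of_mem hz]; exact hu.dist_le_mul y z
  · rw [indicator_of_mem hy, indicator_of_notMem hz, dist_zero_right]; exact key y hy z hz
  · rw [indicator_of_notMem hy, indicator_of_mem hz, dist_zero_left, dist_comm]; exact key z hz y hy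
  · rw [indicator_of_notMem hy, indicator_of_notMem hz, dist_self]; positivity

/-- The cut-offs need to sum to one on the frontier only, since there alone must the reflected
function match the original. -/
theorem exists_boundary_partition (hcl : closure Q₀ ⊆ openCell d) (hl : HasLipschitzBoundary Q₀) :
    ∃ (ι : Type) (_ : Fintype ι) (p : ι → Space d) (c : ∀ i, BoundaryChart Q₀ (p i))
      (φ : ι → Space d → ℝ), (∀ i, p i ∈ frontier Q₀) ∧ (∀ i, ContDiff ℝ 1 (φ i)) ∧
      (∀ i, tsupport (φ i) ⊆ Metric.ball (p i) (c i).r') ∧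
      ∀ y ∈ frontier Q₀, ∑ i, φ i y = 1 := by
  have hch : ∀ x : frontier Q₀, Nonempty (BoundaryChart Q₀ (x : Space d)) := fun x =>
    exists_boundaryChart hcl hl x.2
  let c := fun x => Classical.choice (hch x)
  obtain ⟨t, ht⟩ := (isCompact_frontier_soft hcl).elim_finite_subcover
    (fun x : frontier Q₀ => Metric.ball (x : Space d) (c x).r') (fun _ => Metric.isOpen_ball)
    fun y hy => mem_iUnion.2 ⟨⟨y, hy⟩, Metric.mem_ball_self (c ⟨y, hy⟩).r'_pos⟩
  let p : Fin t.card → frontier Q₀ := fun i => (t.equivFin.symm i : frontier Q₀)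
  have hcov : frontier Q₀ ⊆ ⋃ i : Fin t.card, Metric.ball (p i : Space d) (c (p i)).r' := by
    intro y hy
    obtain ⟨x, hx, hy'⟩ := mem_iUnion₂.1 (ht hy)
    refine mem_iUnion.2 ⟨t.equivFin ⟨x, hx⟩, ?_⟩
    have hpx : p (t.equivFin ⟨x, hx⟩) = x := by simp [p]
    rw [hpx]; exact hy'
  obtain ⟨f, hf⟩ := SmoothPartitionOfUnity.exists_isSubordinate
    (modelWithCornersSelf ℝ (Space d)) isClosed_frontier
    (fun i : Fin t.card => Metric.ball (p i : Space d) (c (p i)).r')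
    (fun _ => Metric.isOpen_ball) hcov
  refine ⟨Fin t.card, inferInstance, fun i => p i, fun i => c (p i), fun i => f i,
    fun i => (p i).2, fun i => (f i).contMDiff.contDiff.of_le (by simp), hf, fun y hy => ?_⟩
  rw [← finsum_eq_sum_of_fintype]
  exact f.sum_eq_one hy

theorem density_sum_le {ι : Type*} [Fintype ι] {w : ι → Space d → ℂ} {y : Space d}
    (hw : ∀ i, DifferentiableAt ℝ (w i) y) :
    density (fun y => ∑ i, w i y) y ≤ Fintype.card ι * ∑ i, density (w i) y := by
  have key : ∀ {E : Type} [NormedAddCommGroup E] (a : ι → E),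
      ‖∑ i, a i‖ₑ ^ 2 ≤ Fintype.card ι * ∑ i, ‖a i‖ₑ ^ 2 := by
    intro E _ a
    have h1 : ‖∑ i, a i‖ ^ 2 ≤ Fintype.card ι * ∑ i, ‖a i‖ ^ 2 :=
      (pow_le_pow_left₀ (norm_nonneg _) (norm_sum_le _ _) 2).trans
        (sq_sum_le_card_mul_sum_sq (s := Finset.univ))
    have h2 : ‖∑ i, a i‖₊ ^ 2 ≤ Fintype.card ι * ∑ i, ‖a i‖₊ ^ 2 := by
      rw [← NNReal.coe_le_coe]; push_cast; exact h1
    simp only [enorm_eq_nnnorm]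
    exact_mod_cast h2
  rw [density, fderiv_fun_sum fun i _ => hw i]
  refine (add_le_add (key _) (key _)).trans (le_of_eq ?_)
  rw [← mul_add, ← Finset.sum_add_distrib]
  rfl

theorem cell_ae_split (ho : IsOpen Q₀) (hcl : closure Q₀ ⊆ openCell d)
    (hl : HasLipschitzBoundary Q₀) (f : Space d → ℝ≥0∞) :
    ∫⁻ y in cell d, f y ≤ (∫⁻ y in cell d \ closure Q₀, f y) + ∫⁻ y in Q₀, f y := by
  have h : cell d ⊆ (cell d \ closure Q₀ ∪ Q₀) ∪ frontier Q₀ := by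
    intro y hy
    by_cases h1 : y ∈ closure Q₀
    · by_cases h2 : y ∈ Q₀
      · exact Or.inl (Or.inr h2)
      · exact Or.inr (by rw [ho.frontier_eq]; exact ⟨h1, h2⟩)
    · exact Or.inl (Or.inl ⟨hy, h1⟩)
  refine (lintegral_mono_set h).trans ((lintegral_union_le _ _ _).trans ?_)
  rw [setLIntegral_measure_zero _ _ (volume_frontier_eq_zero ho hcl hl), add_zero]
  exact lintegral_union_le _ _ _

theorem enorm_sq_le_density {κ : Space d} {p : H1 κ} {D : Space d → ℂ}
    (h1 : fn p =ᵐ[cellMeasure d] D) (h2 : grad p =ᵐ[cellMeasure d] gradVec D) :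
    ‖p‖ₑ ^ 2 ≤ (1 + d) * ∫⁻ y in cell d, density D y := by
  have h0 : ‖p‖ₑ ^ 2 = ‖fn p‖ₑ ^ 2 + ‖grad p‖ₑ ^ 2 := by
    have h := norm_sq_H1 p
    have h' : ‖p‖₊ ^ 2 = ‖fn p‖₊ ^ 2 + ‖grad p‖₊ ^ 2 := NNReal.eq (by push_cast; exact h)
    simp only [enorm_eq_nnnorm]
    exact_mod_cast h'
  rw [h0, enorm_sq_Lp, enorm_sq_Lp, add_mul, one_mul]
  refine add_le_add ?_ ?_
  · refine lintegral_mono_ae ?_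
    filter_upwards [h1] with y hy
    rw [hy]; exact le_self_add
  · rw [← lintegral_const_mul' _ _ (ENNReal.natCast_ne_top d)]
    refine lintegral_mono_ae ?_
    filter_upwards [h2] with y hy
    rw [hy]
    have h3 := norm_gradVec_le D y
    have h4 : ‖gradVec D y‖ ^ 2 ≤ d * ‖fderiv ℝ D y‖ ^ 2 := by
      refine (pow_le_pow_left₀ (norm_nonneg _) h3 2).trans (le_of_eq ?_)
      rw [mul_pow, Real.sq_sqrt (Nat.cast_nonneg d)]
    have h5 : ‖gradVec D y‖₊ ^ 2 ≤ d * ‖fderiv ℝ D y‖₊ ^ 2 := by exact_mod_cast h4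
    have h6 : ‖gradVec D y‖ₑ ^ 2 ≤ d * ‖fderiv ℝ D y‖ₑ ^ 2 := by
      simp only [enorm_eq_nnnorm]; exact_mod_cast h5
    exact h6.trans (mul_le_mul' le_rfl le_add_self)

/-- Extension from the stiff component: up to an element of `H¹_0(Q₀)`, a function is controlled by
its restriction to the stiff component. -/
theorem exists_soft_correction (ho : IsOpen Q₀) (hcl : closure Q₀ ⊆ openCell d)
    (hl : HasLipschitzBoundary Q₀) :
    ∃ C : NNReal, ∀ (κ : Space d) (u : Space d → ℂ) (q : H1 κ), IsQuasiPeriodic κ u →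
      ContDiff ℝ 1 u → fn q =ᵐ[cellMeasure d] u → grad q =ᵐ[cellMeasure d] gradVec u →
      ∃ v ∈ H10sub κ Q₀, ‖q - v‖ₑ ^ 2 ≤ C * ∫⁻ y in cell d \ closure Q₀, density u y := by
  obtain ⟨ι, _, p, c, φ, hp, hφ, hs, hsum⟩ := exists_boundary_partition hcl hl
  choose C hC using fun i => exists_reflect_bound ho (hp i) (c i) (hφ i) (hs i)
  refine ⟨(1 + d) * (1 + Fintype.card ι * ∑ i, C i), fun κ u q hq hu hq1 hq2 => ?_⟩
  obtain ⟨B, hB⟩ := contDiff_gradVec_bounded hu hq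
  have huL : LipschitzWith B u := lipschitzWith_of_nnnorm_fderiv_le (hu.differentiable (by simp))
    fun y => (hB y).2
  -- Inside the soft set these functions see only values of `u` on the stiff cell. Each chart
  -- reflection fixes the boundary points in its ball, so the sum `W` agrees with `u` on the
  -- frontier.
  set w : ι → Space d → ℂ := fun i y => φ i y • u ((c i).reflect y) with hw
  have hwL : ∀ i, ∃ K : NNReal, LipschitzWith K (w i) := by
    intro i
    have hcs : HasCompactSupport (φ i) := Metric.isCompact_of_isClosed_isBounded
      (isClosed_tsupport _) (Metric.isBounded_ball.subset (hs i))
    obtain ⟨M, hM⟩ := hcs.exists_bound_of_continuous (hφ i).continuous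
    obtain ⟨L, hL⟩ := (hφ i).lipschitzWith_of_hasCompactSupport hcs (by simp)
    have huR := huL.comp (c i).lipschitzWith_reflect
    have hM0 : 0 ≤ M := (norm_nonneg _).trans (hM 0)
    refine ⟨M.toNNReal * (B * (1 + 2 * (c i).L)) + L * B, LipschitzWith.of_dist_le_mul fun y z => ?_⟩
    have e : w i y - w i z = φ i y • (u ((c i).reflect y) - u ((c i).reflect z)) +
        (φ i y - φ i z) • u ((c i).reflect z) := by
      simp only [hw, smul_sub, sub_smul]; abel
    rw [dist_eq_norm, e]
    refine (norm_add_le _ _).trans ?_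
    rw [norm_smul, norm_smul, ← dist_eq_norm, ← dist_eq_norm, NNReal.coe_add, NNReal.coe_mul,
      Real.coe_toNNReal _ hM0, NNReal.coe_mul L B, add_mul, mul_assoc]
    refine add_le_add (mul_le_mul (hM y) (huR.dist_le_mul y z) dist_nonneg hM0) ?_
    calc dist (φ i y) (φ i z) * ‖u ((c i).reflect z)‖ ≤ (L * dist y z) * B :=
          mul_le_mul (hL.dist_le_mul y z) (hB _).1 (norm_nonneg _) (by positivity)
      _ = _ := by ring
  choose K hK using hwL
  set W : Space d → ℂ := fun y => ∑ i, w i y with hW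
  have hWL : LipschitzWith (∑ i, K i) W := by
    refine LipschitzWith.of_dist_le_mul fun y z => ?_
    rw [dist_eq_norm, hW, ← Finset.sum_sub_distrib]
    refine (norm_sum_le _ _).trans ?_
    rw [NNReal.coe_sum, Finset.sum_mul]
    refine Finset.sum_le_sum fun i _ => ?_
    rw [← dist_eq_norm]; exact (hK i).dist_le_mul y z
  have hf0 : ∀ y ∈ frontier Q₀, (u - W) y = 0 := by
    intro y hy
    have h1 : ∀ i, w i y = (φ i y : ℂ) * u y := by
      intro i
      by_cases hyi : y ∈ tsupport (φ i)
      · have hyb := Metric.ball_subset_ball (c i).r'_le (hs i hyi)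
        have : (c i).reflect y = y := by
          rw [BoundaryChart.reflect, (c i).h_eq_zero ho hyb hy]; simp
        simp only [hw, this, Complex.real_smul]
      · simp [hw, image_eq_zero_of_notMem_tsupport hyi]
    simp only [Pi.sub_apply, hW, h1, ← Finset.sum_mul]
    rw [← Complex.ofReal_sum, hsum y hy]; simp
  -- Subtracting `v` leaves `u` unchanged off the soft set and puts `W` inside it. As u − W vanishes
  -- on the frontier, `v` is Lipschitz and so lies in H¹₀.
  set v := Q₀.indicator (u - W) with hv
  have hvL : LipschitzWith (B + ∑ i, K i) v := lipschitzWith_indicator (huL.sub hWL) ho hf0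
  have hv0 : ∀ y ∉ Q₀, v y = 0 := fun y hy => indicator_of_notMem hy _
  have hvs : tsupport v ⊆ openCell d :=
    (closure_mono (fun y hy => by by_contra h; exact hy (hv0 y h))).trans hcl
  obtain ⟨pv, hpv1, hpv2⟩ := exists_H1_of_lipschitz κ hvL hvs
  refine ⟨pv, mem_H10sub_of_lipschitz hcl hvL hv0 hpv1, ?_⟩
  have hD1 : fn (q - pv) =ᵐ[cellMeasure d] (u - v) := by
    have : fn (q - pv) = fn q - fn pv := rfl
    rw [this]
    exact (Lp.coeFn_sub _ _).trans (hq1.sub hpv1)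
  have hD2 : grad (q - pv) =ᵐ[cellMeasure d] gradVec (u - v) := by
    have : grad (q - pv) = grad q - grad pv := rfl
    rw [this]
    filter_upwards [Lp.coeFn_sub (grad q) (grad pv), hq2, hpv2,
      ae_restrict_of_ae hvL.ae_differentiableAt] with y e1 e2 e3 e4
    rw [e1, Pi.sub_apply, e2, e3]
    ext i
    simp only [PiLp.sub_apply, gradVec_apply]
    rw [fderiv_sub (hu.differentiable (by simp) y) e4]
    rfl
  refine (enorm_sq_le_density hD1 hD2).trans ?_
  have hI1 : ∫⁻ y in cell d \ closure Q₀, density (u - v) y =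
      ∫⁻ y in cell d \ closure Q₀, density u y := by
    refine setLIntegral_congr_fun (measurableSet_cell.diff isClosed_closure.measurableSet)
      fun y hy => density_congr ?_
    filter_upwards [isClosed_closure.isOpen_compl.mem_nhds hy.2] with z hz
    rw [Pi.sub_apply, hv0 z fun h => hz (subset_closure h), sub_zero]
  have hI2 : ∫⁻ y in Q₀, density (u - v) y ≤
      Fintype.card ι * ∑ i, C i * ∫⁻ y in cell d \ closure Q₀, density u y := by
    calc ∫⁻ y in Q₀, density (u - v) y
        ≤ ∫⁻ y in Q₀, Fintype.card ι * ∑ i, density (w i) y := by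
          refine lintegral_mono_ae ?_
          filter_upwards [ae_restrict_mem ho.measurableSet,
            ae_restrict_of_ae (ae_all_iff.2 fun i => (hK i).ae_differentiableAt)] with y hy hyd
          have h1 : (u - v) =ᶠ[nhds y] W := by
            filter_upwards [ho.mem_nhds hy] with z hz
            rw [Pi.sub_apply, hv, indicator_of_mem hz, Pi.sub_apply, sub_sub_cancel]
          rw [density_congr h1]
          exact density_sum_le hyd
      _ = Fintype.card ι * ∑ i, ∫⁻ y in Q₀, density (w i) y := by
          rw [lintegral_const_mul' _ _ (ENNReal.natCast_ne_top _),
            lintegral_finsetSum _ fun i _ => measurable_density (hK i).continuous]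
      _ ≤ _ := mul_le_mul' le_rfl (Finset.sum_le_sum fun i _ => hC i u hu)
  calc (1 + d : ℝ≥0∞) * ∫⁻ y in cell d, density (u - v) y
      ≤ (1 + d) * ((∫⁻ y in cell d \ closure Q₀, density u y) +
          Fintype.card ι * ∑ i, C i * ∫⁻ y in cell d \ closure Q₀, density u y) := by
        refine mul_le_mul' le_rfl ((cell_ae_split ho hcl hl _).trans ?_)
        rw [hI1]; exact add_le_add le_rfl hI2
    _ = _ := by
        rw [← Finset.sum_mul]; push_cast; ring

end DoublePorosity

/-! ### The distance to the dual lattice and the gap estimate. -/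

namespace DoublePorosity
variable {d : ℕ} {Q₀ : Set (Space d)}

theorem zero_mem_dualLattice : (0 : Space d) ∈ dualLattice d := ⟨0, fun i => by simp⟩

theorem isClosed_dualLattice : IsClosed (dualLattice d) := by
  have h : dualLattice d = ⋂ i : Fin d, (fun x : Space d => x i / (2 * Real.pi)) ⁻¹'
      (range ((↑) : ℤ → ℝ)) := by
    ext x
    have hpi := Real.pi_pos
    simp only [mem_iInter, mem_preimage, mem_range]
    constructor
    · rintro ⟨m, hm⟩ i
      exact ⟨m i, by rw [hm i]; field_simp⟩
    · intro hx
      choose m hm using hx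
      exact ⟨m, fun i => by rw [hm i]; field_simp⟩
  rw [h]
  exact isClosed_iInter fun i => Int.isClosedEmbedding_coe_real.isClosed_range.preimage
    (by fun_prop)

theorem infDist_dualLattice_pos {κ : Space d} (hκ : κ ∉ dualLattice d) :
    0 < Metric.infDist κ (dualLattice d) :=
  (isClosed_dualLattice.notMem_iff_infDist_pos ⟨0, zero_mem_dualLattice⟩).1 hκ

/-- Reduction modulo 2π gives s in [−π, π]; then |exp(is) − 1| = 2|sin(s/2)|, and Jordan's
inequality |sin x| ≥ (2/π)|x| yields the constant π/2. -/
theorem abs_sub_round_le_norm_exp (t : ℝ) :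
    |t - 2 * Real.pi * round (t / (2 * Real.pi))| ≤
      Real.pi / 2 * ‖Complex.exp (Complex.I * t) - 1‖ := by
  set m := round (t / (2 * Real.pi))
  set s := t - 2 * Real.pi * m with hs
  have hpi := Real.pi_pos
  have hsle : |s| ≤ Real.pi := by
    have h1 := abs_sub_round (t / (2 * Real.pi))
    have h2 : s = 2 * Real.pi * (t / (2 * Real.pi) - m) := by rw [hs]; field_simp
    rw [h2, abs_mul, abs_of_pos (by positivity)]
    nlinarith
  have he : Complex.exp (Complex.I * t) = Complex.exp (Complex.I * s) := by
    have : (Complex.I * t : ℂ) = Complex.I * s + m * (2 * Real.pi * Complex.I) := by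
      rw [hs]; push_cast; ring
    rw [this, Complex.exp_add, Complex.exp_int_mul_two_pi_mul_I, mul_one]
  rw [he, Complex.norm_exp_I_mul_ofReal_sub_one, norm_mul, Real.norm_of_nonneg zero_le_two,
    Real.norm_eq_abs]
  have h3 := Real.mul_abs_le_abs_sin (x := s / 2) (by rw [abs_div, abs_two]; linarith)
  rw [abs_div, abs_two] at h3
  have h4 : Real.pi / 2 * (2 / Real.pi * (|s| / 2)) = |s| / 2 := by field_simp
  have h5 := mul_le_mul_of_nonneg_left h3 (by positivity : 0 ≤ Real.pi / 2)
  rw [h4] at h5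
  linarith

theorem infDist_sq_le_sum (κ : Space d) :
    Metric.infDist κ (dualLattice d) ^ 2 ≤
      (Real.pi / 2) ^ 2 * ∑ i, ‖phase κ (Pi.single i 1) - 1‖ ^ 2 := by
  set m : Fin d → ℤ := fun i => round (κ i / (2 * Real.pi))
  set x : Space d := WithLp.toLp 2 fun i => 2 * Real.pi * (m i : ℝ)
  have hx : x ∈ dualLattice d := ⟨m, fun i => rfl⟩
  refine (pow_le_pow_left₀ Metric.infDist_nonneg (Metric.infDist_le_dist_of_mem hx) 2).trans ?_
  rw [dist_eq_norm, EuclideanSpace.norm_sq_eq, Finset.mul_sum]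
  refine Finset.sum_le_sum fun i _ => ?_
  have h1 : phase κ (Pi.single i 1) = Complex.exp (Complex.I * (κ i : ℝ)) := by
    rw [phase, Finset.sum_eq_single i]
    · simp
    · intro j _ hj; simp [hj]
    · simp
  rw [h1, ← mul_pow, PiLp.sub_apply]
  exact pow_le_pow_left₀ (norm_nonneg _) (abs_sub_round_le_norm_exp (κ i)) 2

/-- This bound absorbs the factor d(κ)² in front of the gradient term, for which no smallness is
needed. -/
theorem infDist_sq_le (κ : Space d) :
    Metric.infDist κ (dualLattice d) ^ 2 ≤ Real.pi ^ 2 * d := by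
  refine (infDist_sq_le_sum κ).trans ?_
  have h : ∀ i ∈ (Finset.univ : Finset (Fin d)), ‖phase κ (Pi.single i 1) - 1‖ ^ 2 ≤ (4 : ℝ) := by
    intro i _
    have h1 := norm_sub_le (phase κ (Pi.single i 1)) 1
    rw [norm_phase, norm_one] at h1
    nlinarith [norm_nonneg (phase κ (Pi.single i 1) - 1)]
  have h2 := Finset.sum_le_card_nsmul _ _ _ h
  rw [Finset.card_univ, Fintype.card_fin, nsmul_eq_mul] at h2
  nlinarith [Real.pi_pos, mul_le_mul_of_nonneg_left h2 (sq_nonneg (Real.pi / 2))]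

/-- The gradient on the stiff component. -/
noncomputable def stiffGrad (κ : Space d) (Q₀ : Set (Space d)) :
    H1 κ →L[ℂ] Lp (CVec d) 2 ((cellMeasure d).restrict (closure Q₀)ᶜ) :=
  (LpToLpRestrictCLM (Space d) (CVec d) ℂ (cellMeasure d) 2 (closure Q₀)ᶜ).comp (gradL κ)

theorem stiffGrad_ae {κ : Space d} (u : H1 κ) :
    stiffGrad κ Q₀ u =ᵐ[(cellMeasure d).restrict (closure Q₀)ᶜ] grad u :=
  LpToLpRestrictCLM_coeFn ℂ _ _

theorem restrict_compl_closure :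
    (cellMeasure d).restrict (closure Q₀)ᶜ = volume.restrict (cell d \ closure Q₀) := by
  rw [Measure.restrict_restrict isClosed_closure.measurableSet.compl, inter_comm]; rfl

theorem enorm_sq_stiffGrad {κ : Space d} (u : H1 κ) :
    ‖stiffGrad κ Q₀ u‖ₑ ^ 2 = ∫⁻ y in cell d \ closure Q₀, ‖grad u y‖ₑ ^ 2 := by
  rw [enorm_sq_Lp, ← restrict_compl_closure]
  refine lintegral_congr_ae ?_
  filter_upwards [stiffGrad_ae (Q₀ := Q₀) u] with y hy
  rw [hy]

/-- The generators vanish near every point off the closure of `Q₀`, and the kernel of a continuous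
map is closed. -/
theorem stiffGrad_eq_zero {κ : Space d} (hcl : closure Q₀ ⊆ openCell d) {v : H1 κ}
    (hv : v ∈ H10sub κ Q₀) : stiffGrad κ Q₀ v = 0 := by
  have hle : smoothCompact κ Q₀ ≤ (stiffGrad κ Q₀).ker := by
    rintro v ⟨φ, hφ, -, hs, hv⟩
    rw [LinearMap.mem_ker]
    have hg := grad_ae_eq_of_smoothCompact (hφ.of_le (by simp))
      (hs.trans (subset_closure.trans hcl)) hv
    refine Lp.ext ?_
    filter_upwards [stiffGrad_ae (Q₀ := Q₀) v, ae_restrict_of_ae hg, Lp.coeFn_zero (CVec d) 2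
      ((cellMeasure d).restrict (closure Q₀)ᶜ),
      ae_restrict_mem isClosed_closure.measurableSet.compl] with y h1 h2 h3 h4
    have h5 : φ =ᶠ[nhds y] 0 :=
      notMem_tsupport_iff_eventuallyEq.1 fun h => h4 (subset_closure (hs h))
    have h6 : gradVec φ y = 0 := by
      ext i
      rw [gradVec_apply, h5.fderiv_eq]
      simp
    rw [h3]
    exact h1.trans (h2.trans h6)
  exact (Submodule.topologicalClosure_minimal _ hle (stiffGrad κ Q₀).isClosed_ker) hv

/-- The correction reduces the claim to d(κ)² times the H¹ norm on the stiff cell. The function part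
is handled by the Poincaré inequalities in the coordinate directions, summed; the gradient part by
boundedness of d(κ). -/
theorem exists_smooth_gap (ho : IsOpen Q₀) (hcl : closure Q₀ ⊆ openCell d)
    (hl : HasLipschitzBoundary Q₀) (hc : IsPreconnected (stiff Q₀)) :
    ∃ C : NNReal, ∀ (κ : Space d) (u : Space d → ℂ) (q : H1 κ), IsQuasiPeriodic κ u →
      ContDiff ℝ 1 u → fn q =ᵐ[cellMeasure d] u → grad q =ᵐ[cellMeasure d] gradVec u →
      ∃ v ∈ H10sub κ Q₀,
        ENNReal.ofReal (Metric.infDist κ (dualLattice d) ^ 2) * ‖q - v‖ₑ ^ 2 ≤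
          C * ‖stiffGrad κ Q₀ q‖ₑ ^ 2 := by
  obtain ⟨C₁, hC₁⟩ := exists_soft_correction ho hcl hl
  choose C₂ hC₂ using fun i : Fin d =>
    poincareOn_stiff_cell hcl hc ho hl (Pi.single i 1)
  set P : NNReal := (Real.pi).toNNReal with hP
  refine ⟨C₁ * ((P / 2) ^ 2 * ∑ i, C₂ i + P ^ 2 * d), fun κ u q hq hu h1 h2 => ?_⟩
  obtain ⟨v, hv, hqv⟩ := hC₁ κ u q hq hu h1 h2
  refine ⟨v, hv, ?_⟩
  set δ := Metric.infDist κ (dualLattice d)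
  set S := stiffEnergy Q₀ u with hS
  have hSle : S ≤ ‖stiffGrad κ Q₀ q‖ₑ ^ 2 := by
    rw [enorm_sq_stiffGrad, hS, stiffEnergy, ← restrict_compl_closure]
    refine lintegral_mono_ae ?_
    filter_upwards [ae_restrict_of_ae h2] with y hy
    rw [hy]
    refine pow_le_pow_left₀ zero_le ?_ 2
    rw [← ofReal_norm, ← ofReal_norm]
    exact ENNReal.ofReal_le_ofReal (norm_fderiv_le_gradVec u y)
  have hd1 : ENNReal.ofReal (δ ^ 2) ≤ (P / 2 : NNReal) ^ 2 * ∑ i, phaseGap κ (Pi.single i 1) := by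
    have e := infDist_sq_le_sum κ
    have e2 : (δ ^ 2).toNNReal ≤ (P / 2) ^ 2 * ∑ i, ‖phase κ (Pi.single i 1) - 1‖₊ ^ 2 := by
      rw [Real.toNNReal_le_iff_le_coe]
      push_cast
      rw [hP, Real.coe_toNNReal _ Real.pi_pos.le]
      exact e
    have e3 : ((δ ^ 2).toNNReal : ℝ≥0∞) ≤
      (((P / 2) ^ 2 * ∑ i, ‖phase κ (Pi.single i 1) - 1‖₊ ^ 2 : NNReal) : ℝ≥0∞) := by
      exact_mod_cast e2
    refine e3.trans (le_of_eq ?_)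
    simp only [phaseGap, enorm_eq_nnnorm]
    rw [ENNReal.coe_mul, ENNReal.coe_pow, ENNReal.ofNNReal_finsetSum]
    simp only [ENNReal.coe_pow]
  have hd2 : ENNReal.ofReal (δ ^ 2) ≤ (P ^ 2 * d : NNReal) := by
    refine ENNReal.ofReal_le_of_le_toReal ?_
    rw [ENNReal.coe_toReal]
    push_cast
    rw [hP, Real.coe_toNNReal _ Real.pi_pos.le]
    exact infDist_sq_le κ
  have hden : ∫⁻ y in cell d \ closure Q₀, density u y =
      (∫⁻ y in cell d \ closure Q₀, ‖u y‖ₑ ^ 2) + S :=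
    lintegral_add_left (hu.continuous.enorm.measurable.pow_const 2) _
  calc ENNReal.ofReal (δ ^ 2) * ‖q - v‖ₑ ^ 2
      ≤ ENNReal.ofReal (δ ^ 2) * (C₁ * ((∫⁻ y in cell d \ closure Q₀, ‖u y‖ₑ ^ 2) + S)) := by
        rw [← hden]; exact mul_le_mul' le_rfl hqv
    _ = C₁ * (ENNReal.ofReal (δ ^ 2) * (∫⁻ y in cell d \ closure Q₀, ‖u y‖ₑ ^ 2) +
          ENNReal.ofReal (δ ^ 2) * S) := by ring
    _ ≤ C₁ * ((P / 2 : NNReal) ^ 2 * (∑ i, C₂ i * S) + (P ^ 2 * d : NNReal) * S) := by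
        refine mul_le_mul' le_rfl (add_le_add ?_ (mul_le_mul' hd2 le_rfl))
        refine (mul_le_mul' hd1 le_rfl).trans ?_
        rw [mul_assoc, Finset.sum_mul]
        exact mul_le_mul' le_rfl (Finset.sum_le_sum fun i _ => hC₂ i κ u hq hu)
    _ = (C₁ * ((P / 2) ^ 2 * ∑ i, C₂ i + P ^ 2 * d) : NNReal) * S := by
        rw [← Finset.sum_mul]
        push_cast
        ring
    _ ≤ _ := mul_le_mul' le_rfl hSle

instance (κ : Space d) : CompleteSpace (H10sub κ Q₀) := (smoothCompact κ Q₀).isClosed_topologicalClosure.completeSpace_coe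

/-- The distance to `H¹_0(Q₀)` is controlled by the gradient on the stiff component, with a
constant of order `1 / dist(κ, 2πℤ^d)`. -/
theorem exists_gap (ho : IsOpen Q₀) (hcl : closure Q₀ ⊆ openCell d)
    (hl : HasLipschitzBoundary Q₀) (hc : IsPreconnected (stiff Q₀)) :
    ∃ C : ℝ, 0 < C ∧ ∀ (κ : Space d) (u : H1 κ),
      Metric.infDist κ (dualLattice d) ^ 2 * ‖u - (H10sub κ Q₀).starProjection u‖ ^ 2 ≤
        C * ‖stiffGrad κ Q₀ u‖ ^ 2 := by
  obtain ⟨C, hC⟩ := exists_smooth_gap ho hcl hl hc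
  refine ⟨C + 1, by positivity, fun κ p => ?_⟩
  set δ := Metric.infDist κ (dualLattice d)
  set V := H10sub κ Q₀
  -- Replacing the correction by the orthogonal projection, which is at least as good, makes both
  -- sides continuous in `u`, so density of smooth functions suffices.
  have hclosed : IsClosed {u : H1 κ | δ ^ 2 * ‖u - V.starProjection u‖ ^ 2 ≤
      (C + 1) * ‖stiffGrad κ Q₀ u‖ ^ 2} := isClosed_le (by fun_prop) (by fun_prop)
  refine hclosed.closure_subset (Metric.mem_closure_iff.2 fun ε hε => ?_)
  obtain ⟨u, q, hq, hu, h1, h2, hqp⟩ := exists_smooth_near p hε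
  refine ⟨q, ?_, by rwa [dist_comm, dist_eq_norm]⟩
  obtain ⟨v, hv, hqv⟩ := hC κ u q hq (hu.of_le (by simp)) h1 h2
  have hmin : ‖q - V.starProjection q‖ ≤ ‖q - v‖ := by
    rw [Submodule.starProjection_minimal]
    exact ciInf_le ⟨0, by rintro _ ⟨x, rfl⟩; exact norm_nonneg _⟩ (⟨v, hv⟩ : V)
  have hreal : δ ^ 2 * ‖q - v‖ ^ 2 ≤ C * ‖stiffGrad κ Q₀ q‖ ^ 2 := by
    rw [← ofReal_norm, ← ofReal_norm, ← ENNReal.ofReal_pow (norm_nonneg _),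
      ← ENNReal.ofReal_pow (norm_nonneg _), ← ENNReal.ofReal_mul (sq_nonneg _),
      ← ENNReal.ofReal_coe_nnreal, ← ENNReal.ofReal_mul (p := (C : ℝ)) C.2,
      ENNReal.ofReal_le_ofReal_iff (by positivity)] at hqv
    exact hqv
  change δ ^ 2 * ‖q - V.starProjection q‖ ^ 2 ≤ (C + 1) * ‖stiffGrad κ Q₀ q‖ ^ 2
  calc δ ^ 2 * ‖q - V.starProjection q‖ ^ 2 ≤ δ ^ 2 * ‖q - v‖ ^ 2 :=
        mul_le_mul_of_nonneg_left (pow_le_pow_left₀ (norm_nonneg _) hmin 2) (sq_nonneg _)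
    _ ≤ _ := hreal.trans (mul_le_mul_of_nonneg_right (by linarith) (sq_nonneg _))

end DoublePorosity

/-! ### The abstract penalty problem in a Hilbert space. -/

namespace DoublePorosity

section PenaltyMethod

variable {E : Type*} [NormedAddCommGroup E] [InnerProductSpace ℂ E]

theorem norm_le_of_coercive {T : E →L[ℂ] E} {c : ℝ}
    (h : ∀ u, c * ‖u‖ ^ 2 ≤ (inner ℂ u (T u)).re) (u : E) : c * ‖u‖ ≤ ‖T u‖ := by
  rcases eq_or_ne u 0 with rfl | hu
  · simp
  · have h1 := (h u).trans ((Complex.re_le_norm _).trans (norm_inner_le_norm u (T u)))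
    have h2 : 0 < ‖u‖ := norm_pos_iff.2 hu
    nlinarith

/-- Lax–Milgram: coercivity bounds `T` below, so its range is closed, and a vector orthogonal to the
range is orthogonal to its own image, hence zero. -/
theorem existsUnique_of_coercive [CompleteSpace E] {T : E →L[ℂ] E} {c : ℝ} (hc : 0 < c)
    (h : ∀ u, c * ‖u‖ ^ 2 ≤ (inner ℂ u (T u)).re) (f : E) : ∃! u, T u = f := by
  have hanti : AntilipschitzWith (c⁻¹).toNNReal T := by
    refine ContinuousLinearMap.antilipschitz_of_bound T fun u => ?_
    rw [Real.coe_toNNReal _ (inv_nonneg.2 hc.le), inv_mul_eq_div, le_div_iff₀' hc]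
    exact norm_le_of_coercive h u
  have hcl : IsClosed (T.range : Set E) := hanti.isClosed_range T.uniformContinuous
  have htop : T.range = ⊤ := by
    have := hcl.completeSpace_coe
    rw [← T.range.orthogonal_orthogonal, Submodule.eq_top_iff']
    intro v w hw
    have h1 : inner ℂ w (T w) = 0 := by
      rw [← inner_conj_symm, hw (T w) ⟨w, rfl⟩, map_zero]
    have h2 := h w
    rw [h1, Complex.zero_re] at h2
    have h3 : ‖w‖ ^ 2 ≤ 0 := nonpos_of_mul_nonpos_right h2 hc
    have h4 : w = 0 := by
      rw [← norm_eq_zero]; nlinarith [norm_nonneg w]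
    rw [h4, inner_zero_left]
  obtain ⟨u, hu⟩ := (LinearMap.range_eq_top.1 htop) f
  exact ⟨u, hu, fun v hv => hanti.injective (hv.trans hu.symm)⟩

/-- A coercive operator `B₀` together with a nonnegative operator `B₁` that vanishes exactly on the
closed subspace `V` and is coercive modulo `V`. -/
structure IsPenaltyPair (V : Submodule ℂ E) [V.HasOrthogonalProjection] (B₀ B₁ : E →L[ℂ] E)
    (c M K : ℝ) : Prop where
  c_pos : 0 < c
  M_nonneg : 0 ≤ M
  K_pos : 0 < K
  coercive : ∀ u, c * ‖u‖ ^ 2 ≤ (inner ℂ u (B₀ u)).re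
  bound : ∀ u, ‖B₀ u‖ ≤ M * ‖u‖
  gap : ∀ u, ‖u - V.starProjection u‖ ^ 2 ≤ K * (inner ℂ u (B₁ u)).re
  ker : ∀ v ∈ V, B₁ v = 0
  range : ∀ v ∈ V, ∀ u, inner ℂ v (B₁ u) = 0

/-- The formal expansion in powers of `ε²` of the solution of `(ε⁻² B₁ + B₀) w = f`. -/
structure IsFormalExpansion (V : Submodule ℂ E) (B₀ B₁ : E →L[ℂ] E) (f : E) (w : ℕ → E) :
    Prop where
  mem : w 0 ∈ V
  eq_zero : ∀ v ∈ V, inner ℂ v (B₀ (w 0)) = inner ℂ v f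
  eq_one : B₁ (w 1) = f - B₀ (w 0)
  eq_succ : ∀ n, 1 ≤ n → B₁ (w (n + 1)) = -B₀ (w n)

namespace IsPenaltyPair

variable {V : Submodule ℂ E} [V.HasOrthogonalProjection] {B₀ B₁ : E →L[ℂ] E} {c M K : ℝ}

theorem nonneg (h : IsPenaltyPair V B₀ B₁ c M K) (u : E) : 0 ≤ (inner ℂ u (B₁ u)).re :=
  nonneg_of_mul_nonneg_right ((sq_nonneg _).trans (h.gap u)) h.K_pos

theorem coercive_sum (h : IsPenaltyPair V B₀ B₁ c M K) {t : ℝ} (ht : 0 ≤ t) (u : E) :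
    c * ‖u‖ ^ 2 ≤ (inner ℂ u (((t : ℂ) • B₁ + B₀) u)).re := by
  simp only [add_apply, smul_apply, inner_add_right,
    inner_smul_right, Complex.add_re, Complex.re_ofReal_mul]
  nlinarith [h.coercive u, mul_nonneg ht (h.nonneg u)]

theorem norm_sq_split (V : Submodule ℂ E) [V.HasOrthogonalProjection] (u : E) :
    ‖u‖ ^ 2 = ‖V.starProjection u‖ ^ 2 + ‖u - V.starProjection u‖ ^ 2 := by
  have := Submodule.norm_sq_eq_add_norm_sq_starProjection u V
  rwa [Submodule.starProjection_orthogonal_val] at this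

theorem inner_proj (V : Submodule ℂ E) [V.HasOrthogonalProjection] (u v : E) :
    inner ℂ u (V.starProjection v) = inner ℂ (V.starProjection u) v :=
  (Submodule.inner_starProjection_left_eq_right V u v).symm

theorem exists_dirichlet [CompleteSpace E] (h : IsPenaltyPair V B₀ B₁ c M K) (g : E) :
    ∃ v ∈ V, ∀ φ ∈ V, inner ℂ φ (B₀ v) = inner ℂ φ g := by
  set P := V.starProjection with hP
  -- Completing the compression of `B₀` to `V` by the identity on the orthogonal complement gives a
  -- coercive operator on all of `E`.
  set T : E →L[ℂ] E := P ∘L B₀ ∘L P + (ContinuousLinearMap.id ℂ E - P) with hT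
  have hTc : ∀ u, min c 1 * ‖u‖ ^ 2 ≤ (inner ℂ u (T u)).re := by
    intro u
    have e : (inner ℂ u (T u)).re = (inner ℂ (P u) (B₀ (P u))).re + ‖u - P u‖ ^ 2 := by
      simp only [hT, add_apply, ContinuousLinearMap.comp_apply,
        sub_apply, ContinuousLinearMap.id_apply, inner_add_right,
        Complex.add_re]
      rw [hP, inner_proj]
      congr 1
      have h1 : inner ℂ (V.starProjection u) (u - V.starProjection u) = (0 : ℂ) :=
        V.sub_starProjection_mem_orthogonal u _ (V.starProjection_apply_mem u)
      have h2 : inner ℂ u (u - V.starProjection u) =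
          inner ℂ (u - V.starProjection u) (u - V.starProjection u) := by
        rw [inner_sub_left u, h1, sub_zero]
      rw [h2]
      exact inner_self_eq_norm_sq (𝕜 := ℂ) _
    rw [e, norm_sq_split V u, mul_add]
    refine add_le_add (le_trans ?_ (h.coercive (P u))) ?_
    · exact mul_le_mul_of_nonneg_right (min_le_left _ _) (sq_nonneg _)
    · exact mul_le_of_le_one_left (sq_nonneg _) (min_le_right _ _)
  obtain ⟨u, hu, -⟩ := existsUnique_of_coercive (lt_min h.c_pos one_pos) hTc (P g)
  refine ⟨P u, V.starProjection_apply_mem u, fun φ hφ => ?_⟩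
  have h1 : P φ = φ := Submodule.starProjection_eq_self_iff.2 hφ
  have h2 : inner ℂ φ (T u) = inner ℂ φ (P g) := by rw [hu]
  simp only [hT, add_apply, ContinuousLinearMap.comp_apply,
    sub_apply, ContinuousLinearMap.id_apply, inner_add_right] at h2
  rw [hP, inner_proj, inner_proj, ← hP, h1, V.sub_starProjection_mem_orthogonal u φ hφ,
    add_zero] at h2
  exact h2

/-- The gap makes B₁ + P coercive. Pairing (B₁ + P)z = f with Pz shows Pz = 0, so B₁z = f. The
freedom of adding an element of `V` is spent on making B₀w ⟂ V, which is the solvability condition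
of the next equation. -/
theorem exists_step [CompleteSpace E] (h : IsPenaltyPair V B₀ B₁ c M K) {f : E}
    (hf : ∀ φ ∈ V, inner ℂ φ f = 0) :
    ∃ w, B₁ w = f ∧ ∀ φ ∈ V, inner ℂ φ (B₀ w) = 0 := by
  set P := V.starProjection with hP
  have hTc : ∀ u, min K⁻¹ 1 * ‖u‖ ^ 2 ≤ (inner ℂ u ((B₁ + P) u)).re := by
    intro u
    have e : (inner ℂ u (P u)).re = ‖P u‖ ^ 2 := by
      have e' : inner ℂ u (P u) = inner ℂ (P u) (P u) := by
        rw [hP, inner_proj V (V.starProjection u),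
          Submodule.starProjection_eq_self_iff.2 (V.starProjection_apply_mem u), inner_proj]
      rw [e']
      exact inner_self_eq_norm_sq (𝕜 := ℂ) _
    rw [add_apply, inner_add_right, Complex.add_re, e, norm_sq_split V u,
      mul_add, add_comm]
    refine add_le_add ?_ ?_
    · refine (mul_le_mul_of_nonneg_right (min_le_left _ _) (sq_nonneg _)).trans ?_
      rw [inv_mul_le_iff₀ h.K_pos]
      exact h.gap u
    · exact mul_le_of_le_one_left (sq_nonneg _) (min_le_right _ _)
  obtain ⟨z, hz, -⟩ := existsUnique_of_coercive (lt_min (inv_pos.2 h.K_pos) one_pos) hTc f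
  rw [add_apply] at hz
  have hPz : P z = 0 := by
    have h1 : inner ℂ (P z) (P z) = (0 : ℂ) := by
      have h2 := hf (P z) (V.starProjection_apply_mem z)
      rw [← hz, inner_add_right, h.range _ (V.starProjection_apply_mem z), zero_add] at h2
      exact h2
    exact inner_self_eq_zero.1 h1
  rw [hPz, add_zero] at hz
  obtain ⟨v, hv, hv'⟩ := h.exists_dirichlet (-B₀ z)
  refine ⟨z + v, by rw [map_add, hz, h.ker v hv, add_zero], fun φ hφ => ?_⟩
  rw [map_add, inner_add_right, hv' φ hφ, inner_neg_right, add_neg_cancel]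

/-- Since B₀w ⟂ V, the coercivity form sees only w − Pw in its first slot; hence ‖w‖ is controlled
by the distance to `V`, and the gap applies. -/
theorem norm_sq_le_of_orthogonal (h : IsPenaltyPair V B₀ B₁ c M K) {w : E}
    (hw : ∀ φ ∈ V, inner ℂ φ (B₀ w) = 0) :
    c ^ 2 * ‖w‖ ^ 2 ≤ M ^ 2 * K * (inner ℂ w (B₁ w)).re := by
  have h1 : c * ‖w‖ ^ 2 ≤ ‖w - V.starProjection w‖ * (M * ‖w‖) := by
    refine (h.coercive w).trans ?_
    have : inner ℂ w (B₀ w) = inner ℂ (w - V.starProjection w) (B₀ w) := by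
      rw [inner_sub_left, hw _ (V.starProjection_apply_mem w), sub_zero]
    rw [this]
    exact (Complex.re_le_norm _).trans ((norm_inner_le_norm _ _).trans
      (mul_le_mul_of_nonneg_left (h.bound w) (norm_nonneg _)))
  have h2 : c * ‖w‖ ≤ M * ‖w - V.starProjection w‖ := by
    rcases (norm_nonneg w).eq_or_lt with h0 | h0
    · rw [← h0, mul_zero]; exact mul_nonneg h.M_nonneg (norm_nonneg _)
    · nlinarith
  calc c ^ 2 * ‖w‖ ^ 2 = (c * ‖w‖) ^ 2 := by ring
    _ ≤ (M * ‖w - V.starProjection w‖) ^ 2 :=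
        pow_le_pow_left₀ (mul_nonneg h.c_pos.le (norm_nonneg _)) h2 2
    _ = M ^ 2 * ‖w - V.starProjection w‖ ^ 2 := by ring
    _ ≤ M ^ 2 * (K * (inner ℂ w (B₁ w)).re) :=
        mul_le_mul_of_nonneg_left (h.gap w) (sq_nonneg _)
    _ = _ := by ring

theorem norm_step_le (h : IsPenaltyPair V B₀ B₁ c M K) {w : E}
    (hw : ∀ φ ∈ V, inner ℂ φ (B₀ w) = 0) : ‖w‖ ≤ (M / c) ^ 2 * K * ‖B₁ w‖ := by
  have h1 := h.norm_sq_le_of_orthogonal hw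
  have h2 : (inner ℂ w (B₁ w)).re ≤ ‖w‖ * ‖B₁ w‖ :=
    (Complex.re_le_norm _).trans (norm_inner_le_norm _ _)
  have hc := h.c_pos
  rw [div_pow, div_mul_eq_mul_div, div_mul_eq_mul_div, le_div_iff₀ (by positivity)]
  rcases (norm_nonneg w).eq_or_lt with h0 | h0
  · rw [← h0, zero_mul]
    have := h.K_pos; positivity
  · have h3 : M ^ 2 * K * (inner ℂ w (B₁ w)).re ≤ M ^ 2 * K * (‖w‖ * ‖B₁ w‖) :=
      mul_le_mul_of_nonneg_left h2 (mul_nonneg (sq_nonneg _) h.K_pos.le)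
    nlinarith

/-- This is the solvability condition of the following equation: the range of `B₁` is orthogonal to
`V`. It makes every coefficient unique. -/
theorem orthogonal_of_expansion (h : IsPenaltyPair V B₀ B₁ c M K) {f : E} {w : ℕ → E}
    (hw : IsFormalExpansion V B₀ B₁ f w) {n : ℕ} (hn : 1 ≤ n) :
    ∀ φ ∈ V, inner ℂ φ (B₀ (w n)) = 0 := by
  intro φ hφ
  have h1 := h.range φ hφ (w (n + 1))
  rw [hw.eq_succ n hn, inner_neg_right, neg_eq_zero] at h1
  exact h1

theorem eq_of_step (h : IsPenaltyPair V B₀ B₁ c M K) {w w' : E} (he : B₁ w = B₁ w')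
    (hw : ∀ φ ∈ V, inner ℂ φ (B₀ w) = 0) (hw' : ∀ φ ∈ V, inner ℂ φ (B₀ w') = 0) : w = w' := by
  have h1 := h.norm_step_le (w := w - w') fun φ hφ => by
    rw [map_sub, inner_sub_right, hw φ hφ, hw' φ hφ, sub_zero]
  rw [map_sub, he, sub_self, norm_zero, mul_zero, norm_le_zero_iff, sub_eq_zero] at h1
  exact h1

theorem existsUnique_expansion [CompleteSpace E] (h : IsPenaltyPair V B₀ B₁ c M K) (f : E) :
    ∃! w : ℕ → E, IsFormalExpansion V B₀ B₁ f w := by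
  classical
  obtain ⟨w₀, hm, h0⟩ := h.exists_dirichlet f
  obtain ⟨w₁, h1, h1'⟩ := h.exists_step (f := f - B₀ w₀) fun φ hφ => by
    rw [inner_sub_right, h0 φ hφ, sub_self]
  have hstep : ∀ w : {w : E // ∀ φ ∈ V, inner ℂ φ (B₀ w) = 0},
      ∃ w' : {w : E // ∀ φ ∈ V, inner ℂ φ (B₀ w) = 0}, B₁ w' = -B₀ w := fun w => by
    obtain ⟨w', e, e'⟩ := h.exists_step (f := -B₀ w) fun φ hφ => by
      rw [inner_neg_right, w.2 φ hφ, neg_zero]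
    exact ⟨⟨w', e'⟩, e⟩
  choose next hnext using hstep
  let s : ℕ → {w : E // ∀ φ ∈ V, inner ℂ φ (B₀ w) = 0} := fun n => next^[n] ⟨w₁, h1'⟩
  refine ⟨fun n => Nat.casesOn n w₀ fun n => s n, ⟨hm, h0, h1, fun n hn => ?_⟩, fun w hw => ?_⟩
  · obtain ⟨n, rfl⟩ := Nat.exists_eq_succ_of_ne_zero (Nat.one_le_iff_ne_zero.1 hn)
    have : s (n + 1) = next (s n) := Function.iterate_succ_apply' _ _ _
    change B₁ (s (n + 1) : E) = -B₀ (s n)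
    rw [this]; exact hnext _
  · have hw0 : w 0 = w₀ := by
      have e : ∀ φ ∈ V, inner ℂ φ (B₀ (w 0 - w₀)) = 0 := fun φ hφ => by
        rw [map_sub, inner_sub_right, hw.eq_zero φ hφ, h0 φ hφ, sub_self]
      have e1 := h.coercive (w 0 - w₀)
      rw [e _ (V.sub_mem hw.mem hm), Complex.zero_re] at e1
      have e2 : ‖w 0 - w₀‖ ^ 2 ≤ 0 := nonpos_of_mul_nonpos_right e1 h.c_pos
      rw [← sub_eq_zero, ← norm_eq_zero]
      nlinarith [norm_nonneg (w 0 - w₀)]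
    have hws : ∀ n, w (n + 1) = s n := by
      intro n
      induction n with
      | zero =>
        refine h.eq_of_step ?_ (h.orthogonal_of_expansion hw le_rfl) h1'
        rw [hw.eq_one, hw0]
        exact h1.symm
      | succ n ih =>
        have : s (n + 1) = next (s n) := Function.iterate_succ_apply' _ _ _
        refine h.eq_of_step ?_ (h.orthogonal_of_expansion hw (by omega)) (s (n + 1)).2
        rw [hw.eq_succ _ (by omega), ih, this, hnext]
    funext n
    cases n with
    | zero => exact hw0
    | succ n => exact hws n

theorem norm_leading_le (h : IsPenaltyPair V B₀ B₁ c M K) {f : E} {w : ℕ → E}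
    (hw : IsFormalExpansion V B₀ B₁ f w) : ‖w 0‖ ≤ c⁻¹ * ‖f‖ := by
  have h1 := h.coercive (w 0)
  rw [hw.eq_zero _ hw.mem] at h1
  have h2 := h1.trans ((Complex.re_le_norm _).trans (norm_inner_le_norm _ _))
  rw [inv_mul_eq_div, le_div_iff₀ h.c_pos]
  rcases (norm_nonneg (w 0)).eq_or_lt with h0 | h0
  · rw [← h0, zero_mul]; exact norm_nonneg f
  · nlinarith

/-- Every equation contributes one factor `K`, so its exponent equals the index of the coefficient.
The factor 1 + M/c bounds the first right-hand side f − B₀w⁽⁰⁾. -/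
theorem norm_expansion_le (h : IsPenaltyPair V B₀ B₁ c M K) {f : E} {w : ℕ → E}
    (hw : IsFormalExpansion V B₀ B₁ f w) (n : ℕ) :
    ‖w (n + 1)‖ ≤ ((M / c) ^ 2 * K) ^ (n + 1) * (M ^ n * (1 + M / c)) * ‖f‖ := by
  have hK := h.K_pos.le
  have hM := h.M_nonneg
  induction n with
  | zero =>
    refine (h.norm_step_le (h.orthogonal_of_expansion hw le_rfl)).trans ?_
    rw [hw.eq_one, zero_add, pow_one, pow_zero, one_mul, mul_assoc _ (1 + M / c)]
    refine mul_le_mul_of_nonneg_left ?_ (by positivity)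
    refine (norm_sub_le _ _).trans ?_
    have h1 := (h.bound (w 0)).trans (mul_le_mul_of_nonneg_left (h.norm_leading_le hw) hM)
    calc ‖f‖ + ‖B₀ (w 0)‖ ≤ ‖f‖ + M * (c⁻¹ * ‖f‖) := by linarith
      _ = _ := by ring
  | succ n ih =>
    refine (h.norm_step_le (h.orthogonal_of_expansion hw (by omega))).trans ?_
    rw [hw.eq_succ _ (by omega), norm_neg]
    calc (M / c) ^ 2 * K * ‖B₀ (w (n + 1))‖
        ≤ (M / c) ^ 2 * K * (M * (((M / c) ^ 2 * K) ^ (n + 1) * (M ^ n * (1 + M / c)) * ‖f‖)) := by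
          refine mul_le_mul_of_nonneg_left ?_ (by positivity)
          exact (h.bound _).trans (mul_le_mul_of_nonneg_left ih hM)
      _ = _ := by ring

/-- The sum telescopes: ε⁻²B₁ on each term cancels `B₀` on the preceding one. The singular term of
order ε⁻² is absent because w⁽⁰⁾ lies in the kernel of `B₁`. -/
theorem apply_truncation {f : E} {w : ℕ → E} (h : IsPenaltyPair V B₀ B₁ c M K)
    (hw : IsFormalExpansion V B₀ B₁ f w) {ε : ℝ} (hε : 0 < ε) (N : ℕ) :
    ((((ε ^ 2)⁻¹ : ℝ) : ℂ) • B₁ + B₀)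
        (∑ n ∈ Finset.range (N + 1 + 1), ((ε ^ (2 * n) : ℝ) : ℂ) • w n) =
      f + ((ε ^ (2 * (N + 1)) : ℝ) : ℂ) • B₀ (w (N + 1)) := by
  induction N with
  | zero =>
    simp only [Finset.sum_range_succ, Finset.sum_range_zero, zero_add, mul_zero, pow_zero,
      Complex.ofReal_one, one_smul, mul_one, map_add, map_smul, add_apply,
      smul_apply, h.ker _ hw.mem, hw.eq_one, smul_zero, smul_add, smul_smul]
    rw [← Complex.ofReal_mul, mul_inv_cancel₀ (by positivity), Complex.ofReal_one, one_smul]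
    abel
  | succ N ih =>
    rw [Finset.sum_range_succ, map_add, ih, map_smul, add_apply,
      smul_apply, hw.eq_succ _ (by omega), smul_add, smul_smul,
      ← Complex.ofReal_mul]
    have : ε ^ (2 * (N + 1 + 1)) * (ε ^ 2)⁻¹ = ε ^ (2 * (N + 1)) := by
      field_simp
      ring
    rw [this, smul_neg]
    abel

theorem norm_sub_truncation_le (h : IsPenaltyPair V B₀ B₁ c M K) {f : E} {w : ℕ → E}
    (hw : IsFormalExpansion V B₀ B₁ f w) {ε : ℝ} (hε : 0 < ε) {u : E}
    (hu : ((((ε ^ 2)⁻¹ : ℝ) : ℂ) • B₁ + B₀) u = f) (N : ℕ) :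
    ‖u - ∑ n ∈ Finset.range (N + 1 + 1), ((ε ^ (2 * n) : ℝ) : ℂ) • w n‖ ≤
      M / c * (ε ^ (2 * (N + 1)) * ‖w (N + 1)‖) := by
  have h1 := norm_le_of_coercive (h.coercive_sum (t := (ε ^ 2)⁻¹) (by positivity))
    (u - ∑ n ∈ Finset.range (N + 1 + 1), ((ε ^ (2 * n) : ℝ) : ℂ) • w n)
  rw [map_sub, hu, h.apply_truncation hw hε, sub_add_cancel_left, norm_neg, norm_smul,
    Complex.norm_real, Real.norm_of_nonneg (by positivity)] at h1
  have h2 := mul_le_mul_of_nonneg_left (h.bound (w (N + 1)))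
    (by positivity : 0 ≤ ε ^ (2 * (N + 1)))
  rw [div_mul_eq_mul_div, le_div_iff₀' h.c_pos]
  linarith

end IsPenaltyPair

end PenaltyMethod

end DoublePorosity

/-! ### The forms as operators on H¹_κ(Q), and verification of the penalty structure. -/

namespace DoublePorosity
variable {d : ℕ} {Q₀ : Set (Space d)}

/-- Measurable coefficients whose entries are bounded by `M` almost everywhere on `Q`. -/
structure IsBoundedCoeff (A : Space d → Matrix (Fin d) (Fin d) ℝ) (M : NNReal) : Prop where
  meas : ∀ i j, AEStronglyMeasurable (fun y => A y i j) (cellMeasure d)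
  bound : ∀ᵐ y ∂(cellMeasure d), ∀ i j, ‖A y i j‖ ≤ M

theorem exists_isBoundedCoeff {A : Space d → Matrix (Fin d) (Fin d) ℝ}
    (h : ∀ i j, MemLp (fun y => A y i j) ⊤ (cellMeasure d)) : ∃ M, IsBoundedCoeff A M := by
  refine ⟨∑ i, ∑ j, (eLpNorm (fun y => A y i j) ⊤ (cellMeasure d)).toNNReal,
    fun i j => (h i j).1, ae_all_iff.2 fun i => ae_all_iff.2 fun j => ?_⟩
  filter_upwards [ae_le_eLpNormEssSup (f := fun y => A y i j) (μ := cellMeasure d)] with y hy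
  rw [← eLpNorm_exponent_top] at hy
  have h1 : ‖A y i j‖₊ ≤ (eLpNorm (fun y => A y i j) ⊤ (cellMeasure d)).toNNReal := by
    rw [← ENNReal.coe_le_coe, ENNReal.coe_toNNReal (h i j).2.ne]
    exact hy
  have h2 : (eLpNorm (fun y => A y i j) ⊤ (cellMeasure d)).toNNReal ≤
      ∑ i, ∑ j, (eLpNorm (fun y => A y i j) ⊤ (cellMeasure d)).toNNReal :=
    (Finset.single_le_sum (f := fun j => (eLpNorm (fun y => A y i j) ⊤ (cellMeasure d)).toNNReal)
      (fun _ _ => zero_le) (Finset.mem_univ j)).trans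
      (Finset.single_le_sum
        (f := fun i => ∑ j, (eLpNorm (fun y => A y i j) ⊤ (cellMeasure d)).toNNReal)
        (fun _ _ => zero_le) (Finset.mem_univ i))
  exact_mod_cast h1.trans h2

/-- The pointwise sesquilinear form `A ξ · conj η`. -/
def sesq (A : Matrix (Fin d) (Fin d) ℝ) (ξ η : CVec d) : ℂ :=
  ∑ i, ∑ j, ((A i j : ℝ) : ℂ) * ξ j * (starRingEnd ℂ) (η i)

theorem form_eq {κ : Space d} (A : Space d → Matrix (Fin d) (Fin d) ℝ) (u v : H1 κ) :
    form A u v = ∫ y in cell d, sesq (A y) (grad u y) (grad v y) := rfl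

theorem sesq_add_left (A : Matrix (Fin d) (Fin d) ℝ) (ξ ξ' η : CVec d) :
    sesq A (ξ + ξ') η = sesq A ξ η + sesq A ξ' η := by
  simp only [sesq, PiLp.add_apply, mul_add, add_mul, Finset.sum_add_distrib]

theorem sesq_add_right (A : Matrix (Fin d) (Fin d) ℝ) (ξ η η' : CVec d) :
    sesq A ξ (η + η') = sesq A ξ η + sesq A ξ η' := by
  simp only [sesq, PiLp.add_apply, map_add, mul_add, Finset.sum_add_distrib]

theorem sesq_smul_left (A : Matrix (Fin d) (Fin d) ℝ) (c : ℂ) (ξ η : CVec d) :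
    sesq A (c • ξ) η = c * sesq A ξ η := by
  simp only [sesq, PiLp.smul_apply, smul_eq_mul, Finset.mul_sum]
  exact Finset.sum_congr rfl fun i _ => Finset.sum_congr rfl fun j _ => by ring

theorem sesq_smul_right (A : Matrix (Fin d) (Fin d) ℝ) (c : ℂ) (ξ η : CVec d) :
    sesq A ξ (c • η) = (starRingEnd ℂ) c * sesq A ξ η := by
  simp only [sesq, PiLp.smul_apply, smul_eq_mul, map_mul, Finset.mul_sum]
  exact Finset.sum_congr rfl fun i _ => Finset.sum_congr rfl fun j _ => by ring

theorem sesq_smul_add (A B : Matrix (Fin d) (Fin d) ℝ) (t : ℝ) (ξ η : CVec d) :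
    sesq (t • A + B) ξ η = t * sesq A ξ η + sesq B ξ η := by
  simp only [sesq, Matrix.add_apply, Matrix.smul_apply, smul_eq_mul, Complex.ofReal_add,
    Complex.ofReal_mul, Finset.mul_sum, add_mul, Finset.sum_add_distrib]
  congr 1
  exact Finset.sum_congr rfl fun i _ => Finset.sum_congr rfl fun j _ => by ring

theorem norm_sesq_le {A : Matrix (Fin d) (Fin d) ℝ} {M : NNReal} (h : ∀ i j, ‖A i j‖ ≤ M)
    (ξ η : CVec d) : ‖sesq A ξ η‖ ≤ d ^ 2 * M * (‖ξ‖ * ‖η‖) := by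
  have h1 : ∀ i j, ‖((A i j : ℝ) : ℂ) * ξ j * (starRingEnd ℂ) (η i)‖ ≤ M * (‖ξ‖ * ‖η‖) := by
    intro i j
    rw [norm_mul, norm_mul, Complex.norm_real, RCLike.norm_conj, mul_assoc]
    exact mul_le_mul (h i j) (mul_le_mul (PiLp.norm_apply_le ξ j) (PiLp.norm_apply_le η i)
      (norm_nonneg _) (norm_nonneg _)) (by positivity) M.2
  calc ‖sesq A ξ η‖ ≤ ∑ _i : Fin d, ∑ _j : Fin d, (M * (‖ξ‖ * ‖η‖) : ℝ) :=
        (norm_sum_le _ _).trans (Finset.sum_le_sum fun i _ => (norm_sum_le _ _).trans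
          (Finset.sum_le_sum fun j _ => h1 i j))
    _ = _ := by
        simp only [Finset.sum_const, Finset.card_univ, Fintype.card_fin, nsmul_eq_mul]; ring

/-- For a real matrix, the real part of the form splits into its values on the real and on the
imaginary part of ξ. -/
theorem le_re_sesq {A : Matrix (Fin d) (Fin d) ℝ} {ν : ℝ}
    (h : ∀ ξ : Fin d → ℝ, ν * (ξ ⬝ᵥ ξ) ≤ ξ ⬝ᵥ A.mulVec ξ) (ξ : CVec d) :
    ν * ‖ξ‖ ^ 2 ≤ (sesq A ξ ξ).re := by
  have h1 := h fun i => (ξ i).re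
  have h2 := h fun i => (ξ i).im
  have e1 : ‖ξ‖ ^ 2 = (fun i => (ξ i).re) ⬝ᵥ (fun i => (ξ i).re) +
      (fun i => (ξ i).im) ⬝ᵥ (fun i => (ξ i).im) := by
    rw [EuclideanSpace.norm_sq_eq, dotProduct, dotProduct, ← Finset.sum_add_distrib]
    refine Finset.sum_congr rfl fun i _ => ?_
    rw [← Complex.normSq_eq_norm_sq, Complex.normSq_apply]
  have e2 : (sesq A ξ ξ).re = (fun i => (ξ i).re) ⬝ᵥ A.mulVec (fun i => (ξ i).re) +
      (fun i => (ξ i).im) ⬝ᵥ A.mulVec (fun i => (ξ i).im) := by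
    simp only [sesq, dotProduct, Matrix.mulVec, Complex.re_sum, ← Finset.sum_add_distrib,
      Finset.mul_sum]
    refine Finset.sum_congr rfl fun i _ => Finset.sum_congr rfl fun j _ => ?_
    simp only [Complex.mul_re, Complex.mul_im, Complex.conj_re, Complex.conj_im,
      Complex.ofReal_re, Complex.ofReal_im]
    ring
  rw [e1, e2]
  linarith

theorem sesq_zero_left (A : Matrix (Fin d) (Fin d) ℝ) (η : CVec d) : sesq A 0 η = 0 := by
  simp [sesq]

theorem sesq_zero_right (A : Matrix (Fin d) (Fin d) ℝ) (ξ : CVec d) : sesq A ξ 0 = 0 := by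
  simp [sesq]

theorem sesq_zero (ξ η : CVec d) : sesq 0 ξ η = 0 := by simp [sesq]

namespace IsBoundedCoeff

variable {A B : Space d → Matrix (Fin d) (Fin d) ℝ} {M M' : NNReal}

theorem integrable (h : IsBoundedCoeff A M) (f g : Lp (CVec d) 2 (cellMeasure d)) :
    Integrable (fun y => sesq (A y) (f y) (g y)) (cellMeasure d) := by
  have hfg : Integrable (fun y => d ^ 2 * M * (‖f y‖ * ‖g y‖)) (cellMeasure d) :=
    ((Lp.memLp f).norm.integrable_mul (Lp.memLp g).norm).const_mul _
  refine hfg.mono' ?_ ?_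
  · refine Finset.aestronglyMeasurable_fun_sum _ fun i _ =>
      Finset.aestronglyMeasurable_fun_sum _ fun j _ => ?_
    have hp : ∀ (f : Lp (CVec d) 2 (cellMeasure d)) i,
        AEStronglyMeasurable (fun y => f y i) (cellMeasure d) := fun f i =>
      (EuclideanSpace.proj (𝕜 := ℂ) i).continuous.comp_aestronglyMeasurable
        (Lp.aestronglyMeasurable f)
    exact ((Complex.continuous_ofReal.comp_aestronglyMeasurable (h.meas i j)).mul (hp f j)).mul
      (Complex.continuous_conj.comp_aestronglyMeasurable (hp g i))
  · filter_upwards [h.bound] with y hy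
    exact norm_sesq_le hy _ _

variable {κ : Space d}

theorem form_add_left (h : IsBoundedCoeff A M) (u u' v : H1 κ) :
    form A (u + u') v = form A u v + form A u' v := by
  rw [form_eq, form_eq, form_eq, ← integral_add (h.integrable _ _) (h.integrable _ _)]
  refine integral_congr_ae ?_
  filter_upwards [Lp.coeFn_add (grad u) (grad u')] with y hy
  have e : grad (u + u') = grad u + grad u' := rfl
  rw [e, hy, Pi.add_apply, sesq_add_left]

theorem form_add_right (h : IsBoundedCoeff A M) (u v v' : H1 κ) :
    form A u (v + v') = form A u v + form A u v' := by
  rw [form_eq, form_eq, form_eq, ← integral_add (h.integrable _ _) (h.integrable _ _)]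
  refine integral_congr_ae ?_
  filter_upwards [Lp.coeFn_add (grad v) (grad v')] with y hy
  have e : grad (v + v') = grad v + grad v' := rfl
  rw [e, hy, Pi.add_apply, sesq_add_right]

theorem form_smul_add (hA : IsBoundedCoeff A M) (hB : IsBoundedCoeff B M') (t : ℝ)
    (u v : H1 κ) : form (fun y => t • A y + B y) u v = t * form A u v + form B u v := by
  rw [form_eq, form_eq, form_eq, ← integral_const_mul,
    ← integral_add ((hA.integrable _ _).const_mul _) (hB.integrable _ _)]
  simp only [sesq_smul_add]

theorem norm_form_le (h : IsBoundedCoeff A M) (u v : H1 κ) :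
    ‖form A u v‖ ≤ d ^ 2 * M * (‖grad u‖ * ‖grad v‖) := by
  have h1 : ‖form A u v‖ₑ ≤ (d ^ 2 * M : NNReal) * ∫⁻ y in cell d, ‖grad u y‖ₑ * ‖grad v y‖ₑ := by
    rw [form_eq, ← lintegral_const_mul' _ _ ENNReal.coe_ne_top]
    refine (enorm_integral_le_lintegral_enorm _).trans (lintegral_mono_ae ?_)
    filter_upwards [h.bound] with y hy
    have := norm_sesq_le hy (grad u y) (grad v y)
    simp only [enorm_eq_nnnorm]
    exact_mod_cast this
  have h2 : ∫⁻ y in cell d, ‖grad u y‖ₑ * ‖grad v y‖ₑ ≤ ‖grad u‖ₑ * ‖grad v‖ₑ := by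
    have h3 := sq_lintegral_mul_le _ (Lp.aestronglyMeasurable (grad u)).enorm
      (Lp.aestronglyMeasurable (grad v)).enorm
    rw [← enorm_sq_Lp, ← enorm_sq_Lp, ← mul_pow] at h3
    exact (ENNReal.pow_le_pow_left_iff two_ne_zero).1 h3
  have h4 := h1.trans (mul_le_mul' le_rfl h2)
  simp only [enorm_eq_nnnorm] at h4
  exact_mod_cast h4

theorem re_form (h : IsBoundedCoeff A M) (u : H1 κ) :
    (form A u u).re = ∫ y in cell d, (sesq (A y) (grad u y) (grad u y)).re :=
  (Complex.reCLM.integral_comp_comm (h.integrable _ _)).symm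

end IsBoundedCoeff

theorem norm_sq_Lp {μ : Measure (Space d)} (f : Lp (CVec d) 2 μ) :
    ‖f‖ ^ 2 = ∫ y, ‖f y‖ ^ 2 ∂μ := by
  have h := L2.inner_def (𝕜 := ℂ) f f
  simp only [inner_self_eq_norm_sq_to_K] at h
  have e : ∫ y, ((‖f y‖ : ℂ)) ^ 2 ∂μ = ((∫ y, ‖f y‖ ^ 2 ∂μ : ℝ) : ℂ) := by
    rw [← integral_complex_ofReal]
    simp only [Complex.ofReal_pow]
  exact Complex.ofReal_injective ((Complex.ofReal_pow _ _).trans (h.trans e))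

theorem integrable_norm_sq_Lp {μ : Measure (Space d)} (f : Lp (CVec d) 2 μ) :
    Integrable (fun y => ‖f y‖ ^ 2) μ := (Lp.memLp f).integrable_norm_pow two_ne_zero

theorem pairing_eq_inner (f v : L2 d) : pairing f v = inner ℂ v f := by
  rw [L2.inner_def]; rfl

theorem exists_operator {E : Type*} [NormedAddCommGroup E] [InnerProductSpace ℂ E]
    [CompleteSpace E] {f : E → E → ℂ} {M : ℝ}
    (h1 : ∀ u u' v, f (u + u') v = f u v + f u' v) (h2 : ∀ (c : ℂ) u v, f (c • u) v = c * f u v)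
    (h3 : ∀ u v v', f u (v + v') = f u v + f u v')
    (h4 : ∀ (c : ℂ) u v, f u (c • v) = (starRingEnd ℂ) c * f u v)
    (hM : ∀ u v, ‖f u v‖ ≤ M * ‖u‖ * ‖v‖) :
    ∃ T : E →L[ℂ] E, ∀ u v, inner ℂ v (T u) = f u v := by
  -- The form is linear in its first slot, while Riesz representation expects conjugate linearity
  -- there; it is conjugated here and conjugated back at the end.
  let b : E →ₗ⋆[ℂ] E →ₗ[ℂ] ℂ := LinearMap.mk₂'ₛₗ (starRingEnd ℂ) (RingHom.id ℂ)
    (fun u v => (starRingEnd ℂ) (f u v)) (fun u u' v => by rw [h1, map_add])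
    (fun c u v => by rw [h2, map_mul]; rfl) (fun u v v' => by rw [h3, map_add])
    (fun c u v => by rw [h4, map_mul, Complex.conj_conj]; rfl)
  let B : E →L⋆[ℂ] E →L[ℂ] ℂ := b.mkContinuous₂ M fun u v => by
    change ‖(starRingEnd ℂ) (f u v)‖ ≤ _
    rw [RCLike.norm_conj]; exact hM u v
  refine ⟨InnerProductSpace.continuousLinearMapOfBilin B, fun u v => ?_⟩
  rw [← inner_conj_symm, InnerProductSpace.continuousLinearMapOfBilin_apply]
  change (starRingEnd ℂ) ((starRingEnd ℂ) (f u v)) = _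
  rw [Complex.conj_conj]

theorem IsBoundedCoeff.exists_form_operator {A : Space d → Matrix (Fin d) (Fin d) ℝ} {M : NNReal}
    (h : IsBoundedCoeff A M) (κ : Space d) :
    ∃ T : H1 κ →L[ℂ] H1 κ, ∀ u v, inner ℂ v (T u) = form A u v := by
  refine exists_operator (M := d ^ 2 * M) h.form_add_left (fun c u v => ?_) h.form_add_right
    (fun c u v => ?_) fun u v => ?_
  · rw [form_eq, form_eq, ← integral_const_mul]
    refine integral_congr_ae ?_
    filter_upwards [Lp.coeFn_smul c (grad u)] with y hy
    have e : grad (c • u) = c • grad u := rfl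
    rw [e, hy, Pi.smul_apply, sesq_smul_left]
  · rw [form_eq, form_eq, ← integral_const_mul]
    refine integral_congr_ae ?_
    filter_upwards [Lp.coeFn_smul c (grad v)] with y hy
    have e : grad (c • v) = c • grad v := rfl
    rw [e, hy, Pi.smul_apply, sesq_smul_right]
  · refine (h.norm_form_le u v).trans ?_
    rw [mul_assoc _ ‖u‖]
    exact mul_le_mul_of_nonneg_left (mul_le_mul (norm_grad_le u) (norm_grad_le v) (norm_nonneg _)
      (norm_nonneg _)) (by positivity)

theorem norm_fnL_le (κ : Space d) : ‖fnL κ‖ ≤ 1 :=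
  ContinuousLinearMap.opNorm_le_bound _ zero_le_one fun u => by
    rw [one_mul]; exact norm_fn_le u

/-- The functional `φ ↦ ∫_Q f conj φ` on `H¹_κ(Q)`, represented in `H¹_κ(Q)`. -/
noncomputable def load (κ : Space d) : L2 d →L[ℂ] H1 κ := ContinuousLinearMap.adjoint (fnL κ)

theorem inner_load {κ : Space d} (f : L2 d) (φ : H1 κ) :
    inner ℂ φ (load κ f) = pairing f (fn φ) := by
  rw [load, ContinuousLinearMap.adjoint_inner_right, pairing_eq_inner]; rfl

theorem norm_load_le {κ : Space d} (f : L2 d) : ‖load κ f‖ ≤ ‖f‖ := by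
  have h : ‖load κ‖ ≤ 1 := by
    rw [load, LinearIsometryEquiv.norm_map]; exact norm_fnL_le κ
  simpa using (load κ).le_of_opNorm_le h f

namespace Admissible

variable {ν : ℝ} {A₀ A₁ : Space d → Matrix (Fin d) (Fin d) ℝ} {κ : Space d}

theorem ae_trichotomy (h : Admissible ν A₀ A₁ Q₀) :
    ∀ᵐ y ∂(cellMeasure d), y ∈ Q₀ ∨ y ∉ closure Q₀ := by
  have h0 : ∀ᵐ y ∂(cellMeasure d), y ∉ frontier Q₀ := ae_restrict_of_ae
    (measure_eq_zero_iff_ae_notMem.1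
      (volume_frontier_eq_zero h.isOpen_soft h.closure_soft h.lipschitz_soft))
  filter_upwards [h0] with y hy
  rw [h.isOpen_soft.frontier_eq] at hy
  by_cases hc : y ∈ closure Q₀
  · exact Or.inl (by_contra fun hq => hy ⟨hc, hq⟩)
  · exact Or.inr hc

/-- Since the Lipschitz boundary is null, almost every point is either in the soft set, where A₁
vanishes, or off its closure, where ∇v does. Hence A₁ annihilates H¹₀ in either slot of the form. -/
theorem ae_soft (h : Admissible ν A₀ A₁ Q₀) {v : H1 κ} (hv : v ∈ H10sub κ Q₀) :
    ∀ᵐ y ∂(cellMeasure d), A₁ y = 0 ∨ grad v y = 0 := by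
  have h1 : ∀ᵐ y ∂(cellMeasure d).restrict (closure Q₀)ᶜ, grad v y = 0 := by
    filter_upwards [stiffGrad_ae (Q₀ := Q₀) v, Lp.coeFn_zero (CVec d) 2
      ((cellMeasure d).restrict (closure Q₀)ᶜ)] with y e1 e2
    rw [stiffGrad_eq_zero h.closure_soft hv] at e1
    exact e1.symm.trans e2
  rw [ae_restrict_iff' isClosed_closure.measurableSet.compl] at h1
  filter_upwards [h1, h.soft_A₁, h.ae_trichotomy] with y e1 e2 e3
  exact e3.imp e2 e1

theorem form_soft_left (h : Admissible ν A₀ A₁ Q₀) {v : H1 κ} (hv : v ∈ H10sub κ Q₀) (u : H1 κ) :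
    form A₁ v u = 0 := by
  rw [form_eq]
  refine integral_eq_zero_of_ae ?_
  filter_upwards [h.ae_soft hv] with y hy
  rcases hy with hy | hy <;> rw [hy]
  · exact sesq_zero _ _
  · exact sesq_zero_left _ _

theorem form_soft_right (h : Admissible ν A₀ A₁ Q₀) {v : H1 κ} (hv : v ∈ H10sub κ Q₀) (u : H1 κ) :
    form A₁ u v = 0 := by
  rw [form_eq]
  refine integral_eq_zero_of_ae ?_
  filter_upwards [h.ae_soft hv] with y hy
  rcases hy with hy | hy <;> rw [hy]
  · exact sesq_zero _ _
  · exact sesq_zero_right _ _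

theorem le_re_form_A₀ (h : Admissible ν A₀ A₁ Q₀) (u : H1 κ) :
    ν * ‖grad u‖ ^ 2 ≤ (form A₀ u u).re := by
  obtain ⟨M, hM⟩ := exists_isBoundedCoeff h.memLp_A₀
  rw [hM.re_form, norm_sq_Lp, ← integral_const_mul]
  refine integral_mono_ae ((integrable_norm_sq_Lp _).const_mul _) (hM.integrable _ _).re ?_
  filter_upwards [h.elliptic_A₀] with y hy
  exact le_re_sesq hy _

theorem le_re_form_A₁ (h : Admissible ν A₀ A₁ Q₀) (u : H1 κ) :
    ν * ‖stiffGrad κ Q₀ u‖ ^ 2 ≤ (form A₁ u u).re := by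
  obtain ⟨M, hM⟩ := exists_isBoundedCoeff h.memLp_A₁
  have hm : MeasurableSet (closure Q₀)ᶜ := isClosed_closure.measurableSet.compl
  have e : ‖stiffGrad κ Q₀ u‖ ^ 2 =
      ∫ y in cell d, (closure Q₀)ᶜ.indicator (fun y => ‖grad u y‖ ^ 2) y := by
    rw [norm_sq_Lp, integral_indicator hm]
    refine integral_congr_ae ?_
    filter_upwards [stiffGrad_ae (Q₀ := Q₀) u] with y hy
    rw [hy]
  rw [hM.re_form, e, ← integral_const_mul]
  refine integral_mono_ae (((integrable_norm_sq_Lp _).indicator hm).const_mul _)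
    (hM.integrable _ _).re ?_
  filter_upwards [h.elliptic_A₁, h.soft_A₁, h.ae_trichotomy] with y e1 e2 e3
  rcases e3 with e3 | e3
  · rw [indicator_of_notMem (not_not.2 (subset_closure e3)), e2 e3, sesq_zero]
    simp
  · rw [indicator_of_mem e3]
    exact le_re_sesq (e1 e3) _

/-- Coercivity and boundedness of `B₀` are uniform in κ. Only the gap constant degenerates, like
d(κ)⁻², and it is recorded in exactly that form. -/
theorem exists_isPenaltyPair (h : Admissible ν A₀ A₁ Q₀) :
    ∃ c M K : ℝ, 0 < K ∧ ∀ κ : Space d, κ ∉ dualLattice d → ∃ B₀ B₁ : H1 κ →L[ℂ] H1 κ,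
      IsPenaltyPair (H10sub κ Q₀) B₀ B₁ c M (K / Metric.infDist κ (dualLattice d) ^ 2) ∧
      (∀ u v, inner ℂ v (B₀ u) = form A₀ u v + pairing (fn u) (fn v)) ∧
      ∀ u v, inner ℂ v (B₁ u) = form A₁ u v := by
  obtain ⟨M₀, hM₀⟩ := exists_isBoundedCoeff h.memLp_A₀
  obtain ⟨M₁, hM₁⟩ := exists_isBoundedCoeff h.memLp_A₁
  obtain ⟨C, hC, hgap⟩ := exists_gap h.isOpen_soft h.closure_soft h.lipschitz_soft
    h.connected_stiff.isPreconnected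
  have hν := h.nu_pos
  refine ⟨min ν 1, d ^ 2 * M₀ + 1, C / ν, by positivity, fun κ hκ => ?_⟩
  have hδ := infDist_dualLattice_pos hκ
  obtain ⟨T₀, hT₀⟩ := hM₀.exists_form_operator κ
  obtain ⟨B₁, hB₁⟩ := hM₁.exists_form_operator κ
  have hB₀ : ∀ u v, inner ℂ v ((T₀ + load κ ∘L fnL κ) u) =
      form A₀ u v + pairing (fn u) (fn v) := fun u v => by
    rw [add_apply, inner_add_right, hT₀, ContinuousLinearMap.comp_apply, inner_load,
      fnL_apply]
  refine ⟨T₀ + load κ ∘L fnL κ, B₁, ⟨lt_min hν one_pos, by positivity, by positivity,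
    fun u => ?_, fun u => ?_, fun u => ?_, fun v hv => ?_, fun v hv u => ?_⟩, hB₀, hB₁⟩
  · have e : (pairing (fn u) (fn u)).re = ‖fn u‖ ^ 2 := by
      rw [pairing_eq_inner]; exact inner_self_eq_norm_sq (𝕜 := ℂ) _
    rw [hB₀, Complex.add_re, e, norm_sq_H1, mul_add, add_comm]
    refine add_le_add (le_trans ?_ (h.le_re_form_A₀ u)) ?_
    · exact mul_le_mul_of_nonneg_right (min_le_left _ _) (sq_nonneg _)
    · exact mul_le_of_le_one_left (sq_nonneg _) (min_le_right _ _)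
  · set z := (T₀ + load κ ∘L fnL κ) u with hz
    have h1 : ‖z‖ ^ 2 ≤ (d ^ 2 * M₀ + 1) * ‖u‖ * ‖z‖ := by
      have e : ‖z‖ ^ 2 = ‖form A₀ u z + pairing (fn u) (fn z)‖ := by
        rw [← hB₀, ← hz]
        exact (inner_self_eq_norm_sq (𝕜 := ℂ) z).symm.trans (inner_self_re_eq_norm z)
      rw [e, add_mul, add_mul, one_mul]
      refine (norm_add_le _ _).trans (add_le_add ?_ ?_)
      · refine (hM₀.norm_form_le u z).trans ?_
        rw [mul_assoc _ ‖u‖]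
        exact mul_le_mul_of_nonneg_left (mul_le_mul (norm_grad_le u) (norm_grad_le z)
          (norm_nonneg _) (norm_nonneg _)) (by positivity)
      · rw [pairing_eq_inner, mul_comm]
        exact (norm_inner_le_norm _ _).trans (mul_le_mul (norm_fn_le z) (norm_fn_le u)
          (norm_nonneg _) (norm_nonneg _))
    rcases (norm_nonneg z).eq_or_lt with h0 | h0
    · rw [← h0]; positivity
    · rw [sq] at h1
      exact le_of_mul_le_mul_right h1 h0
  · rw [hB₁, div_mul_eq_mul_div, le_div_iff₀' (by positivity)]
    refine (hgap κ u).trans ?_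
    rw [div_mul_eq_mul_div, le_div_iff₀ hν, mul_assoc]
    refine mul_le_mul_of_nonneg_left ?_ hC.le
    rw [mul_comm]; exact h.le_re_form_A₁ u
  · refine ext_inner_left ℂ fun u => ?_
    rw [hB₁, h.form_soft_left hv, inner_zero_right]
  · rw [hB₁, h.form_soft_right hv]

end Admissible

section Correspondence

variable {κ : Space d} {A₀ A₁ : Space d → Matrix (Fin d) (Fin d) ℝ} {B₀ B₁ : H1 κ →L[ℂ] H1 κ}

theorem isSolution_iff {M₀ M₁ : NNReal} (hM₀ : IsBoundedCoeff A₀ M₀) (hM₁ : IsBoundedCoeff A₁ M₁)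
    (hB₀ : ∀ u v, inner ℂ v (B₀ u) = form A₀ u v + pairing (fn u) (fn v))
    (hB₁ : ∀ u v, inner ℂ v (B₁ u) = form A₁ u v) {ε : ℝ} {F : L2 d} {w : H1 κ} :
    IsSolution A₀ A₁ ε F w ↔ ((((ε ^ 2)⁻¹ : ℝ) : ℂ) • B₁ + B₀) w = load κ F := by
  have e : ∀ φ, inner ℂ φ (((((ε ^ 2)⁻¹ : ℝ) : ℂ) • B₁ + B₀) w) =
      form (fun y => (ε ^ 2)⁻¹ • A₁ y + A₀ y) w φ + pairing (fn w) (fn φ) := fun φ => by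
    rw [add_apply, smul_apply, inner_add_right, inner_smul_right, hB₀, hB₁,
      hM₁.form_smul_add hM₀, add_assoc]
  constructor
  · intro hw
    exact ext_inner_left ℂ fun φ => by rw [e, hw φ, inner_load]
  · intro hw φ
    rw [← e, hw, inner_load]

theorem isOuterExpansion_iff
    (hB₀ : ∀ u v, inner ℂ v (B₀ u) = form A₀ u v + pairing (fn u) (fn v))
    (hB₁ : ∀ u v, inner ℂ v (B₁ u) = form A₁ u v) {F : L2 d} {w : ℕ → H1 κ} :
    IsOuterExpansion A₀ A₁ Q₀ F w ↔
      IsFormalExpansion (H10sub κ Q₀) B₀ B₁ (load κ F) w := by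
  constructor
  · rintro ⟨h1, h2, h3, h4⟩
    -- Membership in `H10` and in `H10sub` agree by unfolding, so `h1` and `hv` serve for both.
    refine ⟨h1, fun v hv => ?_, ext_inner_left ℂ fun φ => ?_, fun n hn =>
      ext_inner_left ℂ fun φ => ?_⟩
    · rw [hB₀, inner_load]; exact h2 v hv
    · rw [hB₁, inner_sub_right, inner_load, hB₀, h3]; ring
    · rw [hB₁, inner_neg_right, hB₀, h4 n hn]; ring
  · rintro ⟨h1, h2, h3, h4⟩
    refine ⟨h1, fun φ hφ => ?_, fun φ => ?_, fun n hn φ => ?_⟩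
    · rw [← hB₀, ← inner_load]; exact h2 φ hφ
    · rw [← hB₁, h3, inner_sub_right, inner_load, hB₀]; ring
    · rw [← hB₁, h4 n hn, inner_neg_right, hB₀]; ring

end Correspondence

end DoublePorosity

/-! ### Well-posedness and the error bounds. -/

namespace DoublePorosity
variable {d : ℕ} {Q₀ : Set (Space d)}

namespace Admissible

variable {ν : ℝ} {A₀ A₁ : Space d → Matrix (Fin d) (Fin d) ℝ}

theorem existsUnique_isSolution (h : Admissible ν A₀ A₁ Q₀) {κ : Space d} (hκ : κ ∉ dualLattice d)
    (F : L2 d) {ε : ℝ} (hε : 0 < ε) : ∃! w : H1 κ, IsSolution A₀ A₁ ε F w := by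
  obtain ⟨M₀, hM₀⟩ := exists_isBoundedCoeff h.memLp_A₀
  obtain ⟨M₁, hM₁⟩ := exists_isBoundedCoeff h.memLp_A₁
  obtain ⟨c, M, K, -, hP⟩ := h.exists_isPenaltyPair
  obtain ⟨B₀, B₁, hB, hB₀, hB₁⟩ := hP κ hκ
  simp only [isSolution_iff hM₀ hM₁ hB₀ hB₁]
  exact existsUnique_of_coercive hB.c_pos
    (hB.coercive_sum (t := (ε ^ 2)⁻¹) (by positivity)) _

theorem existsUnique_isOuterExpansion (h : Admissible ν A₀ A₁ Q₀) {κ : Space d}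
    (hκ : κ ∉ dualLattice d) (F : L2 d) :
    ∃! w : ℕ → H1 κ, IsOuterExpansion A₀ A₁ Q₀ F w := by
  obtain ⟨c, M, K, -, hP⟩ := h.exists_isPenaltyPair
  obtain ⟨B₀, B₁, hB, hB₀, hB₁⟩ := hP κ hκ
  simp only [isOuterExpansion_iff hB₀ hB₁]
  exact hB.existsUnique_expansion _

theorem exists_truncation_bound (h : Admissible ν A₀ A₁ Q₀) (N : ℕ) : ∃ C C' : ℝ, 0 < C ∧ 0 < C' ∧
    ∀ κ : Space d, κ ∉ dualLattice d → ∀ ε : ℝ, 0 < ε →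
      ∀ (F : L2 d) (wε : H1 κ) (w : ℕ → H1 κ), IsSolution A₀ A₁ ε F wε →
        IsOuterExpansion A₀ A₁ Q₀ F w →
        ‖wε - truncation ε w (N + 1)‖ ≤
          C * (ε / Metric.infDist κ (dualLattice d)) ^ (2 * (N + 1)) * ‖F‖ ∧
        ε ^ (2 * (N + 1)) * ‖w (N + 1)‖ ≤
          C' * (ε / Metric.infDist κ (dualLattice d)) ^ (2 * (N + 1)) * ‖F‖ := by
  obtain ⟨M₀, hM₀⟩ := exists_isBoundedCoeff h.memLp_A₀
  obtain ⟨M₁, hM₁⟩ := exists_isBoundedCoeff h.memLp_A₁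
  obtain ⟨c, M, K, hK, hP⟩ := h.exists_isPenaltyPair
  set G : ℝ := ((M / c) ^ 2 * K) ^ (N + 1) * (M ^ N * (1 + M / c)) with hG
  -- The signs of `M` and `c` are supplied only by a penalty pair at some κ outside the dual
  -- lattice, so the constants are chosen beforehand with absolute values, and 1 is added for strict
  -- positivity.
  refine ⟨|M / c| * |G| + 1, |G| + 1, by positivity, by positivity,
    fun κ hκ ε hε F wε w hwε hw => ?_⟩
  obtain ⟨B₀, B₁, hB, hB₀, hB₁⟩ := hP κ hκ
  rw [isSolution_iff hM₀ hM₁ hB₀ hB₁] at hwε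
  rw [isOuterExpansion_iff hB₀ hB₁] at hw
  set δ := Metric.infDist κ (dualLattice d)
  have hδ : 0 < δ := infDist_dualLattice_pos hκ
  set X := (ε / δ) ^ (2 * (N + 1)) * ‖F‖ with hX
  have hX0 : 0 ≤ X := by positivity
  have h1 : ε ^ (2 * (N + 1)) * ‖w (N + 1)‖ ≤ |G| * X := by
    have e : ε ^ (2 * (N + 1)) * (((M / c) ^ 2 * (K / δ ^ 2)) ^ (N + 1) *
        (M ^ N * (1 + M / c)) * ‖F‖) = G * X := by
      have e2 : ((M / c) ^ 2 * (K / δ ^ 2)) ^ (N + 1) =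
          ((M / c) ^ 2 * K) ^ (N + 1) / δ ^ (2 * (N + 1)) := by
        rw [pow_mul δ, ← div_pow, mul_div_assoc]
      rw [hX, hG, e2, div_pow]
      ring
    have hMc : 0 ≤ M / c := div_nonneg hB.M_nonneg hB.c_pos.le
    have hM := hB.M_nonneg
    have h2 := (hB.norm_expansion_le hw N).trans
      (mul_le_mul_of_nonneg_left (norm_load_le F) (by positivity))
    calc ε ^ (2 * (N + 1)) * ‖w (N + 1)‖ ≤ _ :=
          mul_le_mul_of_nonneg_left h2 (by positivity)
      _ = G * X := e
      _ ≤ _ := mul_le_mul_of_nonneg_right (le_abs_self G) hX0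
  rw [mul_assoc, mul_assoc (|G| + 1)]
  refine ⟨(hB.norm_sub_truncation_le hw hε hwε N).trans ?_, by linarith⟩
  calc M / c * (ε ^ (2 * (N + 1)) * ‖w (N + 1)‖) ≤ |M / c| * (|G| * X) :=
        mul_le_mul (le_abs_self _) h1 (by positivity) (abs_nonneg _)
    _ ≤ _ := by rw [add_mul, mul_assoc, one_mul]; linarith

end Admissible

end DoublePorosity

theorem theorem8p1 {d : ℕ} (ν : ℝ)
    (A₀ A₁ : DoublePorosity.Space d → Matrix (Fin d) (Fin d) ℝ)
    (Q₀ : Set (DoublePorosity.Space d))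
    (hadm : DoublePorosity.Admissible ν A₀ A₁ Q₀) :
    (∀ κ : DoublePorosity.Space d, κ ∉ DoublePorosity.dualLattice d →
      ∀ F : DoublePorosity.L2 d,
        (∀ ε : ℝ, 0 < ε →
          ∃! w : DoublePorosity.H1 κ, DoublePorosity.IsSolution A₀ A₁ ε F w) ∧
        (∃! w : ℕ → DoublePorosity.H1 κ, DoublePorosity.IsOuterExpansion A₀ A₁ Q₀ F w)) ∧
    (∀ N : ℕ, 1 ≤ N → ∃ C : ℝ, 0 < C ∧
      ∀ κ : DoublePorosity.Space d, κ ∉ DoublePorosity.dualLattice d →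
      ∀ ε : ℝ, 0 < ε →
      ∀ (F : DoublePorosity.L2 d) (wε : DoublePorosity.H1 κ) (w : ℕ → DoublePorosity.H1 κ),
        DoublePorosity.IsSolution A₀ A₁ ε F wε →
        DoublePorosity.IsOuterExpansion A₀ A₁ Q₀ F w →
        ‖wε - DoublePorosity.truncation ε w N‖ ≤
          C * (ε / Metric.infDist κ (DoublePorosity.dualLattice d)) ^ (2 * N) * ‖F‖) ∧
    (∃ C : ℝ, 0 < C ∧
      ∀ κ : DoublePorosity.Space d, κ ∉ DoublePorosity.dualLattice d →
      ∀ ε : ℝ, 0 < ε →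
      ∀ (F : DoublePorosity.L2 d) (wε : DoublePorosity.H1 κ) (w : ℕ → DoublePorosity.H1 κ),
        DoublePorosity.IsSolution A₀ A₁ ε F wε →
        DoublePorosity.IsOuterExpansion A₀ A₁ Q₀ F w →
        ‖wε - w 0‖ ≤
          C * (ε / Metric.infDist κ (DoublePorosity.dualLattice d)) ^ 2 * ‖F‖) := by
  refine ⟨fun κ hκ F => ⟨fun ε hε => hadm.existsUnique_isSolution hκ F hε,
    hadm.existsUnique_isOuterExpansion hκ F⟩, fun N hN => ?_, ?_⟩
  · obtain ⟨n, rfl⟩ := Nat.exists_eq_succ_of_ne_zero (Nat.one_le_iff_ne_zero.1 hN)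
    obtain ⟨C, _, hC, _, h⟩ := hadm.exists_truncation_bound n
    exact ⟨C, hC, fun κ hκ ε hε F wε w h1 h2 => (h κ hκ ε hε F wε w h1 h2).1⟩
  · obtain ⟨C, C', hC, hC', h⟩ := hadm.exists_truncation_bound 0
    -- The bound for N = 1 is combined with that for the dropped term ε²w⁽¹⁾, which has the same
    -- order.
    refine ⟨C + C', by positivity, fun κ hκ ε hε F wε w h1 h2 => ?_⟩
    obtain ⟨e1, e2⟩ := h κ hκ ε hε F wε w h1 h2
    have e3 : wε - w 0 = (wε - DoublePorosity.truncation ε w 1) +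
        ((ε ^ 2 : ℝ) : ℂ) • w 1 := by
      simp only [DoublePorosity.truncation, Finset.sum_range_succ, Finset.sum_range_zero, zero_add,
        mul_zero, pow_zero, Complex.ofReal_one, one_smul, mul_one]
      abel
    simp only [zero_add, mul_one] at e1 e2
    rw [e3, add_mul, add_mul]
    refine (norm_add_le _ _).trans (add_le_add e1 ?_)
    rw [norm_smul, Complex.norm_real, Real.norm_of_nonneg (sq_nonneg ε)]
    exact e2
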